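/- For $t\ge 0$ let $\phi(t)=\sqrt2\,\Gamma(\tfrac{t+1}{2})/\Gamma(\tfrac t2)$ (with $\phi(0)=0$), an increasing bijection of $[0,\infty)$ onto itself. For $T\subset\mathbb R^n$ let $\omega(T)=\mathbb E\big[\sup_{z\in T}\langle g,z\rangle\big]$, $g\sim\mathcal N(0,I_n)$, be its Gaussian width, and let $\mathcal B^n$ be the closed Euclidean unit ball. There is a numerical constant $\gamma>0$ such that the following holds for all $m,n$. Let $x\in\mathbb R^n$ and $w\in\mathbb R^m$ be arbitrary (fixed) vectors and let $f:\mathbb R^n\to\mathbb R$ be a convex function with closed sub-level sets. Let $\mathcal C$ be a cone of descent of $f$ at $x$, that is, a closed cone containing the descent set $\{h: f(x+h)\le f(x)\}$ (for example the tangent cone, the smallest such cone). Let $\eta\ge 0$ and $m_0=\phi^{-1}\big(\omega(\mathcal C\cap\mathcal B^n)+\eta\big)$. Let $A\in\mathbb R^{m\times n}$ have independent $\mathcal N(0,1)$ entries and let $y=Ax+w$. Let $\mathcal K=\{z: f(z)\le f(x)\}$, let $\mathcal P_{\mathcal K}$ be the Euclidean projection onto $\mathcal K$, and consider projected gradient descent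 $$z_{0}=0,\qquad z_{\tau+1}=\mathcal P_{\mathcal K}\big(z_\tau+\mu A^{*}(y-Az_\tau)\big),\qquad \mu=\frac{0.99}{(\sqrt m+\sqrt n)^2}.$$ If $m>m_0$, then with probability at least $1-2e^{-\eta^2/2}-e^{-\gamma n}$ the iterates satisfy, for all $\tau=0,1,2,\dots$ simultaneously, $$\|z_\tau-x\|_{2}\le\Big(1-\frac{0.3}{m+n}\big(\sqrt m-\sqrt{m_0}\big)^2\Big)^{\tau}\|x\|_{2}+\frac{3.5}{\big(1-\sqrt{m_0/m}\big)^2}\,\frac{\sqrt{m_0}}{m}\,\|w\|_{2}.$$ -/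

import Mathlib

open MeasureTheory ProbabilityTheory

namespace PGD

noncomputable section

/-- `ℝⁿ` with the Euclidean norm. -/
abbrev E (n : ℕ) : Type := EuclideanSpace ℝ (Fin n)

/-- A proper function: all sub-level sets are closed. -/
def IsProper {n : ℕ} (f : E n → ℝ) : Prop :=
  ∀ r : ℝ, IsClosed {z : E n | f z ≤ r}

/-- The set of descent `{h : f (x + h) ≤ f x}`. -/
def descentSet {n : ℕ} (f : E n → ℝ) (x : E n) : Set (E n) :=
  {h | f (x + h) ≤ f x}

/-- `C` is a cone of descent of `f` at `x`: a closed cone that contains the descent set.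
The tangent cone is the smallest such `C`. No convexity of `C` is asked for. -/
structure IsDescentCone {n : ℕ} (f : E n → ℝ) (x : E n) (C : Set (E n)) : Prop where
  isClosed : IsClosed C
  smul_mem : ∀ c : ℝ, 0 ≤ c → ∀ v ∈ C, c • v ∈ C
  descentSet_subset : descentSet f x ⊆ C

/-- The Gaussian width `𝔼 sup_{z ∈ T} ⟨g, z⟩`, where `g` is a standard Gaussian vector. -/
def gaussianWidth {n : ℕ} (T : Set (E n)) : ℝ :=
  ∫ g : E n, sSup ((fun z : E n => inner ℝ g z) '' T) ∂(stdGaussian (E n))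

/-- `φ(t) = √2 Γ((t+1)/2) / Γ(t/2)` for `t ≥ 0`. -/
def phi (t : ℝ) : ℝ :=
  √2 * Real.Gamma ((t + 1) / 2) / Real.Gamma (t / 2)

/-- The formula for `phi` at `0` gives the limiting value `φ(0) = 0`
(since `1 / Γ` vanishes at `0`), so that `phi` maps `[0, ∞)` bijectively onto itself. -/
theorem phi_zero : phi 0 = 0 := by
  simp [phi, Real.Gamma_zero]

/-- The phase transition function `φ⁻¹(ω(C ∩ Bⁿ) + η)`, where `Bⁿ` is the closed unit ball
and `φ⁻¹` is the inverse of `φ : [0, ∞) → [0, ∞)`. -/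
def phaseTransition {n : ℕ} (C : Set (E n)) (η : ℝ) : ℝ :=
  Function.invFunOn phi (Set.Ici 0) (gaussianWidth (C ∩ Metric.closedBall 0 1) + η)

/-- The Euclidean projection `argmin_{p ∈ K} ‖v - p‖`, for a nonempty closed set `K`.
It is unique for convex `K`. -/
def proj {n : ℕ} (K : Set (E n)) (v : E n) : E n :=
  Classical.epsilon fun p : E n => p ∈ K ∧ ∀ q ∈ K, ‖v - p‖ ≤ ‖v - q‖

/-- The iterates of projected gradient descent, started at `0`:
`z_{τ+1} = P_K (z_τ + μ Aᵀ (y - A z_τ))`. -/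
def pgd {m n : ℕ} (K : Set (E n)) (μ : ℝ) (A : Matrix (Fin m) (Fin n) ℝ) (y : E m) : ℕ → E n
  | 0 => 0
  | τ + 1 =>
      proj K (pgd K μ A y τ +
        μ • A.transpose.toEuclideanLin (y - A.toEuclideanLin (pgd K μ A y τ)))

/-- A Gaussian map: a random `m × n` matrix with independent `N(0,1)` entries. -/
structure IsGaussianMap {Ω : Type*} [MeasurableSpace Ω] (P : Measure Ω) {m n : ℕ}
    (A : Ω → Matrix (Fin m) (Fin n) ℝ) : Prop where
  hasLaw : ∀ i j, HasLaw (fun s => A s i j) (gaussianReal 0 1) P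
  indep : iIndepFun (fun (ij : Fin m × Fin n) (s : Ω) => A s ij.1 ij.2) P

end

end PGD

namespace PGD

open Filter Topology Set

/-! ### The function `phi` -/

/-! The proof isolates four properties of `A` that force convergence, then shows that each fails
with small probability. With `ω` the width of `C ∩ Bⁿ`, `φ(m₀) = ω + η` and `s = φ(m) - φ(m₀)`, they
are: `‖Av‖ ≥ s` for unit `v ∈ C`; `‖Ax‖ ≥ s‖x‖`; `⟨w, Av⟩ ≤ 2 φ(m₀) ‖w‖` for unit `v ∈ C`; and `‖A‖
≤ 1.005 (√m + √n)`.

Deterministic part (`norm_pgd_sub_le`). The norm bound makes `I - μ A*A` positive semidefinite. Put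
`u = z_{τ+1} - x` and `v = z_τ - x`. The obtuse-angle property of the projection onto the convex set
`K ∋ x` gives `‖u‖² ≤ ⟨u, (I - μ A*A) v⟩ + μ ⟨w, Au⟩`. Cauchy–Schwarz for the semidefinite form
(`inner_sub_mul_inner_le`) needs only its diagonal values at `u` and at `v`, so `C` need not be
convex. The result is `‖u‖ ≤ (1 - μ s²) ‖v‖ + 2 μ φ(m₀) ‖w‖`, a contraction with noise floor `2
φ(m₀) ‖w‖ / s²`. The numerical constants come from `s ≥ √(2/π) (√m - √m₀)`, a consequence of the
monotonicity of `φ(t)²/t`.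

Probabilistic part. Gaussian interpolation along `cos θ X + sin θ Y` has as derivative a
covariance-weighted second derivative. It is used twice: for the sharp Laplace bound `𝔼 e^{sf} ≤
e^{s 𝔼f + s²/2}` for 1-Lipschitz `f` (`lintegral_exp_le_of_lipschitz`), and for Gordon's min-max
comparison (`gordon_lintegral_exp_le`). Gordon compares `⟨u, Av⟩ + g` with `⟨g, u⟩ - ⟨h, v⟩`. At the
level of Laplace transforms the auxiliary Gaussian contributes a factor `e^{s²/2}` that divides out,
and a Chernoff bound leaves exactly `e^{-t²/2}` (`measure_minmax_matOf_le`). All four estimates on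
`A` are instances of this bound.

The failure probabilities are `e^{-η²/2}`, `e^{-(ω+η)²/2}`, `e^{-(ω+2η)²/2}` and `e^{-γn}`. The two
in the middle together are at most `e^{-η²/2}` when the claim is not vacuous, because `ω ≥ φ(1)/2`
as soon as `C ≠ {0}` (`exp_add_exp_le`). -/

theorem gammaSeq_ratio {x : ℝ} (hx : 0 < x) {n : ℕ} (hn : n ≠ 0) :
    Real.GammaSeq (x + 1 / 2) n ^ 2 / (Real.GammaSeq x n * Real.GammaSeq (x + 1) n) =
      ∏ j ∈ Finset.range (n + 1), (1 - 1 / 4 / (x + 1 / 2 + j) ^ 2) := by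
  have hn' : (0 : ℝ) < n := by positivity
  have hpow : ((n : ℝ) ^ (x + 1 / 2)) ^ 2 = (n : ℝ) ^ x * (n : ℝ) ^ (x + 1) := by
    rw [← Real.rpow_natCast, ← Real.rpow_mul hn'.le, ← Real.rpow_add hn']
    congr 1
    push_cast
    ring
  have hfac : (n.factorial : ℝ) ≠ 0 := by positivity
  have h1 : ∏ j ∈ Finset.range (n + 1), (x + 1 / 2 + (j : ℝ)) ≠ 0 :=
    Finset.prod_ne_zero_iff.2 fun j _ => by positivity
  have h2 : ∏ j ∈ Finset.range (n + 1), (x + (j : ℝ)) ≠ 0 :=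
    Finset.prod_ne_zero_iff.2 fun j _ => by positivity
  have h3 : ∏ j ∈ Finset.range (n + 1), (x + 1 + (j : ℝ)) ≠ 0 :=
    Finset.prod_ne_zero_iff.2 fun j _ => by positivity
  have hp1 : (n : ℝ) ^ x ≠ 0 := by positivity
  have hp2 : (n : ℝ) ^ (x + 1) ≠ 0 := by positivity
  -- This is the factorisation `(y + 1/2)² - 1/4 = y (y + 1)` with `y = x + j`.
  have hR : ∏ j ∈ Finset.range (n + 1), (1 - 1 / 4 / (x + 1 / 2 + (j : ℝ)) ^ 2) =
      (∏ j ∈ Finset.range (n + 1), (x + (j : ℝ))) * (∏ j ∈ Finset.range (n + 1), (x + 1 + (j : ℝ))) /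
        (∏ j ∈ Finset.range (n + 1), (x + 1 / 2 + (j : ℝ))) ^ 2 := by
    rw [← Finset.prod_mul_distrib, ← Finset.prod_pow, ← Finset.prod_div_distrib]
    refine Finset.prod_congr rfl fun j _ => ?_
    have : (x + 1 / 2 + (j : ℝ)) ≠ 0 := by positivity
    field_simp
    ring
  rw [hR]
  simp only [Real.GammaSeq, div_pow, mul_pow, hpow]
  field_simp

/-- `phi t ^ 2 / t` in terms of `x = t / 2`. -/
noncomputable def gammaRatio (x : ℝ) : ℝ :=
  Real.Gamma (x + 1 / 2) ^ 2 / (Real.Gamma x * Real.Gamma (x + 1))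

/-- Euler's limit formula turns the Gamma quotient into an infinite product whose factors lie in
`[0, 1]` and increase with `x`; both monotonicity and the bound by `1` are then read off factor by
factor. -/
theorem tendsto_gammaRatio {x : ℝ} (hx : 0 < x) :
    Tendsto (fun n : ℕ => ∏ j ∈ Finset.range (n + 1), (1 - 1 / 4 / (x + 1 / 2 + (j : ℝ)) ^ 2))
      atTop (𝓝 (gammaRatio x)) := by
  have h : Tendsto (fun n : ℕ => Real.GammaSeq (x + 1 / 2) n ^ 2 /
      (Real.GammaSeq x n * Real.GammaSeq (x + 1) n)) atTop (𝓝 (gammaRatio x)) := by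
    refine ((Real.GammaSeq_tendsto_Gamma _).pow 2).div
      ((Real.GammaSeq_tendsto_Gamma _).mul (Real.GammaSeq_tendsto_Gamma _)) ?_
    exact mul_ne_zero (Real.Gamma_pos_of_pos hx).ne' (Real.Gamma_pos_of_pos (by linarith)).ne'
  refine h.congr' ?_
  filter_upwards [eventually_ne_atTop 0] with n hn using gammaSeq_ratio hx hn

theorem gammaRatio_factor_nonneg {x : ℝ} (hx : 0 < x) (j : ℕ) :
    0 ≤ 1 - 1 / 4 / (x + 1 / 2 + (j : ℝ)) ^ 2 := by
  have h : (1 / 4 : ℝ) ≤ (x + 1 / 2 + (j : ℝ)) ^ 2 := by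
    have : (0 : ℝ) ≤ j := by positivity
    nlinarith
  have := div_le_one_of_le₀ h (by positivity)
  linarith

theorem gammaRatio_mono {x y : ℝ} (hx : 0 < x) (hxy : x ≤ y) : gammaRatio x ≤ gammaRatio y := by
  refine le_of_tendsto_of_tendsto' (tendsto_gammaRatio hx) (tendsto_gammaRatio (hx.trans_le hxy)) ?_
  intro n
  refine Finset.prod_le_prod (fun j _ => gammaRatio_factor_nonneg hx j) fun j _ => ?_
  gcongr

theorem gammaRatio_le_one {x : ℝ} (hx : 0 < x) : gammaRatio x ≤ 1 := by
  refine le_of_tendsto' (tendsto_gammaRatio hx) fun n => ?_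
  refine Finset.prod_le_one (fun j _ => gammaRatio_factor_nonneg hx j) fun j _ => ?_
  have : 0 ≤ 1 / 4 / (x + 1 / 2 + (j : ℝ)) ^ 2 := by positivity
  linarith

theorem phi_sq {t : ℝ} (ht : 0 < t) : phi t ^ 2 = t * gammaRatio (t / 2) := by
  have h1 : Real.Gamma (t / 2) ≠ 0 := (Real.Gamma_pos_of_pos (by linarith)).ne'
  have h2 : Real.Gamma (t / 2 + 1) = t / 2 * Real.Gamma (t / 2) := Real.Gamma_add_one (by positivity)
  have h3 : (t + 1) / 2 = t / 2 + 1 / 2 := by ring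
  have ht' := ht.ne'
  rw [phi, gammaRatio, h2, h3, div_pow, mul_pow, Real.sq_sqrt (by norm_num)]
  field_simp

theorem phi_nonneg {t : ℝ} (ht : 0 ≤ t) : 0 ≤ phi t := by
  rcases ht.eq_or_lt with rfl | ht
  · rw [phi_zero]
  · have h1 := Real.Gamma_pos_of_pos (show 0 < t / 2 by linarith)
    have h2 := Real.Gamma_pos_of_pos (show 0 < (t + 1) / 2 by linarith)
    unfold phi
    positivity

theorem phi_eq_sqrt_mul {t : ℝ} (ht : 0 ≤ t) : phi t = √t * √(gammaRatio (t / 2)) := by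
  rcases ht.eq_or_lt with rfl | h
  · simp [phi_zero]
  · rw [← Real.sqrt_mul ht, ← phi_sq h, Real.sqrt_sq (phi_nonneg ht)]

theorem phi_le_sqrt {t : ℝ} (ht : 0 ≤ t) : phi t ≤ √t := by
  rcases ht.eq_or_lt with rfl | h
  · simp [phi_zero]
  · rw [phi_eq_sqrt_mul ht]
    exact mul_le_of_le_one_right (Real.sqrt_nonneg _)
      (Real.sqrt_le_one.2 (gammaRatio_le_one (by linarith)))

theorem gammaRatio_half : gammaRatio (1 / 2) = 2 / Real.pi := by
  have h : Real.Gamma (1 / 2 + 1) = 1 / 2 * Real.Gamma (1 / 2) := Real.Gamma_add_one (by norm_num)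
  rw [gammaRatio, h, Real.Gamma_one_half_eq]
  norm_num
  have := Real.pi_pos
  rw [show (√Real.pi)⁻¹ * 2 * (√Real.pi)⁻¹ = 2 / (√Real.pi * √Real.pi) by field_simp,
    Real.mul_self_sqrt this.le]

/-- In `φ(t) = √t √(gammaRatio (t/2))` the second factor increases, so the difference is at least
`(√b - √a)` times its value at `b`, which for `b ≥ 1` is at least its value `√(2/π)` at `1`. -/
theorem sqrt_two_div_pi_mul_le_phi_sub {a b : ℝ} (ha : 0 ≤ a) (hab : a ≤ b) (hb : 1 ≤ b) :
    √(2 / Real.pi) * (√b - √a) ≤ phi b - phi a := by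
  have hb0 : 0 ≤ b := by linarith
  have h1 : √(2 / Real.pi) ≤ √(gammaRatio (b / 2)) := by
    rw [← gammaRatio_half]
    exact Real.sqrt_le_sqrt (gammaRatio_mono (by norm_num) (by linarith))
  have h2 : phi a ≤ √a * √(gammaRatio (b / 2)) := by
    rcases ha.eq_or_lt with rfl | h
    · simp [phi_zero]
    · rw [phi_eq_sqrt_mul ha]
      gcongr
      exact gammaRatio_mono (by linarith) (by linarith)
  have h3 : √a ≤ √b := Real.sqrt_le_sqrt hab
  rw [phi_eq_sqrt_mul hb0]
  nlinarith

theorem continuousOn_phi : ContinuousOn phi (Ici 0) := by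
  intro t ht
  rcases (mem_Ici.1 ht).eq_or_lt with rfl | h
  · rw [ContinuousWithinAt, phi_zero]
    have hs : Tendsto (fun t : ℝ => √t) (𝓝[Ici 0] 0) (𝓝 0) := by
      have := (Real.continuous_sqrt.tendsto 0).mono_left (nhdsWithin_le_nhds (s := Ici 0))
      simpa using this
    -- `Γ(t/2)` has a pole at `0`, so continuity there comes from squeezing `0 ≤ φ(t) ≤ √t`.
    refine tendsto_of_tendsto_of_tendsto_of_le_of_le' tendsto_const_nhds hs ?_ ?_
    · filter_upwards [self_mem_nhdsWithin] with t ht using phi_nonneg ht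
    · filter_upwards [self_mem_nhdsWithin] with t ht using phi_le_sqrt ht
  · have hG : ∀ s : ℝ, 0 < s → ContinuousAt Real.Gamma s := fun s hs =>
      (Real.differentiableAt_Gamma fun m => by
        have : (0 : ℝ) ≤ m := by positivity
        linarith).continuousAt
    refine ContinuousAt.continuousWithinAt ?_
    unfold phi
    refine ContinuousAt.div (continuousAt_const.mul ?_) ?_ (Real.Gamma_pos_of_pos (by linarith)).ne'
    · exact ContinuousAt.comp (f := fun t : ℝ => (t + 1) / 2) (hG _ (by linarith)) (by fun_prop)
    · exact ContinuousAt.comp (f := fun t : ℝ => t / 2) (hG _ (by linarith)) (by fun_prop)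

theorem surjOn_phi : SurjOn phi (Ici 0) (Ici 0) := by
  intro y hy
  have hy : 0 ≤ y := hy
  have hpi := Real.pi_pos
  -- Chosen so that `√(2/π) √b ≥ y`; the summand `1` secures `b ≥ 1`.
  set b : ℝ := 1 + y ^ 2 * (Real.pi / 2) with hb
  have hb1 : 1 ≤ b := by rw [hb]; nlinarith [sq_nonneg y]
  have h1 : y ≤ phi b := by
    have h := sqrt_two_div_pi_mul_le_phi_sub le_rfl (by linarith : (0 : ℝ) ≤ b) hb1
    rw [phi_zero, Real.sqrt_zero, sub_zero, sub_zero, ← Real.sqrt_mul (by positivity)] at h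
    refine le_trans (Real.le_sqrt_of_sq_le ?_) h
    rw [hb]
    field_simp
    linarith
  have := intermediate_value_Icc (by linarith : (0 : ℝ) ≤ b)
    (continuousOn_phi.mono Icc_subset_Ici_self)
  obtain ⟨t, ht, rfl⟩ := this ⟨by rw [phi_zero]; exact hy, h1⟩
  exact ⟨t, ht.1, rfl⟩

/-! ### Gaussian integration by parts -/

/-- The standard Gaussian measure on `ι → ℝ`. -/
noncomputable abbrev gaussPi (ι : Type*) [Fintype ι] : Measure (ι → ℝ) :=
  Measure.pi fun _ : ι => gaussianReal 0 1

theorem measurable_update_fst_snd {ι : Type*} [DecidableEq ι] (i : ι) :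
    Measurable fun p : (ι → ℝ) × ℝ => Function.update p.1 i p.2 := by
  rw [measurable_pi_iff]
  intro j
  by_cases hj : j = i
  · subst hj; simpa using measurable_snd
  · simp only [Function.update_of_ne hj]
    exact (measurable_pi_apply j).comp measurable_fst

/-- Resampling one coordinate independently preserves the product law. This reduces integration by
parts in coordinate `i` to one dimension. -/
theorem map_update_gaussPi {ι : Type*} [Fintype ι] [DecidableEq ι] (i : ι) :
    ((gaussPi ι).prod (gaussianReal 0 1)).map (fun p => Function.update p.1 i p.2) =
      gaussPi ι := by
  refine (Measure.pi_eq fun s hs => ?_).symm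
  have hm : Measurable fun p : (ι → ℝ) × ℝ => Function.update p.1 i p.2 :=
    measurable_update_fst_snd i
  rw [Measure.map_apply hm (MeasurableSet.univ_pi hs)]
  have : (fun p : (ι → ℝ) × ℝ => Function.update p.1 i p.2) ⁻¹' (univ.pi s) =
      (univ.pi (Function.update s i univ)) ×ˢ (s i) := by
    ext p
    simp only [mem_preimage, Set.mem_pi, mem_univ, true_imp_iff, mem_prod]
    constructor
    · intro h
      refine ⟨fun j => ?_, by simpa using h i⟩
      by_cases hj : j = i
      · subst hj; simp
      · simpa [Function.update_of_ne hj] using h j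
    · rintro ⟨h1, h2⟩ j
      by_cases hj : j = i
      · subst hj; simpa using h2
      · simpa [Function.update_of_ne hj] using h1 j
  rw [this, Measure.prod_prod, Measure.pi_pi, ← Finset.prod_erase_mul _ _ (Finset.mem_univ i),
    ← Finset.prod_erase_mul (a := i) _ (fun j => gaussianReal 0 1 (s j)) (Finset.mem_univ i)]
  congr 1
  simp only [Function.update_self, measure_univ, mul_one]
  refine Finset.prod_congr rfl fun j hj => ?_
  rw [Function.update_of_ne (Finset.ne_of_mem_erase hj)]

theorem measurePreserving_update_gaussPi {ι : Type*} [Fintype ι] [DecidableEq ι] (i : ι) :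
    MeasurePreserving (fun p : (ι → ℝ) × ℝ => Function.update p.1 i p.2)
      ((gaussPi ι).prod (gaussianReal 0 1)) (gaussPi ι) :=
  ⟨measurable_update_fst_snd i, map_update_gaussPi i⟩

/-- The density satisfies `p' = -t p`, so this is integration by parts on the line. -/
theorem integral_mul_gaussianReal {H H' : ℝ → ℝ} {C : ℝ} (hd : ∀ t, HasDerivAt H (H' t) t)
    (hH : ∀ t, |H t| ≤ C) (hH' : ∀ t, |H' t| ≤ C) (hc : Continuous H') :
    ∫ t, t * H t ∂(gaussianReal 0 1) = ∫ t, H' t ∂(gaussianReal 0 1) := by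
  have hHc : Continuous H := continuous_iff_continuousAt.2 fun t => (hd t).continuousAt
  rw [integral_gaussianReal_eq_integral_smul one_ne_zero,
    integral_gaussianReal_eq_integral_smul one_ne_zero]
  have hpc : Continuous (gaussianPDFReal 0 1) := by
    unfold gaussianPDFReal; fun_prop
  have hp : ∀ t, HasDerivAt (gaussianPDFReal 0 1) (-(t * gaussianPDFReal 0 1 t)) t := by
    intro t
    unfold gaussianPDFReal
    have h1 : HasDerivAt (fun x : ℝ => -(x - 0) ^ 2 / (2 * ((1 : NNReal) : ℝ))) (-t) t := by
      have := (((hasDerivAt_id t).sub_const 0).pow 2).neg.div_const (2 * ((1 : NNReal) : ℝ))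
      refine this.congr_deriv ?_
      simp
      ring
    refine ((h1.exp).const_mul _).congr_deriv ?_
    ring
  have hpi : Integrable (gaussianPDFReal 0 1) := integrable_gaussianPDFReal 0 1
  have hxp : Integrable fun t => t * gaussianPDFReal 0 1 t := by
    have h := (integrable_mul_exp_neg_mul_sq (b := 1 / 2) (by norm_num)).const_mul
      ((√(2 * Real.pi * ((1 : NNReal) : ℝ)))⁻¹)
    refine h.congr (ae_of_all _ fun t => ?_)
    simp only [gaussianPDFReal]
    rw [show -(t - 0) ^ 2 / (2 * ((1 : NNReal) : ℝ)) = -(1 / 2) * t ^ 2 by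
      simp; ring]
    ring
  have key := integral_mul_deriv_eq_deriv_mul_of_integrable (u := H) (u' := H')
    (v := gaussianPDFReal 0 1) (v' := fun t => -(t * gaussianPDFReal 0 1 t))
    (fun t _ => hd t) (fun t _ => hp t) ?_ ?_ ?_
  · have e1 : ∀ t, gaussianPDFReal 0 1 t • (t * H t) =
        -(H t * -(t * gaussianPDFReal 0 1 t)) := fun t => by
      simp only [smul_eq_mul]; ring
    simp_rw [e1]
    rw [integral_neg, key, neg_neg]
    refine integral_congr_ae (ae_of_all _ fun t => ?_)
    simp [mul_comm]
  · exact hxp.neg.bdd_mul hHc.aestronglyMeasurable (ae_of_all _ hH)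
  · exact hpi.bdd_mul hc.aestronglyMeasurable (ae_of_all _ hH')
  · exact hpi.bdd_mul hHc.aestronglyMeasurable (ae_of_all _ hH)

theorem map_ofLp_stdGaussian (ι : Type*) [Fintype ι] :
    (stdGaussian (EuclideanSpace ℝ ι)).map (EuclideanSpace.equiv ι ℝ : _ →L[ℝ] (ι → ℝ)) =
      gaussPi ι := by
  rw [← map_pi_eq_stdGaussian, Measure.map_map (by fun_prop) (by fun_prop)]
  exact Measure.map_id

instance isGaussian_gaussPi (ι : Type*) [Fintype ι] : IsGaussian (gaussPi ι) := by
  rw [← map_ofLp_stdGaussian]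
  infer_instance

theorem integrable_norm_gaussPi (ι : Type*) [Fintype ι] :
    Integrable (fun x : ι → ℝ => ‖x‖) (gaussPi ι) :=
  (IsGaussian.integrable_id (μ := gaussPi ι)).norm

theorem integral_coord_mul_gaussPi {ι : Type*} [Fintype ι] [DecidableEq ι] (i : ι)
    {H H' : (ι → ℝ) → ℝ} {C : ℝ}
    (hd : ∀ x t, HasDerivAt (fun t => H (Function.update x i t)) (H' (Function.update x i t)) t)
    (hH : ∀ x, |H x| ≤ C) (hH' : ∀ x, |H' x| ≤ C) (hc : Continuous H) (hc' : Continuous H') :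
    ∫ x, x i * H x ∂(gaussPi ι) = ∫ x, H' x ∂(gaussPi ι) := by
  have mp := measurePreserving_update_gaussPi i
  have hi : Integrable (fun x => x i * H x) (gaussPi ι) := by
    have h0 : Integrable (fun x : ι → ℝ => x i) (gaussPi ι) :=
      (integrable_norm_gaussPi ι).mono' (continuous_apply i).aestronglyMeasurable (ae_of_all _ fun x => norm_le_pi_norm x i)
    exact h0.mul_bdd hc.aestronglyMeasurable (ae_of_all _ hH)
  have hi' : Integrable H' (gaussPi ι) :=
    (integrable_const C).mono' hc'.aestronglyMeasurable (ae_of_all _ hH')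
  rw [← mp.map_eq, integral_map mp.measurable.aemeasurable (by rw [mp.map_eq]; exact hi.1),
    integral_map mp.measurable.aemeasurable (by rw [mp.map_eq]; exact hi'.1),
    integral_prod (fun p : (ι → ℝ) × ℝ => Function.update p.1 i p.2 i *
      H (Function.update p.1 i p.2)) (mp.integrable_comp_of_integrable hi),
    integral_prod (fun p : (ι → ℝ) × ℝ => H' (Function.update p.1 i p.2))
      (mp.integrable_comp_of_integrable hi')]
  refine integral_congr_ae (ae_of_all _ fun x => ?_)
  simp only [Function.update_self]
  refine integral_mul_gaussianReal (hd x) (fun t => hH _) (fun t => hH' _) ?_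
  exact hc'.comp (by fun_prop)

/-! ### Gaussian interpolation -/

/-- Twice continuously differentiable functions that are bounded along with their first two
derivatives. -/
structure BddC2 {W : Type*} [NormedAddCommGroup W] [NormedSpace ℝ W] (F : W → ℝ) : Prop where
  contDiff : ContDiff ℝ 2 F
  bdd : ∃ C, ∀ x, |F x| ≤ C ∧ ‖fderiv ℝ F x‖ ≤ C ∧ ‖fderiv ℝ (fderiv ℝ F) x‖ ≤ C

section

variable {W : Type*} [NormedAddCommGroup W] [NormedSpace ℝ W] {F : W → ℝ}

theorem BddC2.differentiable (hF : BddC2 F) : Differentiable ℝ F :=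
  hF.contDiff.differentiable (by norm_num)

theorem BddC2.contDiff_fderiv (hF : BddC2 F) : ContDiff ℝ 1 (fderiv ℝ F) :=
  hF.contDiff.fderiv_right (by norm_num)

theorem BddC2.differentiable_fderiv (hF : BddC2 F) : Differentiable ℝ (fderiv ℝ F) :=
  hF.contDiff_fderiv.differentiable (by norm_num)

theorem BddC2.continuous_fderiv_fderiv (hF : BddC2 F) : Continuous (fderiv ℝ (fderiv ℝ F)) :=
  hF.contDiff_fderiv.continuous_fderiv (by norm_num)

theorem eq_sum_smul_single {ι : Type*} [Fintype ι] [DecidableEq ι] (x : ι → ℝ) :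
    x = ∑ i, x i • (Pi.single i 1 : ι → ℝ) := by
  simpa [Pi.single_apply] using (pi_eq_sum_univ' x)

/-- Expand `M x` in coordinates and integrate each `xᵢ` by parts: differentiating `L x` in the
direction `i` produces `L eᵢ`. -/
theorem integral_fderiv_apply_gaussPi {ι : Type*} [Fintype ι] [DecidableEq ι] (hF : BddC2 F)
    (L M : (ι → ℝ) →L[ℝ] W) :
    ∫ x, fderiv ℝ F (L x) (M x) ∂(gaussPi ι) =
      ∫ x, ∑ i, fderiv ℝ (fderiv ℝ F) (L x) (L (Pi.single i 1)) (M (Pi.single i 1))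
        ∂(gaussPi ι) := by
  obtain ⟨C, hC⟩ := hF.bdd
  have hC0 : 0 ≤ C := (abs_nonneg _).trans (hC 0).1
  have e : ∀ x, fderiv ℝ F (L x) (M x) =
      ∑ i, x i * fderiv ℝ F (L x) (M (Pi.single i 1)) := by
    intro x
    conv_lhs => rw [eq_sum_smul_single x, map_sum M, map_sum, ← eq_sum_smul_single x]
    simp
  have c1 : ∀ i : ι, Continuous fun x => fderiv ℝ F (L x) (M (Pi.single i 1)) := fun i =>
    (hF.contDiff_fderiv.continuous.comp L.continuous).clm_apply continuous_const
  have c2 : ∀ i : ι, Continuous fun x =>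
      fderiv ℝ (fderiv ℝ F) (L x) (L (Pi.single i 1)) (M (Pi.single i 1)) := fun i =>
    ((hF.continuous_fderiv_fderiv.comp L.continuous).clm_apply continuous_const).clm_apply
      continuous_const
  have b1 : ∀ (i : ι) x, |fderiv ℝ F (L x) (M (Pi.single i 1))| ≤ C * ‖M (Pi.single i 1)‖ :=
    fun i x => ((fderiv ℝ F (L x)).le_opNorm _).trans
      (mul_le_mul_of_nonneg_right (hC _).2.1 (norm_nonneg _))
  have b2 : ∀ (i : ι) x, |fderiv ℝ (fderiv ℝ F) (L x) (L (Pi.single i 1)) (M (Pi.single i 1))| ≤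
      C * ‖L (Pi.single i 1)‖ * ‖M (Pi.single i 1)‖ := fun i x =>
    ((fderiv ℝ (fderiv ℝ F) (L x)).le_opNorm₂ _ _).trans (by gcongr; exact (hC _).2.2)
  have hi1 : ∀ i : ι, Integrable (fun x => x i * fderiv ℝ F (L x) (M (Pi.single i 1)))
      (gaussPi ι) := by
    intro i
    have h0 : Integrable (fun x : ι → ℝ => x i) (gaussPi ι) :=
      (integrable_norm_gaussPi ι).mono' (continuous_apply i).aestronglyMeasurable
        (ae_of_all _ fun x => norm_le_pi_norm x i)
    exact h0.mul_bdd (c1 i).aestronglyMeasurable (ae_of_all _ (b1 i))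
  have hi2 : ∀ i : ι, Integrable (fun x =>
      fderiv ℝ (fderiv ℝ F) (L x) (L (Pi.single i 1)) (M (Pi.single i 1))) (gaussPi ι) := fun i =>
    (integrable_const _).mono' (c2 i).aestronglyMeasurable (ae_of_all _ (b2 i))
  simp_rw [e]
  rw [integral_finsetSum _ fun i _ => hi1 i, integral_finsetSum _ fun i _ => hi2 i]
  refine Finset.sum_congr rfl fun i _ => ?_
  refine integral_coord_mul_gaussPi i
    (C := max (C * ‖M (Pi.single i 1)‖) (C * ‖L (Pi.single i 1)‖ * ‖M (Pi.single i 1)‖)) ?_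
    (fun x => (b1 i x).trans (le_max_left _ _)) (fun x => (b2 i x).trans (le_max_right _ _))
    (c1 i) (c2 i)
  intro x t
  have h1 : HasDerivAt (fun t => L (Function.update x i t)) (L (Pi.single i 1)) t :=
    L.hasFDerivAt.comp_hasDerivAt t (hasDerivAt_update x i t)
  have h2 := (hF.differentiable_fderiv (L (Function.update x i t))).hasFDerivAt.comp_hasDerivAt t h1
  exact h2.clm_apply (hasDerivAt_const t (M (Pi.single i 1))) |>.congr_deriv (by simp)

end

/-! ### The interpolation path and its derivative. -/

section

/-- Restriction to the left summand. -/
def resInl (ι κ : Type*) : (ι ⊕ κ → ℝ) →L[ℝ] (ι → ℝ) :=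
  ContinuousLinearMap.pi fun i => ContinuousLinearMap.proj (Sum.inl i)

/-- Restriction to the right summand. -/
def resInr (ι κ : Type*) : (ι ⊕ κ → ℝ) →L[ℝ] (κ → ℝ) :=
  ContinuousLinearMap.pi fun i => ContinuousLinearMap.proj (Sum.inr i)

@[simp] theorem resInl_apply {ι κ : Type*} (x : ι ⊕ κ → ℝ) (i : ι) :
    resInl ι κ x i = x (Sum.inl i) := rfl

@[simp] theorem resInr_apply {ι κ : Type*} (x : ι ⊕ κ → ℝ) (i : κ) :
    resInr ι κ x i = x (Sum.inr i) := rfl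

variable {ι κ : Type*} [Fintype ι] [Fintype κ]

theorem measurePreserving_res :
    MeasurePreserving (fun x => (resInl ι κ x, resInr ι κ x)) (gaussPi (ι ⊕ κ))
      ((gaussPi ι).prod (gaussPi κ)) :=
  measurePreserving_sumPiEquivProdPi (fun _ : ι ⊕ κ => gaussianReal 0 1)

theorem measurePreserving_resInl :
    MeasurePreserving (resInl ι κ) (gaussPi (ι ⊕ κ)) (gaussPi ι) :=
  measurePreserving_fst.comp measurePreserving_res

theorem measurePreserving_resInr :
    MeasurePreserving (resInr ι κ) (gaussPi (ι ⊕ κ)) (gaussPi κ) :=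
  measurePreserving_snd.comp measurePreserving_res

variable {W : Type*} [NormedAddCommGroup W] [NormedSpace ℝ W] {F : W → ℝ}

/-- The path `cos θ X + sin θ Y` between the independent Gaussian vectors `X` and `Y`. -/
noncomputable def interp (X : (ι → ℝ) →L[ℝ] W) (Y : (κ → ℝ) →L[ℝ] W) (θ : ℝ) :
    (ι ⊕ κ → ℝ) →L[ℝ] W :=
  Real.cos θ • X.comp (resInl ι κ) + Real.sin θ • Y.comp (resInr ι κ)

/-- The difference of the covariance-weighted second derivatives. -/
noncomputable def hessGap [DecidableEq ι] [DecidableEq κ] (F : W → ℝ) (X : (ι → ℝ) →L[ℝ] W)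
    (Y : (κ → ℝ) →L[ℝ] W) (z : W) : ℝ :=
  ∑ k, fderiv ℝ (fderiv ℝ F) z (Y (Pi.single k 1)) (Y (Pi.single k 1)) -
    ∑ i, fderiv ℝ (fderiv ℝ F) z (X (Pi.single i 1)) (X (Pi.single i 1))

theorem integrable_bddC2_comp (hF : BddC2 F) (L : (ι → ℝ) →L[ℝ] W) :
    Integrable (fun x => F (L x)) (gaussPi ι) := by
  obtain ⟨C, hC⟩ := hF.bdd
  exact (integrable_const C).mono'
    (hF.contDiff.continuous.comp L.continuous).aestronglyMeasurable
    (ae_of_all _ fun x => (hC _).1)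

/-- Differentiating under the integral gives `DF` applied to the velocity of the path, then
integration by parts produces second derivatives. Each basis vector belongs to only one of the two
independent blocks, so no mixed `X`–`Y` terms appear, and both blocks carry the weight `sin θ cos θ`
with opposite signs. -/
theorem hasDerivAt_integral_interp [DecidableEq ι] [DecidableEq κ] (hF : BddC2 F)
    (X : (ι → ℝ) →L[ℝ] W) (Y : (κ → ℝ) →L[ℝ] W) (θ : ℝ) :
    HasDerivAt (fun θ => ∫ x, F (interp X Y θ x) ∂(gaussPi (ι ⊕ κ)))
      (Real.sin θ * Real.cos θ * ∫ x, hessGap F X Y (interp X Y θ x) ∂(gaussPi (ι ⊕ κ))) θ := by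
  obtain ⟨C, hC⟩ := hF.bdd
  have hC0 : 0 ≤ C := (abs_nonneg _).trans (hC 0).1
  -- The velocity of the path `interp X Y`.
  set M : ℝ → (ι ⊕ κ → ℝ) →L[ℝ] W := fun θ =>
    (-Real.sin θ) • X.comp (resInl ι κ) + Real.cos θ • Y.comp (resInr ι κ) with hM
  have hder : ∀ (x : ι ⊕ κ → ℝ) θ, HasDerivAt (fun θ => F (interp X Y θ x))
      (fderiv ℝ F (interp X Y θ x) (M θ x)) θ := by
    intro x θ
    have h : HasDerivAt (fun θ => interp X Y θ x) (M θ x) θ := by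
      simp only [interp, hM, add_apply, smul_apply]
      exact ((Real.hasDerivAt_cos θ).smul_const _).add ((Real.hasDerivAt_sin θ).smul_const _)
    exact (hF.differentiable _).hasFDerivAt.comp_hasDerivAt θ h
  have hMb : ∀ θ x, ‖M θ x‖ ≤ (‖X.comp (resInl ι κ)‖ + ‖Y.comp (resInr ι κ)‖) * ‖x‖ := by
    intro θ x
    refine ((M θ).le_opNorm x).trans ?_
    gcongr
    refine (norm_add_le _ _).trans ?_
    rw [norm_smul, norm_smul, norm_neg]
    gcongr
    · exact mul_le_of_le_one_left (norm_nonneg _) (Real.abs_sin_le_one θ)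
    · exact mul_le_of_le_one_left (norm_nonneg _) (Real.abs_cos_le_one θ)
  have main := (hasDerivAt_integral_of_dominated_loc_of_deriv_le (μ := gaussPi (ι ⊕ κ))
    (F := fun θ x => F (interp X Y θ x)) (F' := fun θ x => fderiv ℝ F (interp X Y θ x) (M θ x))
    (x₀ := θ) (s := univ)
    (bound := fun x => C * ((‖X.comp (resInl ι κ)‖ + ‖Y.comp (resInr ι κ)‖) * ‖x‖))
    univ_mem (Eventually.of_forall fun θ => (integrable_bddC2_comp hF _).1)
    (integrable_bddC2_comp hF _) ?_ ?_ ?_ ?_).2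
  · refine main.congr_deriv ?_
    rw [integral_fderiv_apply_gaussPi hF, ← integral_const_mul]
    refine integral_congr_ae (ae_of_all _ fun x => ?_)
    have l1 : ∀ i : ι, resInl ι κ (Pi.single (Sum.inl i) 1) = Pi.single i 1 := by
      intro i; ext j; simp [Pi.single_apply]
    have l2 : ∀ i : ι, resInr ι κ (Pi.single (Sum.inl i) 1) = 0 := by
      intro i; ext j; simp
    have r1 : ∀ i : κ, resInl ι κ (Pi.single (Sum.inr i) 1) = 0 := by
      intro i; ext j; simp
    have r2 : ∀ i : κ, resInr ι κ (Pi.single (Sum.inr i) 1) = Pi.single i 1 := by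
      intro i; ext j; simp [Pi.single_apply]
    have i1 : ∀ i : ι, interp X Y θ (Pi.single (Sum.inl i) 1) = Real.cos θ • X (Pi.single i 1) := by
      intro i; simp [interp, l1, l2]
    have i2 : ∀ i : κ, interp X Y θ (Pi.single (Sum.inr i) 1) = Real.sin θ • Y (Pi.single i 1) := by
      intro i; simp [interp, r1, r2]
    have m1 : ∀ i : ι, M θ (Pi.single (Sum.inl i) 1) = (-Real.sin θ) • X (Pi.single i 1) := by
      intro i; simp [hM, l1, l2]
    have m2 : ∀ i : κ, M θ (Pi.single (Sum.inr i) 1) = Real.cos θ • Y (Pi.single i 1) := by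
      intro i; simp [hM, r1, r2]
    simp only [Fintype.sum_sum_type, i1, i2, m1, m2, hessGap, map_smul,
      smul_apply, smul_eq_mul, mul_sub, Finset.mul_sum]
    rw [add_comm, sub_eq_add_neg, ← Finset.sum_neg_distrib]
    congr 1 <;> exact Finset.sum_congr rfl fun i _ => by ring
  · refine Continuous.aestronglyMeasurable ?_
    exact (hF.contDiff_fderiv.continuous.comp (interp X Y θ).continuous).clm_apply (M θ).continuous
  · refine ae_of_all _ fun x θ _ => ?_
    refine ((fderiv ℝ F _).le_opNorm _).trans ?_
    gcongr
    exacts [(hC _).2.1, hMb θ x]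
  · exact ((integrable_norm_gaussPi _).const_mul _).const_mul _
  · exact ae_of_all _ fun x θ _ => hder x θ

theorem integral_interp_zero (hF : BddC2 F) (X : (ι → ℝ) →L[ℝ] W) (Y : (κ → ℝ) →L[ℝ] W) :
    ∫ x, F (interp X Y 0 x) ∂(gaussPi (ι ⊕ κ)) = ∫ x, F (X x) ∂(gaussPi ι) := by
  rw [← measurePreserving_resInl (ι := ι) (κ := κ) |>.map_eq,
    integral_map (f := fun x => F (X x)) (measurePreserving_resInl).measurable.aemeasurable
    (hF.contDiff.continuous.comp X.continuous).aestronglyMeasurable]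
  simp [interp]

theorem integral_interp_pi_div_two (hF : BddC2 F) (X : (ι → ℝ) →L[ℝ] W) (Y : (κ → ℝ) →L[ℝ] W) :
    ∫ x, F (interp X Y (Real.pi / 2) x) ∂(gaussPi (ι ⊕ κ)) = ∫ x, F (Y x) ∂(gaussPi κ) := by
  rw [← measurePreserving_resInr (ι := ι) (κ := κ) |>.map_eq,
    integral_map (f := fun x => F (Y x)) (measurePreserving_resInr).measurable.aemeasurable
    (hF.contDiff.continuous.comp Y.continuous).aestronglyMeasurable]
  simp [interp]

/-- Gaussian comparison: if the expected second derivative along the path has a sign, the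
endpoints are ordered. -/
theorem integral_le_integral_of_hessGap_nonpos [DecidableEq ι] [DecidableEq κ] (hF : BddC2 F)
    (X : (ι → ℝ) →L[ℝ] W) (Y : (κ → ℝ) →L[ℝ] W) (h : ∀ z, hessGap F X Y z ≤ 0) :
    ∫ x, F (Y x) ∂(gaussPi κ) ≤ ∫ x, F (X x) ∂(gaussPi ι) := by
  rw [← integral_interp_zero hF X Y, ← integral_interp_pi_div_two hF X Y]
  have hanti : AntitoneOn (fun θ => ∫ x, F (interp X Y θ x) ∂(gaussPi (ι ⊕ κ)))
      (Icc 0 (Real.pi / 2)) := by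
    refine antitoneOn_of_deriv_nonpos (convex_Icc _ _)
      (fun θ _ => (hasDerivAt_integral_interp hF X Y θ).continuousAt.continuousWithinAt)
      (fun θ _ => (hasDerivAt_integral_interp hF X Y θ).differentiableAt.differentiableWithinAt) ?_
    intro θ hθ
    rw [interior_Icc] at hθ
    rw [(hasDerivAt_integral_interp hF X Y θ).deriv]
    have hpi := Real.pi_pos
    have hs : 0 ≤ Real.sin θ := Real.sin_nonneg_of_nonneg_of_le_pi hθ.1.le (by linarith [hθ.2])
    have hc : 0 ≤ Real.cos θ := Real.cos_nonneg_of_neg_pi_div_two_le_of_le (by linarith [hθ.1]) hθ.2.le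
    exact mul_nonpos_of_nonneg_of_nonpos (mul_nonneg hs hc)
      (integral_nonpos fun x => h _)
  have hpi : 0 ≤ Real.pi / 2 := by positivity
  exact hanti (left_mem_Icc.2 hpi) (right_mem_Icc.2 hpi) hpi

end

/-! ### Closure properties of `BddC2` -/

section

variable {W : Type*} [NormedAddCommGroup W] [NormedSpace ℝ W] {F G : W → ℝ}

/-- Iterated derivatives give access to the Leibniz and composition estimates used for the closure
properties. -/
theorem bddC2_iff : BddC2 F ↔
    ContDiff ℝ 2 F ∧ ∃ C, ∀ k ≤ 2, ∀ x, ‖iteratedFDeriv ℝ k F x‖ ≤ C := by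
  have h0 : ∀ x, ‖iteratedFDeriv ℝ 0 F x‖ = |F x| := fun x => by
    rw [norm_iteratedFDeriv_zero, Real.norm_eq_abs]
  have h1 : ∀ x, ‖iteratedFDeriv ℝ 1 F x‖ = ‖fderiv ℝ F x‖ := fun x => norm_iteratedFDeriv_one F
  have h2 : ∀ x, ‖iteratedFDeriv ℝ 2 F x‖ = ‖fderiv ℝ (fderiv ℝ F) x‖ := fun x => by
    rw [← norm_iteratedFDeriv_fderiv, norm_iteratedFDeriv_one]
  constructor
  · rintro ⟨hd, C, hC⟩
    refine ⟨hd, C, fun k hk x => ?_⟩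
    interval_cases k
    · rw [h0]; exact (hC x).1
    · rw [h1]; exact (hC x).2.1
    · rw [h2]; exact (hC x).2.2
  · rintro ⟨hd, C, hC⟩
    refine ⟨hd, C, fun x => ⟨?_, ?_, ?_⟩⟩
    · rw [← h0]; exact hC 0 (by norm_num) x
    · rw [← h1]; exact hC 1 (by norm_num) x
    · rw [← h2]; exact hC 2 le_rfl x

theorem BddC2.mul (hF : BddC2 F) (hG : BddC2 G) : BddC2 fun x => F x * G x := by
  obtain ⟨hF', C, hC⟩ := bddC2_iff.1 hF
  obtain ⟨hG', D, hD⟩ := bddC2_iff.1 hG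
  have hC0 : 0 ≤ C := (norm_nonneg _).trans (hC 0 (by norm_num) 0)
  refine bddC2_iff.2 ⟨hF'.mul hG', ∑ j ∈ Finset.range 3, ∑ i ∈ Finset.range (j + 1),
    (j.choose i : ℝ) * C * D, fun k hk x => ?_⟩
  have hD0 : 0 ≤ D := (norm_nonneg _).trans (hD 0 (by norm_num) 0)
  refine (norm_iteratedFDeriv_mul_le hF' hG' x (by exact_mod_cast hk)).trans ?_
  refine le_trans ?_ (Finset.single_le_sum (f := fun j => ∑ i ∈ Finset.range (j + 1),
    (j.choose i : ℝ) * C * D) (fun j _ => by positivity) (Finset.mem_range.2 (by omega : k < 3)))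
  refine Finset.sum_le_sum fun i hi => ?_
  have := Finset.mem_range.1 hi
  gcongr
  · exact hC _ (by omega) x
  · exact hD _ (by omega) x

theorem BddC2.add (hF : BddC2 F) (hG : BddC2 G) : BddC2 fun x => F x + G x := by
  obtain ⟨hF', C, hC⟩ := bddC2_iff.1 hF
  obtain ⟨hG', D, hD⟩ := bddC2_iff.1 hG
  refine bddC2_iff.2 ⟨hF'.add hG', C + D, fun k hk x => ?_⟩
  rw [fun_iteratedFDeriv_add_apply (hF'.contDiffAt.of_le (by exact_mod_cast hk))
    (hG'.contDiffAt.of_le (by exact_mod_cast hk))]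
  exact (norm_add_le _ _).trans (add_le_add (hC k hk x) (hD k hk x))

theorem bddC2_const (c : ℝ) : BddC2 fun _ : W => c := by
  refine bddC2_iff.2 ⟨contDiff_const, |c|, fun k _ x => ?_⟩
  rcases Nat.eq_zero_or_pos k with rfl | hk
  · simp
  · rw [iteratedFDeriv_const_of_ne hk.ne']
    simp

theorem BddC2.const_sub (c : ℝ) (hF : BddC2 F) : BddC2 fun x => c - F x := by
  have := (bddC2_const (W := W) c).add ((bddC2_const (W := W) (-1)).mul hF)
  simpa [sub_eq_add_neg] using this

theorem BddC2.prod {ι : Type*} (s : Finset ι) {f : ι → W → ℝ} (hf : ∀ i ∈ s, BddC2 (f i)) :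
    BddC2 fun x => ∏ i ∈ s, f i x := by
  classical
  induction s using Finset.induction_on with
  | empty => simpa using bddC2_const 1
  | insert a s ha ih =>
    simp_rw [Finset.prod_insert ha]
    exact (hf a (by simp)).mul (ih fun i hi => hf i (by simp [hi]))

theorem BddC2.comp_clm {V : Type*} [NormedAddCommGroup V] [NormedSpace ℝ V] (hF : BddC2 F)
    (L : V →L[ℝ] W) : BddC2 fun x => F (L x) := by
  obtain ⟨hF', C, hC⟩ := bddC2_iff.1 hF
  have hC0 : 0 ≤ C := (norm_nonneg _).trans (hC 0 (by norm_num) 0)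
  refine bddC2_iff.2 ⟨hF'.comp L.contDiff, C * ∑ k ∈ Finset.range 3, ‖L‖ ^ k, fun k hk x => ?_⟩
  have := L.iteratedFDeriv_comp_right hF' x (i := k) (by exact_mod_cast hk)
  simp only [Function.comp_def] at this
  rw [this]
  refine (ContinuousMultilinearMap.norm_compContinuousLinearMap_le _ _).trans ?_
  rw [Finset.prod_const, Finset.card_univ, Fintype.card_fin]
  gcongr
  · exact hC k hk _
  · exact Finset.single_le_sum (f := fun k => ‖L‖ ^ k) (fun j _ => by positivity)
      (Finset.mem_range.2 (by omega : k < 3))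

theorem bddC2_of_hasCompactSupport (hF : ContDiff ℝ 2 F) (hc : HasCompactSupport F) : BddC2 F := by
  have h : ∀ k : ℕ, ∃ C, k ≤ 2 → ∀ x, ‖iteratedFDeriv ℝ k F x‖ ≤ C := by
    intro k
    by_cases hk : k ≤ 2
    · obtain ⟨C, hC⟩ := (hc.iteratedFDeriv (𝕜 := ℝ) k).exists_bound_of_continuous
        (hF.continuous_iteratedFDeriv (by exact_mod_cast hk))
      exact ⟨C, fun _ => hC⟩
    · exact ⟨0, fun h => absurd h hk⟩
  choose C hC using h
  refine bddC2_iff.2 ⟨hF, max (C 0) (max (C 1) (C 2)), fun k hk x => (hC k hk x).trans ?_⟩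
  interval_cases k <;> simp

theorem hasFDerivAt_fderiv_apply (hF : BddC2 F) (z b : W) :
    HasFDerivAt (fun z => fderiv ℝ F z b) ((fderiv ℝ (fderiv ℝ F) z).flip b) z := by
  have := (hF.differentiable_fderiv z).hasFDerivAt.clm_apply (hasFDerivAt_const b z)
  refine this.congr_fderiv ?_
  ext
  simp

theorem fderiv_fderiv_symm (hF : BddC2 F) (z a b : W) :
    fderiv ℝ (fderiv ℝ F) z a b = fderiv ℝ (fderiv ℝ F) z b a := by
  have h : IsSymmSndFDerivAt ℝ F z := hF.contDiff.contDiffAt.isSymmSndFDerivAt (by simp)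
  exact h a b

end

/-! ### Smoothing of Lipschitz functions -/

section

variable {V : Type*} [NormedAddCommGroup V] [InnerProductSpace ℝ V] [FiniteDimensional ℝ V]

open scoped ContDiff in
-- Convolution with a normalised bump averages translates of `f`: this keeps the Lipschitz constant,
-- and a bump of radius `ε` moves values by at most `ε`.
theorem exists_smooth_lipschitz_approx [MeasurableSpace V] [BorelSpace V] {f : V → ℝ}
    (hf : LipschitzWith 1 f)
    (hc : HasCompactSupport f) {ε : ℝ} (hε : 0 < ε) :
    ∃ g : V → ℝ, ContDiff ℝ ∞ g ∧ HasCompactSupport g ∧ LipschitzWith 1 g ∧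
      ∀ x, |g x - f x| ≤ ε := by
  let φ : ContDiffBump (0 : V) := ⟨ε / 2, ε, half_pos hε, half_lt_self hε⟩
  let μ : Measure V := volume
  have hφ : ∀ x, 0 ≤ φ.normed μ x := φ.nonneg_normed
  refine ⟨MeasureTheory.convolution (φ.normed μ) f (ContinuousLinearMap.lsmul ℝ ℝ) μ,
    φ.hasCompactSupport_normed.contDiff_convolution_left _ φ.contDiff_normed
      (hf.continuous.locallyIntegrable),
    HasCompactSupport.convolution _ φ.hasCompactSupport_normed hc, ?_, ?_⟩
  · have hint : ∀ a, Integrable (fun t => φ.normed μ t * f (a - t)) μ := by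
      intro a
      obtain ⟨C, hC⟩ := hc.exists_bound_of_continuous hf.continuous
      exact φ.integrable_normed.mul_bdd
        (hf.continuous.comp (by fun_prop)).aestronglyMeasurable (ae_of_all _ fun t => hC _)
    refine LipschitzWith.of_dist_le_mul fun a b => ?_
    simp only [convolution, ContinuousLinearMap.lsmul_apply, smul_eq_mul]
    rw [Real.dist_eq, ← integral_sub (hint a) (hint b), NNReal.coe_one, one_mul]
    refine (abs_integral_le_integral_abs).trans ?_
    calc ∫ t, |φ.normed μ t * f (a - t) - φ.normed μ t * f (b - t)| ∂μ
        ≤ ∫ t, φ.normed μ t * dist a b ∂μ := by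
          refine integral_mono ((hint a).sub (hint b)).abs (φ.integrable_normed.mul_const _) ?_
          intro t
          simp only
          rw [← mul_sub, abs_mul, abs_of_nonneg (hφ t)]
          refine mul_le_mul_of_nonneg_left ?_ (hφ t)
          have := hf.dist_le_mul (a - t) (b - t)
          simpa [Real.dist_eq] using this
      _ = dist a b := by rw [integral_mul_const, φ.integral_normed, one_mul]
  · intro x
    rw [← Real.dist_eq]
    refine φ.dist_normed_convolution_le hf.continuous.aestronglyMeasurable fun y hy => ?_
    have := hf.dist_le_mul y x
    rw [NNReal.coe_one, one_mul] at this
    exact this.trans (Metric.mem_ball.1 hy).le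

end

/-! ### Gaussian concentration for Lipschitz functions -/

section

variable {ι : Type*} [Fintype ι]

/-- The identity `(ι → ℝ) → EuclideanSpace ℝ ι`. -/
noncomputable def toE (ι : Type*) [Fintype ι] : (ι → ℝ) →L[ℝ] EuclideanSpace ℝ ι :=
  (EuclideanSpace.equiv ι ℝ).symm

@[simp] theorem toE_apply (x : ι → ℝ) (i : ι) : toE ι x i = x i := rfl

theorem measurePreserving_toE :
    MeasurePreserving (toE ι) (gaussPi ι) (stdGaussian (EuclideanSpace ℝ ι)) :=
  ⟨(toE ι).continuous.measurable, map_pi_eq_stdGaussian⟩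

theorem integral_comp_toE {f : EuclideanSpace ℝ ι → ℝ} (hf : Continuous f) :
    ∫ x, f (toE ι x) ∂(gaussPi ι) = ∫ x, f x ∂(stdGaussian (EuclideanSpace ℝ ι)) := by
  rw [← measurePreserving_toE.map_eq,
    integral_map measurePreserving_toE.measurable.aemeasurable hf.aestronglyMeasurable]

/-- By Riesz representation and Parseval the sum is an inner product of the two gradients, then
Cauchy–Schwarz. -/
theorem sum_dual_mul_dual_le [DecidableEq ι] (a b : EuclideanSpace ℝ ι →L[ℝ] ℝ) :
    ∑ i, a (toE ι (Pi.single i 1)) * b (toE ι (Pi.single i 1)) ≤ ‖a‖ * ‖b‖ := by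
  have he : ∀ i, toE ι (Pi.single i 1) = EuclideanSpace.basisFun ι ℝ i := by
    intro i
    ext j
    simp [Pi.single_apply]
  have h := (EuclideanSpace.basisFun ι ℝ).sum_inner_mul_inner
    ((InnerProductSpace.toDual ℝ _).symm a) ((InnerProductSpace.toDual ℝ _).symm b)
  simp_rw [real_inner_comm _ (EuclideanSpace.basisFun ι ℝ _)] at h
  have ha : ∀ (a : EuclideanSpace ℝ ι →L[ℝ] ℝ) (x : EuclideanSpace ℝ ι),
      inner ℝ ((InnerProductSpace.toDual ℝ _).symm a) x = a x :=
    fun a x => InnerProductSpace.toDual_symm_apply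
  have h1 := (real_inner_le_norm ((InnerProductSpace.toDual ℝ _).symm a)
    ((InnerProductSpace.toDual ℝ _).symm b))
  rw [LinearIsometryEquiv.norm_map, LinearIsometryEquiv.norm_map] at h1
  refine le_trans (le_of_eq ?_) h1
  rw [← h]
  refine Finset.sum_congr rfl fun i _ => ?_
  rw [he, real_inner_comm, ha]
  try rw [real_inner_comm]
  try rw [ha]

variable {V : Type*} [NormedAddCommGroup V] [NormedSpace ℝ V] {u v : V → ℝ}

theorem bddC2_mul_prod (hu : BddC2 u) (hv : BddC2 v) :
    BddC2 fun p : V × V => u p.1 * v p.2 :=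
  (hu.comp_clm (ContinuousLinearMap.fst ℝ V V)).mul (hv.comp_clm (ContinuousLinearMap.snd ℝ V V))

theorem fderiv_fderiv_mul_prod (hu : BddC2 u) (hv : BddC2 v) (p : V × V) (a b : V) :
    fderiv ℝ (fderiv ℝ fun p : V × V => u p.1 * v p.2) p (a, 0) (0, b) =
      fderiv ℝ u p.1 a * fderiv ℝ v p.2 b := by
  have h1 : ∀ z : V × V, fderiv ℝ (fun p : V × V => u p.1 * v p.2) z (0, b) =
      u z.1 * fderiv ℝ v z.2 b := by
    intro z
    have hu1 : HasFDerivAt (fun p : V × V => u p.1)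
        ((fderiv ℝ u z.1).comp (ContinuousLinearMap.fst ℝ V V)) z :=
      (hu.differentiable z.1).hasFDerivAt.comp z hasFDerivAt_fst
    have hv1 : HasFDerivAt (fun p : V × V => v p.2)
        ((fderiv ℝ v z.2).comp (ContinuousLinearMap.snd ℝ V V)) z :=
      (hv.differentiable z.2).hasFDerivAt.comp z hasFDerivAt_snd
    rw [(hu1.fun_mul hv1).fderiv]
    simp
  have h2 := hasFDerivAt_fderiv_apply (bddC2_mul_prod hu hv) p (0, b)
  simp_rw [h1] at h2
  have hu1 : HasFDerivAt (fun p : V × V => u p.1)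
      ((fderiv ℝ u p.1).comp (ContinuousLinearMap.fst ℝ V V)) p :=
    (hu.differentiable p.1).hasFDerivAt.comp p hasFDerivAt_fst
  have hv1 : HasFDerivAt (fun z : V × V => fderiv ℝ v z.2 b)
      (((fderiv ℝ (fderiv ℝ v) p.2).flip b).comp (ContinuousLinearMap.snd ℝ V V)) p :=
    (hasFDerivAt_fderiv_apply hv p.2 b).comp p hasFDerivAt_snd
  have h3 := h2.unique (hu1.fun_mul hv1)
  have h4 := DFunLike.congr_fun h3 (a, 0)
  simpa [mul_comm] using h4

theorem integrable_hessGap {κ κ' : Type*} [Fintype κ] [Fintype κ'] [DecidableEq κ] [DecidableEq κ']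
    {W : Type*} [NormedAddCommGroup W] [NormedSpace ℝ W] {F : W → ℝ} (hF : BddC2 F)
    (X : (κ → ℝ) →L[ℝ] W) (Y : (κ' → ℝ) →L[ℝ] W) (L : (ι → ℝ) →L[ℝ] W) :
    Integrable (fun x => hessGap F X Y (L x)) (gaussPi ι) := by
  obtain ⟨C, hC⟩ := hF.bdd
  have h : ∀ a : W, Integrable (fun x => fderiv ℝ (fderiv ℝ F) (L x) a a) (gaussPi ι) := by
    intro a
    refine (integrable_const (C * ‖a‖ * ‖a‖)).mono' ?_ (ae_of_all _ fun x => ?_)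
    · exact (((hF.continuous_fderiv_fderiv.comp L.continuous).clm_apply
        continuous_const).clm_apply continuous_const).aestronglyMeasurable
    · exact ((fderiv ℝ (fderiv ℝ F) (L x)).le_opNorm₂ _ _).trans (by gcongr; exact (hC _).2.2)
  exact (integrable_finsetSum _ fun i _ => h _).sub (integrable_finsetSum _ fun i _ => h _)

/-- A covariance inequality for a pair of functions of a Gaussian vector. -/
theorem integral_mul_le_of_sum_fderiv_le {u v : EuclideanSpace ℝ ι → ℝ} [DecidableEq ι]
    (hu : BddC2 u) (hv : BddC2 v) {c : ℝ}
    (h : ∀ x y, ∑ i, fderiv ℝ u x (toE ι (Pi.single i 1)) * fderiv ℝ v y (toE ι (Pi.single i 1)) ≤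
      c * v y) :
    ∫ x, u x * v x ∂(stdGaussian (EuclideanSpace ℝ ι)) ≤
      (∫ x, u x ∂(stdGaussian (EuclideanSpace ℝ ι))) * ∫ x, v x ∂(stdGaussian (EuclideanSpace ℝ ι)) +
        c * ∫ x, v x ∂(stdGaussian (EuclideanSpace ℝ ι)) := by
  -- `X = (g, g)` and `Y = (g, g')` have the same marginals and differ only in the cross-covariance.
  -- Interpolating `u(p₁) v(p₂)` therefore goes from `𝔼[uv]` to `𝔼u 𝔼v`, and the gap consists of
  -- mixed derivatives only.
  let X : (ι → ℝ) →L[ℝ] EuclideanSpace ℝ ι × EuclideanSpace ℝ ι := (toE ι).prod (toE ι)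
  let Y : (ι ⊕ ι → ℝ) →L[ℝ] EuclideanSpace ℝ ι × EuclideanSpace ℝ ι :=
    ((toE ι).comp (resInl ι ι)).prod ((toE ι).comp (resInr ι ι))
  have hF := bddC2_mul_prod hu hv
  have hG : BddC2 fun p : EuclideanSpace ℝ ι × EuclideanSpace ℝ ι => v p.2 := hv.comp_clm (ContinuousLinearMap.snd ℝ (EuclideanSpace ℝ ι) (EuclideanSpace ℝ ι))
  have gap : ∀ {F : EuclideanSpace ℝ ι × EuclideanSpace ℝ ι → ℝ}, BddC2 F → ∀ z, hessGap F X Y z =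
      -2 * ∑ i, fderiv ℝ (fderiv ℝ F) z (toE ι (Pi.single i 1), 0) (0, toE ι (Pi.single i 1)) := by
    intro F hF z
    have l1 : ∀ i : ι, resInl ι ι (Pi.single (Sum.inl i) 1) = Pi.single i 1 := by
      intro i; ext j; simp [Pi.single_apply]
    have l2 : ∀ i : ι, resInr ι ι (Pi.single (Sum.inl i) 1) = 0 := by
      intro i; ext j; simp
    have r1 : ∀ i : ι, resInl ι ι (Pi.single (Sum.inr i) 1) = 0 := by
      intro i; ext j; simp
    have r2 : ∀ i : ι, resInr ι ι (Pi.single (Sum.inr i) 1) = Pi.single i 1 := by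
      intro i; ext j; simp [Pi.single_apply]
    have y1 : ∀ i : ι, Y (Pi.single (Sum.inl i) 1) = (toE ι (Pi.single i 1), 0) := by
      intro i; simp [Y, l1, l2]
    have y2 : ∀ i : ι, Y (Pi.single (Sum.inr i) 1) = (0, toE ι (Pi.single i 1)) := by
      intro i; simp [Y, r1, r2]
    have x1 : ∀ i : ι, X (Pi.single i 1) =
        (toE ι (Pi.single i 1), 0) + (0, toE ι (Pi.single i 1)) := by
      intro i; simp [X]
    simp only [hessGap, Fintype.sum_sum_type, y1, y2, x1, map_add, add_apply]
    simp only [fderiv_fderiv_symm hF z (0, _) (_, 0)]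
    simp only [Finset.sum_add_distrib]
    ring
  have gapG : ∀ z, hessGap (fun p : EuclideanSpace ℝ ι × EuclideanSpace ℝ ι => v p.2) X Y z = 0 := by
    intro z
    rw [gap hG]
    have := fun a b => fderiv_fderiv_mul_prod (bddC2_const (W := EuclideanSpace ℝ ι) 1) hv z a b
    simp only [one_mul] at this
    simp [this]
  have gapF : ∀ z, -2 * (c * v z.2) ≤ hessGap (fun p : EuclideanSpace ℝ ι × EuclideanSpace ℝ ι => u p.1 * v p.2) X Y z := by
    intro z
    rw [gap hF]
    simp_rw [fderiv_fderiv_mul_prod hu hv]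
    linarith [h z.1 z.2]
  set γ := gaussPi (ι ⊕ (ι ⊕ ι))
  -- The law of the second component does not change along the path: its gap vanishes.
  have hconst : ∀ θ, ∫ x, v (interp X Y θ x).2 ∂γ = ∫ x, v x ∂(stdGaussian (EuclideanSpace ℝ ι)) := by
    have hd : ∀ θ, HasDerivAt (fun θ => ∫ x, v (interp X Y θ x).2 ∂γ) 0 θ := by
      intro θ
      have := hasDerivAt_integral_interp hG X Y θ
      simp only [gapG] at this
      simpa using this
    intro θ
    have h1 := is_const_of_deriv_eq_zero (fun θ => (hd θ).differentiableAt)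
      (fun θ => (hd θ).deriv) θ 0
    rw [h1, integral_interp_zero hG X Y]
    exact integral_comp_toE hv.contDiff.continuous
  -- The term `sin² θ · c 𝔼v` has derivative `2 sin θ cos θ · c 𝔼v`, which offsets the lower bound
  -- `-2 c 𝔼v` for the mean gap.
  have hmono : MonotoneOn (fun θ => ∫ x, u (interp X Y θ x).1 * v (interp X Y θ x).2 ∂γ +
      Real.sin θ ^ 2 * (c * ∫ x, v x ∂(stdGaussian (EuclideanSpace ℝ ι)))) (Icc 0 (Real.pi / 2)) := by
    have hd : ∀ θ, HasDerivAt (fun θ => ∫ x, u (interp X Y θ x).1 * v (interp X Y θ x).2 ∂γ +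
        Real.sin θ ^ 2 * (c * ∫ x, v x ∂(stdGaussian (EuclideanSpace ℝ ι))))
        (Real.sin θ * Real.cos θ * ∫ x, hessGap (fun p : EuclideanSpace ℝ ι × EuclideanSpace ℝ ι => u p.1 * v p.2) X Y
          (interp X Y θ x) ∂γ + 2 * Real.sin θ * Real.cos θ *
            (c * ∫ x, v x ∂(stdGaussian (EuclideanSpace ℝ ι)))) θ := by
      intro θ
      refine (hasDerivAt_integral_interp hF X Y θ).fun_add (HasDerivAt.mul_const ?_ _)
      simpa using (Real.hasDerivAt_sin θ).fun_pow 2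
    refine monotoneOn_of_deriv_nonneg (convex_Icc _ _)
      (fun θ _ => (hd θ).continuousAt.continuousWithinAt)
      (fun θ _ => (hd θ).differentiableAt.differentiableWithinAt) ?_
    intro θ hθ
    rw [interior_Icc] at hθ
    have hpi := Real.pi_pos
    have hs : 0 ≤ Real.sin θ := Real.sin_nonneg_of_nonneg_of_le_pi hθ.1.le (by linarith [hθ.2])
    have hc : 0 ≤ Real.cos θ := Real.cos_nonneg_of_neg_pi_div_two_le_of_le (by linarith [hθ.1]) hθ.2.le
    rw [(hd θ).deriv]
    have hle : -2 * (c * ∫ x, v x ∂(stdGaussian (EuclideanSpace ℝ ι))) ≤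
        ∫ x, hessGap (fun p : EuclideanSpace ℝ ι × EuclideanSpace ℝ ι => u p.1 * v p.2) X Y (interp X Y θ x) ∂γ := by
      rw [← hconst θ, ← integral_const_mul, ← integral_const_mul]
      exact integral_mono (((integrable_bddC2_comp hG _).const_mul c).const_mul (-2))
        (integrable_hessGap hF X Y _) fun x => gapF _
    nlinarith [mul_nonneg hs hc]
  have hpi : 0 ≤ Real.pi / 2 := by positivity
  have key := hmono (left_mem_Icc.2 hpi) (right_mem_Icc.2 hpi) hpi
  simp only at key
  rw [integral_interp_zero hF X Y, integral_interp_pi_div_two hF X Y] at key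
  have e1 : ∫ x, u (X x).1 * v (X x).2 ∂(gaussPi ι) = ∫ x, u x * v x ∂(stdGaussian (EuclideanSpace ℝ ι)) :=
    integral_comp_toE (hu.contDiff.continuous.mul hv.contDiff.continuous)
  have e2 : ∫ x, u (Y x).1 * v (Y x).2 ∂(gaussPi (ι ⊕ ι)) =
      (∫ x, u x ∂(stdGaussian (EuclideanSpace ℝ ι))) * ∫ x, v x ∂(stdGaussian (EuclideanSpace ℝ ι)) := by
    rw [← integral_comp_toE hu.contDiff.continuous, ← integral_comp_toE hv.contDiff.continuous,
      ← integral_prod_mul, ← measurePreserving_res.map_eq,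
      integral_map measurePreserving_res.measurable.aemeasurable]
    · rfl
    · exact ((hu.contDiff.continuous.comp ((toE ι).continuous.comp continuous_fst)).mul
        (hv.contDiff.continuous.comp ((toE ι).continuous.comp continuous_snd))).aestronglyMeasurable
  rw [e1, e2] at key
  simpa using key

end

/-! ### From the covariance inequality to the Laplace transform bound. -/

section

variable {ι : Type*} [Fintype ι]

open scoped ContDiff in
-- The covariance inequality is applied to `u` and `v = e^{su}`. Since `∇v = s v ∇u` and `‖∇u‖ ≤ 1`,
-- the constant is `c = s`.
theorem integral_mul_exp_le {u : EuclideanSpace ℝ ι → ℝ} (hu : ContDiff ℝ ∞ u)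
    (hc : HasCompactSupport u) (hl : LipschitzWith 1 u) {s : ℝ} (hs : 0 ≤ s) :
    ∫ x, u x * Real.exp (s * u x) ∂(stdGaussian (EuclideanSpace ℝ ι)) ≤
      (∫ x, u x ∂(stdGaussian (EuclideanSpace ℝ ι)) + s) *
        ∫ x, Real.exp (s * u x) ∂(stdGaussian (EuclideanSpace ℝ ι)) := by
  classical
  have hu2 : ContDiff ℝ 2 u := by exact_mod_cast contDiff_infty.1 hu 2
  have hU : BddC2 u := bddC2_of_hasCompactSupport hu2 hc
  have hV : BddC2 fun x => Real.exp (s * u x) := by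
    -- `e^{su}` equals `1` off the support of `u`, so subtracting `1` restores compact support.
    have h1 : BddC2 fun x => Real.exp (s * u x) - 1 := by
      refine bddC2_of_hasCompactSupport (((contDiff_const.mul hu2).exp).sub contDiff_const) ?_
      exact hc.comp_left (g := fun t => Real.exp (s * t) - 1) (by simp)
    have h2 := h1.add (bddC2_const 1)
    simpa using h2
  rw [add_mul]
  refine integral_mul_le_of_sum_fderiv_le hU hV fun x y => ?_
  have hd : fderiv ℝ (fun x => Real.exp (s * u x)) y =
      (Real.exp (s * u y) * s) • fderiv ℝ u y := by
    have := (((hU.differentiable y).hasFDerivAt.const_mul s).exp).fderiv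
    rw [this, smul_smul]
  have hn : ∀ x, ‖fderiv ℝ u x‖ ≤ 1 := fun x => by
    simpa using norm_fderiv_le_of_lipschitz ℝ hl (x₀ := x)
  have h := sum_dual_mul_dual_le (fderiv ℝ u x) (fderiv ℝ u y)
  have h1 : ‖fderiv ℝ u x‖ * ‖fderiv ℝ u y‖ ≤ 1 :=
    mul_le_one₀ (hn x) (norm_nonneg _) (hn y)
  simp only [hd, smul_apply, smul_eq_mul]
  calc ∑ i, fderiv ℝ u x (toE ι (Pi.single i 1)) *
        (Real.exp (s * u y) * s * fderiv ℝ u y (toE ι (Pi.single i 1)))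
      = (Real.exp (s * u y) * s) * ∑ i, fderiv ℝ u x (toE ι (Pi.single i 1)) *
        fderiv ℝ u y (toE ι (Pi.single i 1)) := by
        rw [Finset.mul_sum]; exact Finset.sum_congr rfl fun i _ => by ring
    _ ≤ (Real.exp (s * u y) * s) * 1 := by gcongr; exact h.trans h1
    _ = s * Real.exp (s * u y) := by ring

open scoped ContDiff in
-- The preceding inequality says that the logarithmic derivative of the moment generating function
-- at `t` is at most `m + t`. Hence `mgf(t) e^{-(tm + t²/2)}` decreases from its value `1` at `t =
-- 0`.
theorem integral_exp_le_of_smooth {u : EuclideanSpace ℝ ι → ℝ} (hu : ContDiff ℝ ∞ u)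
    (hc : HasCompactSupport u) (hl : LipschitzWith 1 u) {s : ℝ} (hs : 0 ≤ s) :
    ∫ x, Real.exp (s * u x) ∂(stdGaussian (EuclideanSpace ℝ ι)) ≤
      Real.exp (s * ∫ x, u x ∂(stdGaussian (EuclideanSpace ℝ ι)) + s ^ 2 / 2) := by
  set μ := stdGaussian (EuclideanSpace ℝ ι)
  set m := ∫ x, u x ∂μ
  obtain ⟨C, hC⟩ := hc.exists_bound_of_continuous hl.continuous
  have hset : integrableExpSet u μ = univ := by
    refine eq_univ_of_forall fun t => ?_
    change Integrable (fun x => Real.exp (t * u x)) μ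
    refine (integrable_const (Real.exp (|t| * C))).mono'
      (by have := hl.continuous; fun_prop) (ae_of_all _ fun x => ?_)
    rw [Real.norm_eq_abs, Real.abs_exp]
    refine Real.exp_le_exp.2 ((le_abs_self _).trans ?_)
    rw [abs_mul]
    gcongr
    exact hC x
  have hd : ∀ t, HasDerivAt (mgf u μ) (∫ x, u x * Real.exp (t * u x) ∂μ) t := fun t =>
    hasDerivAt_mgf (by rw [hset]; simp)
  have hd2 : ∀ t, HasDerivAt (fun t => mgf u μ t * Real.exp (-(t * m + t ^ 2 / 2)))
      ((∫ x, u x * Real.exp (t * u x) ∂μ) * Real.exp (-(t * m + t ^ 2 / 2)) +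
        mgf u μ t * (Real.exp (-(t * m + t ^ 2 / 2)) * (-(m + t)))) t := by
    intro t
    refine (hd t).fun_mul (HasDerivAt.exp ?_)
    refine HasDerivAt.fun_neg (HasDerivAt.fun_add ?_ ?_)
    · simpa using (hasDerivAt_id t).mul_const m
    · have := ((hasDerivAt_id t).fun_pow 2).div_const 2
      simpa using this
  have hanti : AntitoneOn (fun t => mgf u μ t * Real.exp (-(t * m + t ^ 2 / 2))) (Ici 0) := by
    refine antitoneOn_of_deriv_nonpos (convex_Ici _)
      (fun t _ => (hd2 t).continuousAt.continuousWithinAt)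
      (fun t _ => (hd2 t).differentiableAt.differentiableWithinAt) ?_
    intro t ht
    rw [interior_Ici] at ht
    rw [(hd2 t).deriv]
    have h := integral_mul_exp_le hu hc hl (le_of_lt ht)
    have he := Real.exp_pos (-(t * m + t ^ 2 / 2))
    change _ ≤ (m + t) * mgf u μ t at h
    nlinarith
  have h := hanti (mem_Ici.2 le_rfl) (mem_Ici.2 hs) hs
  simp only [mgf_zero, zero_mul] at h
  rw [Real.exp_neg, ← div_eq_mul_inv, div_le_iff₀ (Real.exp_pos _)] at h
  simpa [mgf] using h

theorem integral_exp_le_of_hasCompactSupport {f : EuclideanSpace ℝ ι → ℝ}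
    (hl : LipschitzWith 1 f) (hc : HasCompactSupport f) {s : ℝ} (hs : 0 ≤ s) :
    ∫ x, Real.exp (s * f x) ∂(stdGaussian (EuclideanSpace ℝ ι)) ≤
      Real.exp (s * ∫ x, f x ∂(stdGaussian (EuclideanSpace ℝ ι)) + s ^ 2 / 2) := by
  set μ := stdGaussian (EuclideanSpace ℝ ι)
  have hint : ∀ {g : EuclideanSpace ℝ ι → ℝ}, HasCompactSupport g → Continuous g →
      Integrable g μ ∧ Integrable (fun x => Real.exp (s * g x)) μ := by
    intro g hg hgc
    obtain ⟨C, hC⟩ := hg.exists_bound_of_continuous hgc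
    refine ⟨(integrable_const C).mono' hgc.aestronglyMeasurable (ae_of_all _ hC),
      (integrable_const (Real.exp (s * C))).mono' (by fun_prop) (ae_of_all _ fun x => ?_)⟩
    rw [Real.norm_eq_abs, Real.abs_exp]
    have := (le_abs_self _).trans (hC x)
    gcongr
  -- One `sε` is lost in replacing `f` by `g` in the exponential, another in replacing the mean of
  -- `g` by that of `f`.
  have key : ∀ ε > 0, ∫ x, Real.exp (s * f x) ∂μ ≤
      Real.exp (s * ∫ x, f x ∂μ + s ^ 2 / 2 + 2 * s * ε) := by
    intro ε hε
    obtain ⟨g, hg, hgc, hgl, hgf⟩ := exists_smooth_lipschitz_approx hl hc hε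
    have h1 := integral_exp_le_of_smooth hg hgc hgl hs
    have h2 : ∫ x, Real.exp (s * f x) ∂μ ≤ ∫ x, Real.exp (s * ε) * Real.exp (s * g x) ∂μ := by
      refine integral_mono (hint hc hl.continuous).2
        ((hint hgc hgl.continuous).2.const_mul _) fun x => ?_
      simp only
      rw [← Real.exp_add, ← mul_add]
      have := abs_le.1 (hgf x)
      gcongr
      linarith
    have h3 : ∫ x, g x ∂μ ≤ ∫ x, f x ∂μ + ε := by
      have : ∫ x, g x ∂μ ≤ ∫ x, (f x + ε) ∂μ := by
        refine integral_mono (hint hgc hgl.continuous).1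
          ((hint hc hl.continuous).1.add (integrable_const _)) fun x => ?_
        have := abs_le.1 (hgf x)
        simp only
        linarith
      rwa [integral_add (hint hc hl.continuous).1 (integrable_const _), integral_const,
        probReal_univ, one_smul] at this
    rw [integral_const_mul] at h2
    calc _ ≤ _ := h2
      _ ≤ Real.exp (s * ε) * Real.exp (s * ∫ x, g x ∂μ + s ^ 2 / 2) := by gcongr
      _ ≤ _ := by
        rw [← Real.exp_add]
        refine Real.exp_le_exp.2 ?_
        nlinarith
  have ht : Tendsto (fun ε : ℝ => Real.exp (s * ∫ x, f x ∂μ + s ^ 2 / 2 + 2 * s * ε)) (𝓝[>] 0)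
      (𝓝 (Real.exp (s * ∫ x, f x ∂μ + s ^ 2 / 2 + 2 * s * 0))) :=
    (Continuous.tendsto (by fun_prop) 0).mono_left nhdsWithin_le_nhds
  have := ge_of_tendsto ht (by filter_upwards [self_mem_nhdsWithin] with ε hε using key ε hε)
  simpa using this

theorem integrable_of_lipschitz {f : EuclideanSpace ℝ ι → ℝ} (hl : LipschitzWith 1 f) :
    Integrable f (stdGaussian (EuclideanSpace ℝ ι)) := by
  have h : Integrable (fun x : EuclideanSpace ℝ ι => |f 0| + ‖x‖)
      (stdGaussian (EuclideanSpace ℝ ι)) :=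
    (integrable_const _).add IsGaussian.integrable_id.norm
  refine h.mono' hl.continuous.aestronglyMeasurable (ae_of_all _ fun x => ?_)
  have := hl.dist_le_mul x 0
  rw [NNReal.coe_one, one_mul, dist_zero_right, Real.dist_eq] at this
  calc |f x| = |f 0 + (f x - f 0)| := by ring_nf
    _ ≤ |f 0| + |f x - f 0| := abs_add_le _ _
    _ ≤ _ := by gcongr

/-- The truncation of `f` by a cone of height `R`. -/
noncomputable def coneTrunc (R : ℝ) (f : EuclideanSpace ℝ ι → ℝ) (x : EuclideanSpace ℝ ι) : ℝ :=
  max (min (f x) (max (R - ‖x‖) 0)) (-max (R - ‖x‖) 0)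

theorem lipschitzWith_coneTrunc {f : EuclideanSpace ℝ ι → ℝ} (hl : LipschitzWith 1 f) (R : ℝ) :
    LipschitzWith 1 (coneTrunc R f) := by
  have h1 : LipschitzWith 1 fun x : EuclideanSpace ℝ ι => max (R - ‖x‖) 0 := by
    have : LipschitzWith (0 + 1) fun x : EuclideanSpace ℝ ι => R - ‖x‖ :=
      (LipschitzWith.const R).sub lipschitzWith_one_norm
    rw [zero_add] at this
    exact this.max_const 0
  have h2 := (hl.min h1).max h1.neg
  rw [max_self, max_self] at h2
  exact h2

theorem hasCompactSupport_coneTrunc (f : EuclideanSpace ℝ ι → ℝ) (R : ℝ) :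
    HasCompactSupport (coneTrunc R f) := by
  refine HasCompactSupport.intro (isCompact_closedBall (0 : EuclideanSpace ℝ ι) R) fun x hx => ?_
  have : R - ‖x‖ ≤ 0 := by simpa using (le_of_lt (by simpa using hx) : R ≤ ‖x‖)
  rw [coneTrunc, max_eq_right this]
  simp

theorem abs_coneTrunc_le (f : EuclideanSpace ℝ ι → ℝ) (R : ℝ) (x : EuclideanSpace ℝ ι) :
    |coneTrunc R f x| ≤ |f x| := by
  rw [coneTrunc, abs_le]
  have h := le_max_right (R - ‖x‖) 0
  have h1 := neg_abs_le (f x)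
  have h2 := le_abs_self (f x)
  constructor
  · by_cases hf : f x ≤ max (R - ‖x‖) 0
    · exact le_max_of_le_left (by rw [min_eq_left hf]; exact h1)
    · push Not at hf
      exact le_max_of_le_left (by rw [min_eq_right hf.le]; linarith [abs_nonneg (f x)])
  · exact max_le ((min_le_left _ _).trans h2) (by linarith [abs_nonneg (f x)])

theorem coneTrunc_eq (f : EuclideanSpace ℝ ι → ℝ) {R : ℝ} {x : EuclideanSpace ℝ ι}
    (h : |f x| + ‖x‖ ≤ R) : coneTrunc R f x = f x := by
  have h1 : |f x| ≤ max (R - ‖x‖) 0 := le_max_of_le_left (by linarith)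
  rw [abs_le] at h1
  rw [coneTrunc, min_eq_left h1.2, max_eq_left h1.1]

/-- The sharp Gaussian Laplace transform bound for Lipschitz functions. -/
theorem lintegral_exp_le_of_lipschitz {f : EuclideanSpace ℝ ι → ℝ} (hl : LipschitzWith 1 f)
    {s : ℝ} (hs : 0 ≤ s) :
    ∫⁻ x, ENNReal.ofReal (Real.exp (s * f x)) ∂(stdGaussian (EuclideanSpace ℝ ι)) ≤
      ENNReal.ofReal
        (Real.exp (s * ∫ x, f x ∂(stdGaussian (EuclideanSpace ℝ ι)) + s ^ 2 / 2)) := by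
  set μ := stdGaussian (EuclideanSpace ℝ ι)
  have hlc : ∀ n : ℕ, LipschitzWith 1 (coneTrunc n f) := fun n => lipschitzWith_coneTrunc hl n
  have hev : ∀ x, ∀ᶠ n : ℕ in atTop, coneTrunc n f x = f x := by
    intro x
    obtain ⟨N, hN⟩ := exists_nat_ge (|f x| + ‖x‖)
    filter_upwards [eventually_ge_atTop N] with n hn
    exact coneTrunc_eq f (hN.trans (by exact_mod_cast hn))
  have hlim : Tendsto (fun n : ℕ => ∫ x, coneTrunc n f x ∂μ) atTop (𝓝 (∫ x, f x ∂μ)) := by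
    refine tendsto_integral_of_dominated_convergence (fun x => |f x|)
      (fun n => (hlc n).continuous.aestronglyMeasurable) (integrable_of_lipschitz hl).abs
      (fun n => ae_of_all _ fun x => abs_coneTrunc_le f n x) (ae_of_all _ fun x => ?_)
    exact tendsto_const_nhds.congr' ((hev x).mono fun n hn => hn.symm)
  have hb : ∀ n : ℕ, ∫⁻ x, ENNReal.ofReal (Real.exp (s * coneTrunc n f x)) ∂μ ≤
      ENNReal.ofReal (Real.exp (s * ∫ x, coneTrunc n f x ∂μ + s ^ 2 / 2)) := by
    intro n
    have hc := hasCompactSupport_coneTrunc f n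
    obtain ⟨C, hC⟩ := hc.exists_bound_of_continuous (hlc n).continuous
    rw [← ofReal_integral_eq_lintegral_ofReal _ (ae_of_all _ fun x => (Real.exp_pos _).le)]
    · exact ENNReal.ofReal_le_ofReal (integral_exp_le_of_hasCompactSupport (hlc n) hc hs)
    · refine (integrable_const (Real.exp (s * C))).mono'
        (by have := (hlc n).continuous; fun_prop) (ae_of_all _ fun x => ?_)
      rw [Real.norm_eq_abs, Real.abs_exp]
      have := (le_abs_self _).trans (hC x)
      gcongr
  -- Fatou's lemma, in `ℝ≥0∞`, so that integrability of `e^{sf}` need not be known in advance. The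
  -- truncations agree with `f` eventually at each point.
  have hF : ∫⁻ x, ENNReal.ofReal (Real.exp (s * f x)) ∂μ ≤
      liminf (fun n : ℕ => ∫⁻ x, ENNReal.ofReal (Real.exp (s * coneTrunc n f x)) ∂μ) atTop := by
    refine le_trans (le_of_eq ?_) (lintegral_liminf_le fun n => ?_)
    · refine lintegral_congr fun x => ?_
      refine (Tendsto.liminf_eq (tendsto_const_nhds.congr' ?_)).symm
      exact (hev x).mono fun n hn => by simp only [hn]
    · have := (hlc n).continuous
      fun_prop
  refine hF.trans ?_
  have hlim2 : Tendsto (fun n : ℕ => ENNReal.ofReal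
      (Real.exp (s * ∫ x, coneTrunc n f x ∂μ + s ^ 2 / 2))) atTop
      (𝓝 (ENNReal.ofReal (Real.exp (s * ∫ x, f x ∂μ + s ^ 2 / 2)))) := by
    refine ENNReal.tendsto_ofReal ?_
    exact (Real.continuous_exp.tendsto _).comp ((hlim.const_mul s).add_const _)
  rw [← hlim2.liminf_eq]
  exact liminf_le_liminf (Eventually.of_forall hb)

end

/-! ### Gordon's comparison theorem -/

section

variable {K : Type*} [Fintype K] [DecidableEq K]

/-- Supermodularity makes the difference of `F` between `z + s'•e` and `z + s•e` monotone in the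
direction `f`. Thus `∂_f F` is monotone in the direction `e`, which gives the sign without computing
any second derivative. -/
theorem mixed_deriv_nonneg {F : (K → ℝ) → ℝ} (hF : BddC2 F) (k l : K)
    (h : ∀ (z : K → ℝ) (s t : ℝ), 0 ≤ s → 0 ≤ t →
      F (z + s • Pi.single k 1) + F (z + t • Pi.single l 1) ≤
        F (z + s • Pi.single k 1 + t • Pi.single l 1) + F z) (z : K → ℝ) :
    0 ≤ fderiv ℝ (fderiv ℝ F) z (Pi.single k 1) (Pi.single l 1) := by
  set e : K → ℝ := Pi.single k 1
  set f : K → ℝ := Pi.single l 1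
  have line : ∀ (z a : K → ℝ) (t : ℝ), HasDerivAt (fun t : ℝ => z + t • a) a t := by
    intro z a t
    simpa using ((hasDerivAt_id t).smul_const a).const_add z
  have hdF : ∀ (z a : K → ℝ) (t : ℝ),
      HasDerivAt (fun t : ℝ => F (z + t • a)) (fderiv ℝ F (z + t • a) a) t := fun z a t =>
    (hF.differentiable _).hasFDerivAt.comp_hasDerivAt t (line z a t)
  have hmono : Monotone fun s : ℝ => fderiv ℝ F (z + s • e) f := by
    intro s s' hs
    have hd := (hdF (z + s' • e) f 0).fun_sub (hdF (z + s • e) f 0)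
    have hm : Monotone fun t : ℝ => F (z + s' • e + t • f) - F (z + s • e + t • f) := by
      intro t t' ht
      have := h (z + s • e + t • f) (s' - s) (t' - t) (by linarith) (by linarith)
      have e1 : z + s • e + t • f + (s' - s) • e = z + s' • e + t • f := by
        rw [sub_smul]; abel
      have e2 : z + s • e + t • f + (t' - t) • f = z + s • e + t' • f := by
        rw [sub_smul]; abel
      have e3 : z + s' • e + t • f + (t' - t) • f = z + s' • e + t' • f := by
        rw [sub_smul]; abel
      rw [e1, e2, e3] at this
      simp only
      linarith
    have := hd.nonneg_of_monotone hm
    simpa using this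
  have hd : HasDerivAt (fun s : ℝ => fderiv ℝ F (z + s • e) f)
      (fderiv ℝ (fderiv ℝ F) (z + (0 : ℝ) • e) e f) 0 := by
    have := HasFDerivAt.comp_hasDerivAt (l := fun w => fderiv ℝ F w f) 0
      (hasFDerivAt_fderiv_apply hF (z + (0 : ℝ) • e) f) (line z e 0)
    exact this
  simpa using hd.nonneg_of_monotone hmono

variable {ι κ : Type*} [Fintype ι] [Fintype κ] [DecidableEq ι] [DecidableEq κ]

/-- The covariance of the Gaussian vector `X`. -/
def covOf (X : (ι → ℝ) →L[ℝ] (K → ℝ)) (k l : K) : ℝ :=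
  ∑ i, X (Pi.single i 1) k * X (Pi.single i 1) l

theorem sum_bilin_eq_sum_covOf (B : (K → ℝ) →L[ℝ] (K → ℝ) →L[ℝ] ℝ)
    (X : (ι → ℝ) →L[ℝ] (K → ℝ)) :
    ∑ i, B (X (Pi.single i 1)) (X (Pi.single i 1)) =
      ∑ k, ∑ l, covOf X k l * B (Pi.single k 1) (Pi.single l 1) := by
  have h : ∀ a b : K → ℝ, B a b = ∑ k, ∑ l, a k * b l * B (Pi.single k 1) (Pi.single l 1) := by
    intro a b
    conv_lhs => rw [eq_sum_smul_single a, eq_sum_smul_single b]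
    simp only [map_sum, map_smul, sum_apply, smul_apply, smul_eq_mul,
      Finset.mul_sum]
    rw [Finset.sum_comm]
    exact Finset.sum_congr rfl fun k _ => Finset.sum_congr rfl fun l _ => by ring
  simp only [covOf, Finset.sum_mul]
  rw [Finset.sum_congr rfl fun i _ => h (X (Pi.single i 1)) (X (Pi.single i 1)), Finset.sum_comm]
  refine Finset.sum_congr rfl fun k _ => ?_
  rw [Finset.sum_comm]

theorem hessGap_nonpos {F : (K → ℝ) → ℝ} (X : (ι → ℝ) →L[ℝ] (K → ℝ))
    (Y : (κ → ℝ) →L[ℝ] (K → ℝ)) (z : K → ℝ)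
    (h : ∀ k l, (covOf Y k l - covOf X k l) *
      fderiv ℝ (fderiv ℝ F) z (Pi.single k 1) (Pi.single l 1) ≤ 0) :
    hessGap F X Y z ≤ 0 := by
  rw [hessGap, sum_bilin_eq_sum_covOf, sum_bilin_eq_sum_covOf, ← Finset.sum_sub_distrib]
  refine Finset.sum_nonpos fun k _ => ?_
  rw [← Finset.sum_sub_distrib]
  refine Finset.sum_nonpos fun l _ => ?_
  rw [← sub_mul]
  exact h k l

/-- The function is constant outside `[0, 1]`, so its derivative has compact support and all higher
derivatives are bounded. -/
theorem bddC2_smoothTransition : BddC2 Real.smoothTransition := by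
  have hcd : ContDiff ℝ 2 Real.smoothTransition := Real.smoothTransition.contDiff (n := 2)
  have hcd1 : ContDiff ℝ 1 (fderiv ℝ Real.smoothTransition) := hcd.fderiv_right (by norm_num)
  have hc : HasCompactSupport (fderiv ℝ Real.smoothTransition) := by
    refine HasCompactSupport.intro (isCompact_Icc (a := (0 : ℝ)) (b := 1)) fun x hx => ?_
    have : Real.smoothTransition =ᶠ[𝓝 x] fun _ => Real.smoothTransition x := by
      rw [mem_Icc, not_and_or, not_le, not_le] at hx
      rcases hx with hx | hx
      · filter_upwards [Iio_mem_nhds hx] with y hy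
        rw [Real.smoothTransition.zero_of_nonpos hx.le,
          Real.smoothTransition.zero_of_nonpos (le_of_lt hy)]
      · filter_upwards [Ioi_mem_nhds hx] with y hy
        rw [Real.smoothTransition.one_of_one_le hx.le,
          Real.smoothTransition.one_of_one_le (le_of_lt hy)]
    rw [this.fderiv_eq]
    simp
  have h : ∀ k : ℕ, ∃ C, k ≤ 2 → ∀ x, ‖iteratedFDeriv ℝ k Real.smoothTransition x‖ ≤ C := by
    intro k
    rcases k with _ | k
    · refine ⟨1, fun _ x => ?_⟩
      rw [norm_iteratedFDeriv_zero, Real.norm_eq_abs,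
        abs_of_nonneg (Real.smoothTransition.nonneg x)]
      exact Real.smoothTransition.le_one x
    · by_cases hk : k + 1 ≤ 2
      · obtain ⟨C, hC⟩ := (hc.iteratedFDeriv (𝕜 := ℝ) k).exists_bound_of_continuous
          (hcd1.continuous_iteratedFDeriv (by exact_mod_cast (by omega : k ≤ 1)))
        refine ⟨C, fun _ x => ?_⟩
        rw [← norm_iteratedFDeriv_fderiv]
        exact hC x
      · exact ⟨0, fun h => absurd h hk⟩
  choose C hC using h
  refine bddC2_iff.2 ⟨hcd, max (C 0) (max (C 1) (C 2)), fun k hk x => (hC k hk x).trans ?_⟩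
  interval_cases k <;> simp

theorem BddC2.comp_affine {g : ℝ → ℝ} (hg : BddC2 g) (a b : ℝ) : BddC2 fun t => g (a * t + b) := by
  have h1 : BddC2 fun t => g (t + b) := by
    obtain ⟨h, C, hC⟩ := bddC2_iff.1 hg
    refine bddC2_iff.2 ⟨h.comp (contDiff_id.add contDiff_const), C, fun k hk x => ?_⟩
    rw [iteratedFDeriv_comp_add_right]
    exact hC k hk _
  exact h1.comp_clm (ContinuousLinearMap.mul ℝ ℝ a)

/-- A smooth approximation of the indicator function of `[c, ∞)` on the scale `δ`. -/
noncomputable def smoothStep (c δ t : ℝ) : ℝ :=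
  Real.smoothTransition (δ⁻¹ * t + (1 - δ⁻¹ * c))

theorem bddC2_smoothStep (c δ : ℝ) : BddC2 (smoothStep c δ) :=
  bddC2_smoothTransition.comp_affine _ _

theorem smoothStep_eq_one {c δ t : ℝ} (hδ : 0 < δ) (h : c ≤ t) : smoothStep c δ t = 1 := by
  refine Real.smoothTransition.one_of_one_le ?_
  have : δ⁻¹ * c ≤ δ⁻¹ * t := by gcongr
  linarith

theorem smoothStep_eq_zero {c δ t : ℝ} (hδ : 0 < δ) (h : t ≤ c - δ) : smoothStep c δ t = 0 := by
  refine Real.smoothTransition.zero_of_nonpos ?_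
  have : δ⁻¹ * t ≤ δ⁻¹ * (c - δ) := by gcongr
  rw [mul_sub, inv_mul_cancel₀ hδ.ne'] at this
  linarith

theorem smoothStep_mono {c δ : ℝ} (hδ : 0 < δ) : Monotone (smoothStep c δ) := by
  intro s t hst
  refine Real.smoothTransition.monotone ?_
  gcongr

variable {I J : Type*} [Fintype J]

/-- Smooth approximation of the indicator of `∃ j, c ≤ z (i, j)`. -/
noncomputable def rowStep (c δ : ℝ) (i : I) (z : I × J → ℝ) : ℝ :=
  1 - ∏ j, (1 - smoothStep c δ (z (i, j)))

theorem one_sub_smoothStep_mem (c δ t : ℝ) :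
    0 ≤ 1 - smoothStep c δ t ∧ 1 - smoothStep c δ t ≤ 1 :=
  ⟨sub_nonneg.2 (Real.smoothTransition.le_one _),
    sub_le_self _ (Real.smoothTransition.nonneg _)⟩

theorem rowStep_nonneg (c δ : ℝ) (i : I) (z : I × J → ℝ) : 0 ≤ rowStep c δ i z :=
  sub_nonneg.2 (Finset.prod_le_one (fun _ _ => (one_sub_smoothStep_mem _ _ _).1)
    fun _ _ => (one_sub_smoothStep_mem _ _ _).2)

theorem rowStep_le_one (c δ : ℝ) (i : I) (z : I × J → ℝ) : rowStep c δ i z ≤ 1 :=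
  sub_le_self _ (Finset.prod_nonneg fun _ _ => (one_sub_smoothStep_mem _ _ _).1)

theorem rowStep_mono {c δ : ℝ} (hδ : 0 < δ) (i : I) {z z' : I × J → ℝ}
    (h : ∀ j, z (i, j) ≤ z' (i, j)) : rowStep c δ i z ≤ rowStep c δ i z' := by
  refine sub_le_sub_left (Finset.prod_le_prod (fun _ _ => (one_sub_smoothStep_mem _ _ _).1)
    fun j _ => ?_) _
  exact sub_le_sub_left (smoothStep_mono hδ (h j)) _

theorem rowStep_congr (c δ : ℝ) (i : I) {z z' : I × J → ℝ}
    (h : ∀ j, z (i, j) = z' (i, j)) : rowStep c δ i z = rowStep c δ i z' := by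
  simp only [rowStep, h]

theorem rowStep_eq_one {c δ : ℝ} (hδ : 0 < δ) {i : I} {z : I × J → ℝ} {j : J}
    (h : c ≤ z (i, j)) : rowStep c δ i z = 1 := by
  rw [rowStep, Finset.prod_eq_zero (Finset.mem_univ j), sub_zero]
  rw [smoothStep_eq_one hδ h, sub_self]

theorem rowStep_eq_zero {c δ : ℝ} (hδ : 0 < δ) {i : I} {z : I × J → ℝ}
    (h : ∀ j, z (i, j) ≤ c - δ) : rowStep c δ i z = 0 := by
  rw [rowStep, Finset.prod_eq_one, sub_self]
  intro j _
  rw [smoothStep_eq_zero hδ (h j), sub_zero]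

variable [Fintype I]

theorem bddC2_prod_rowStep (c δ : ℝ) :
    BddC2 fun z : I × J → ℝ => ∏ i, rowStep c δ i z := by
  refine BddC2.prod _ fun i _ => BddC2.const_sub 1 (BddC2.prod _ fun j _ => BddC2.const_sub 1 ?_)
  exact (bddC2_smoothStep c δ).comp_clm (ContinuousLinearMap.proj (R := ℝ) (φ := fun _ : I × J => ℝ) (i, j))

/-- Raising an entry of row `k.1` affects only the factor of that row, and upwards. With two
different rows, the excess is the product of the two increments and of the remaining nonnegative
factors. -/
theorem prod_rowStep_supermodular [DecidableEq I] [DecidableEq J] {c δ : ℝ} (hδ : 0 < δ)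
    {k l : I × J} (hkl : k.1 ≠ l.1)
    (z : I × J → ℝ) {s t : ℝ} (hs : 0 ≤ s) (ht : 0 ≤ t) :
    ∏ i, rowStep c δ i (z + s • Pi.single k 1) + ∏ i, rowStep c δ i (z + t • Pi.single l 1) ≤
      ∏ i, rowStep c δ i (z + s • Pi.single k 1 + t • Pi.single l 1) + ∏ i, rowStep c δ i z := by
  have hsplit : ∀ w : I × J → ℝ, ∏ i, rowStep c δ i w =
      rowStep c δ k.1 w * (rowStep c δ l.1 w *
        ∏ i ∈ (Finset.univ.erase k.1).erase l.1, rowStep c δ i w) := by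
    intro w
    rw [Finset.mul_prod_erase _ (fun i => rowStep c δ i w)
        (Finset.mem_erase.2 ⟨hkl.symm, Finset.mem_univ _⟩),
      Finset.mul_prod_erase _ (fun i => rowStep c δ i w) (Finset.mem_univ _)]
  have hne : ∀ (k : I × J) (w : I × J → ℝ) (s : ℝ) {i : I}, i ≠ k.1 →
      rowStep c δ i (w + s • Pi.single k 1) = rowStep c δ i w := by
    intro k w s i hi
    refine rowStep_congr c δ i fun j => ?_
    have : (i, j) ≠ k := fun h => hi (by rw [← h])
    simp [Pi.single_eq_of_ne this]
  have hR : ∀ w w' : I × J → ℝ, (∀ i, i ≠ k.1 → i ≠ l.1 → rowStep c δ i w = rowStep c δ i w') →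
      ∏ i ∈ (Finset.univ.erase k.1).erase l.1, rowStep c δ i w =
        ∏ i ∈ (Finset.univ.erase k.1).erase l.1, rowStep c δ i w' := by
    intro w w' h
    refine Finset.prod_congr rfl fun i hi => ?_
    simp only [Finset.mem_erase, Finset.mem_univ, and_true] at hi
    exact h i hi.2 hi.1
  rw [hsplit, hsplit (z + t • _), hsplit (z + s • _ + t • _), hsplit z,
    hR (z + s • Pi.single k 1) z fun i h _ => hne k z s h,
    hR (z + t • Pi.single l 1) z fun i _ h => hne l z t h,
    hR (z + s • Pi.single k 1 + t • Pi.single l 1) z fun i h h' => by rw [hne l _ t h', hne k _ s h],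
    hne l (z + s • Pi.single k 1) t hkl, hne l z t hkl, hne k z s hkl.symm]
  have e1 : rowStep c δ l.1 (z + s • Pi.single k 1 + t • Pi.single l 1) =
      rowStep c δ l.1 (z + t • Pi.single l 1) := by
    rw [add_right_comm, hne k _ s hkl.symm]
  rw [e1]
  have hRn : 0 ≤ ∏ i ∈ (Finset.univ.erase k.1).erase l.1, rowStep c δ i z :=
    Finset.prod_nonneg fun i _ => rowStep_nonneg c δ i z
  have hm : ∀ (k : I × J) (s : ℝ), 0 ≤ s →
      rowStep c δ k.1 z ≤ rowStep c δ k.1 (z + s • Pi.single k 1) := by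
    intro k s hs
    refine rowStep_mono hδ _ fun j => ?_
    simp only [Pi.add_apply, Pi.smul_apply, smul_eq_mul, le_add_iff_nonneg_right]
    refine mul_nonneg hs ?_
    rw [Pi.single_apply]
    split_ifs <;> norm_num
  have h1 := hm k s hs
  have h2 := hm l t ht
  nlinarith [mul_nonneg hRn (mul_nonneg (sub_nonneg.2 h1) (sub_nonneg.2 h2))]

/-- The minimum over the rows of the maximum over the columns. -/
noncomputable def minmax [Nonempty I] [Nonempty J] (z : I × J → ℝ) : ℝ :=
  Finset.univ.inf' Finset.univ_nonempty fun i => Finset.univ.sup' Finset.univ_nonempty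
    fun j => z (i, j)

theorem le_minmax_iff [Nonempty I] [Nonempty J] {z : I × J → ℝ} {c : ℝ} :
    c ≤ minmax z ↔ ∀ i, ∃ j, c ≤ z (i, j) := by
  simp [minmax, Finset.le_inf'_iff, Finset.le_sup'_iff]

theorem lt_minmax_iff [Nonempty I] [Nonempty J] {z : I × J → ℝ} {c : ℝ} :
    c < minmax z ↔ ∀ i, ∃ j, c < z (i, j) := by
  simp [minmax, Finset.lt_inf'_iff, Finset.lt_sup'_iff]

theorem continuous_minmax [Nonempty I] [Nonempty J] :
    Continuous (minmax : (I × J → ℝ) → ℝ) :=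
  Continuous.finset_inf'_apply _ fun i _ => Continuous.finset_sup'_apply _ fun j _ =>
    continuous_apply (i, j)

/-- Gordon's comparison theorem in smoothed form. -/
theorem gordon_measure_le [Nonempty I] [Nonempty J] [DecidableEq I] [DecidableEq J]
    (X : (ι → ℝ) →L[ℝ] (I × J → ℝ)) (Y : (κ → ℝ) →L[ℝ] (I × J → ℝ))
    (hrow : ∀ i j j', covOf Y (i, j) (i, j') = covOf X (i, j) (i, j'))
    (hcross : ∀ k l, k.1 ≠ l.1 → covOf Y k l ≤ covOf X k l) (c : ℝ) {δ : ℝ} (hδ : 0 < δ) :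
    gaussPi ι {x | minmax (X x) ≤ c - δ} ≤ gaussPi κ {y | minmax (Y y) < c} := by
  have hF := bddC2_prod_rowStep (I := I) (J := J) c δ
  -- Within a row the covariances agree, so those second derivatives, whose sign is not controlled,
  -- drop out. Across rows the covariance difference is nonpositive and the mixed derivative
  -- nonnegative.
  have h := integral_le_integral_of_hessGap_nonpos hF X Y fun z => hessGap_nonpos X Y z fun k l => by
    by_cases hkl : k.1 = l.1
    · obtain ⟨i, j⟩ := k
      obtain ⟨i', j'⟩ := l
      obtain rfl : i = i' := hkl
      rw [hrow, sub_self, zero_mul]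
    · exact mul_nonpos_of_nonpos_of_nonneg (sub_nonpos.2 (hcross k l hkl))
        (mixed_deriv_nonneg hF k l (fun z s t hs ht => prod_rowStep_supermodular hδ hkl z hs ht) z)
  have hX1 : MeasurableSet {x | minmax (X x) ≤ c - δ} :=
    (isClosed_le (continuous_minmax.comp X.continuous) continuous_const).measurableSet
  have hY1 : MeasurableSet {y | minmax (Y y) < c} :=
    (isOpen_lt (continuous_minmax.comp Y.continuous) continuous_const).measurableSet
  -- The smooth product is `1` where `minmax ≥ c` and `0` where `minmax ≤ c - δ`, so it lies between
  -- the two indicators.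
  have hY2 : (gaussPi κ).real {y | minmax (Y y) < c}ᶜ ≤
      ∫ y, ∏ i, rowStep c δ i (Y y) ∂(gaussPi κ) := by
    rw [← integral_indicator_one hY1.compl]
    refine integral_mono ((integrable_const (1 : ℝ)).indicator hY1.compl)
      (integrable_bddC2_comp hF Y) fun y => ?_
    by_cases hy : y ∈ {y | minmax (Y y) < c}ᶜ
    · rw [indicator_of_mem hy]
      have hy' : c ≤ minmax (Y y) := not_lt.1 hy
      rw [le_minmax_iff] at hy'
      simp only [Pi.one_apply]
      rw [Finset.prod_eq_one]
      intro i _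
      obtain ⟨j, hj⟩ := hy' i
      exact rowStep_eq_one hδ hj
    · rw [indicator_of_notMem hy]
      exact Finset.prod_nonneg fun i _ => rowStep_nonneg c δ i _
  have hX2 : ∫ x, ∏ i, rowStep c δ i (X x) ∂(gaussPi ι) ≤
      (gaussPi ι).real {x | minmax (X x) ≤ c - δ}ᶜ := by
    rw [← integral_indicator_one hX1.compl]
    refine integral_mono (integrable_bddC2_comp hF X)
      ((integrable_const (1 : ℝ)).indicator hX1.compl) fun x => ?_
    by_cases hx : x ∈ {x | minmax (X x) ≤ c - δ}ᶜ
    · rw [indicator_of_mem hx]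
      exact Finset.prod_le_one (fun i _ => rowStep_nonneg c δ i _) fun i _ => rowStep_le_one c δ i _
    · rw [indicator_of_notMem hx]
      have hx' : minmax (X x) ≤ c - δ := by simpa using hx
      have hx2 : ¬ (∀ i, ∃ j, c - δ < X x (i, j)) := fun h => absurd (lt_minmax_iff.2 h) hx'.not_gt
      push Not at hx2
      obtain ⟨i, hi⟩ := hx2
      exact (Finset.prod_eq_zero (Finset.mem_univ i) (rowStep_eq_zero hδ hi)).le
  have h3 := hY2.trans (h.trans hX2)
  rw [probReal_compl_eq_one_sub hY1, probReal_compl_eq_one_sub hX1] at h3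
  have h4 : (gaussPi ι).real {x | minmax (X x) ≤ c - δ} ≤
      (gaussPi κ).real {y | minmax (Y y) < c} := by linarith
  exact (ENNReal.toReal_le_toReal (measure_ne_top _ _) (measure_ne_top _ _)).1 h4

theorem gordon_measure_lt_le [Nonempty I] [Nonempty J] [DecidableEq I] [DecidableEq J]
    (X : (ι → ℝ) →L[ℝ] (I × J → ℝ)) (Y : (κ → ℝ) →L[ℝ] (I × J → ℝ))
    (hrow : ∀ i j j', covOf Y (i, j) (i, j') = covOf X (i, j) (i, j'))
    (hcross : ∀ k l, k.1 ≠ l.1 → covOf Y k l ≤ covOf X k l) (c : ℝ) :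
    gaussPi ι {x | minmax (X x) < c} ≤ gaussPi κ {y | minmax (Y y) < c} := by
  have hU : {x | minmax (X x) < c} = ⋃ n : ℕ, {x | minmax (X x) ≤ c - 1 / ((n : ℝ) + 1)} := by
    ext x
    simp only [mem_ofPred_eq, mem_iUnion]
    constructor
    · intro h
      obtain ⟨n, hn⟩ := exists_nat_one_div_lt (sub_pos.2 h)
      exact ⟨n, by linarith⟩
    · rintro ⟨n, hn⟩
      have : 0 < 1 / ((n : ℝ) + 1) := by positivity
      linarith
  have hm : Monotone fun n : ℕ => {x | minmax (X x) ≤ c - 1 / ((n : ℝ) + 1)} := by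
    intro a b hab x hx
    have hx : minmax (X x) ≤ c - 1 / ((a : ℝ) + 1) := hx
    have : 1 / ((b : ℝ) + 1) ≤ 1 / ((a : ℝ) + 1) := by gcongr
    exact hx.trans (by linarith)
  rw [hU, hm.measure_iUnion]
  exact iSup_le fun n => gordon_measure_le X Y hrow hcross c (by positivity)

/-- Gordon's comparison theorem for Laplace transforms. -/
theorem gordon_lintegral_exp_le [Nonempty I] [Nonempty J] [DecidableEq I] [DecidableEq J]
    (X : (ι → ℝ) →L[ℝ] (I × J → ℝ)) (Y : (κ → ℝ) →L[ℝ] (I × J → ℝ))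
    (hrow : ∀ i j j', covOf Y (i, j) (i, j') = covOf X (i, j) (i, j'))
    (hcross : ∀ k l, k.1 ≠ l.1 → covOf Y k l ≤ covOf X k l) {s : ℝ} (hs : 0 ≤ s) :
    ∫⁻ x, ENNReal.ofReal (Real.exp (-(s * minmax (X x)))) ∂(gaussPi ι) ≤
      ∫⁻ y, ENNReal.ofReal (Real.exp (-(s * minmax (Y y)))) ∂(gaussPi κ) := by
  rcases hs.eq_or_lt with rfl | hs
  · simp
  have hX : Continuous fun x => Real.exp (-(s * minmax (X x))) := Real.continuous_exp.comp
    (continuous_const.mul (continuous_minmax.comp X.continuous)).neg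
  have hY : Continuous fun y => Real.exp (-(s * minmax (Y y))) := Real.continuous_exp.comp
    (continuous_const.mul (continuous_minmax.comp Y.continuous)).neg
  -- Layer-cake formula: the superlevel sets of `e^{-s minmax}` are sublevel sets of `minmax`, for
  -- which the comparison is known.
  rw [lintegral_eq_lintegral_meas_lt _ (ae_of_all _ fun x => (Real.exp_pos _).le)
      hX.measurable.aemeasurable,
    lintegral_eq_lintegral_meas_lt _ (ae_of_all _ fun x => (Real.exp_pos _).le)
      hY.measurable.aemeasurable]
  refine setLIntegral_mono' measurableSet_Ioi fun t ht => ?_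
  have ht : 0 < t := ht
  have e : ∀ M : ℝ, t < Real.exp (-(s * M)) ↔ M < -Real.log t / s := by
    intro M
    rw [← Real.log_lt_iff_lt_exp ht, lt_div_iff₀ hs]
    constructor <;> intro h <;> linarith
  simp only [e]
  exact gordon_measure_lt_le X Y hrow hcross _

end

/-! ### The mean of the norm of a Gaussian vector -/

theorem gaussPi_eq_withDensity (ι : Type*) [Fintype ι] :
    gaussPi ι = (volume : Measure (ι → ℝ)).withDensity
      fun x => ENNReal.ofReal (∏ i, gaussianPDFReal 0 1 (x i)) := by
  refine Measure.pi_eq fun s hs => ?_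
  have hpos : ∀ x : ι → ℝ, 0 ≤ ∏ i, gaussianPDFReal 0 1 (x i) := fun x =>
    Finset.prod_nonneg fun i _ => gaussianPDFReal_nonneg 0 1 _
  have hint : Integrable (fun x : ι → ℝ => ∏ i, gaussianPDFReal 0 1 (x i)) :=
    Integrable.fintype_prod fun _ => integrable_gaussianPDFReal 0 1
  rw [withDensity_apply _ (MeasurableSet.univ_pi hs),
    ← ofReal_integral_eq_lintegral_ofReal hint.integrableOn (ae_of_all _ hpos), volume_pi,
    Measure.restrict_pi_pi, integral_fintype_prod_eq_prod (fun _ => gaussianPDFReal 0 1),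
    ENNReal.ofReal_prod_of_nonneg fun i _ =>
      integral_nonneg fun x => gaussianPDFReal_nonneg 0 1 x]
  exact Finset.prod_congr rfl fun i _ => (gaussianReal_apply_eq_integral 0 one_ne_zero (s i)).symm

/-- Polar coordinates. The constant may stay unspecified: taking `f = 1` determines it, so the
volume of the ball cancels in the mean of the norm. -/
theorem integral_fun_norm_stdGaussian {m : ℕ} (hm : 0 < m) : ∃ c : ℝ, ∀ f : ℝ → ℝ,
    Measurable f → ∫ x, f ‖x‖ ∂(stdGaussian (E m)) =
      c * ∫ y in Ioi (0 : ℝ), y ^ (m - 1) * (Real.exp (-y ^ 2 / 2) * f y) := by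
  have : Nonempty (Fin m) := ⟨⟨0, hm⟩⟩
  have : Nontrivial (E m) := by
    refine Module.nontrivial_of_finrank_pos (R := ℝ) ?_
    rw [finrank_euclideanSpace_fin]
    exact hm
  refine ⟨((√(2 * Real.pi))⁻¹) ^ m * (m * (volume : Measure (E m)).real (Metric.ball 0 1)),
    fun f hf => ?_⟩
  have hpdf : ∀ x : Fin m → ℝ, ∏ i, gaussianPDFReal 0 1 (x i) =
      ((√(2 * Real.pi))⁻¹) ^ m * Real.exp (-‖toE (Fin m) x‖ ^ 2 / 2) := by
    intro x
    simp only [gaussianPDFReal, Finset.prod_mul_distrib, Finset.prod_const, Finset.card_univ,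
      Fintype.card_fin, ← Real.exp_sum]
    rw [EuclideanSpace.real_norm_sq_eq]
    simp [Finset.sum_div, Finset.sum_neg_distrib, neg_div]
  have h1 : ∫ x, f ‖x‖ ∂(stdGaussian (E m)) = ∫ x, f ‖toE (Fin m) x‖ ∂(gaussPi (Fin m)) := by
    rw [← measurePreserving_toE.map_eq, integral_map measurePreserving_toE.measurable.aemeasurable]
    exact (hf.comp measurable_norm).aestronglyMeasurable
  rw [h1, gaussPi_eq_withDensity, integral_withDensity_eq_integral_toReal_smul]
  · have h2 : ∀ x : Fin m → ℝ, (ENNReal.ofReal (∏ i, gaussianPDFReal 0 1 (x i))).toReal •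
        f ‖toE (Fin m) x‖ = (fun v : E m => ((√(2 * Real.pi))⁻¹) ^ m *
          (Real.exp (-‖v‖ ^ 2 / 2) * f ‖v‖)) (WithLp.toLp 2 x) := by
      intro x
      rw [ENNReal.toReal_ofReal (Finset.prod_nonneg fun i _ => gaussianPDFReal_nonneg 0 1 _), hpdf,
        smul_eq_mul, mul_assoc]
      rfl
    simp_rw [h2]
    rw [(PiLp.volume_preserving_toLp (Fin m)).integral_comp
      (MeasurableEquiv.toLp 2 (Fin m → ℝ)).measurableEmbedding (fun v : E m =>
        ((√(2 * Real.pi))⁻¹) ^ m * (Real.exp (-‖v‖ ^ 2 / 2) * f ‖v‖)), integral_const_mul,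
      integral_fun_norm_addHaar volume (fun y => Real.exp (-y ^ 2 / 2) * f y),
      finrank_euclideanSpace_fin]
    simp only [smul_eq_mul, nsmul_eq_mul]
    ring
  · refine Measurable.ennreal_ofReal ?_
    exact Finset.measurable_prod _ fun i _ =>
      (measurable_gaussianPDFReal 0 1).comp (measurable_pi_apply i)
  · exact ae_of_all _ fun x => ENNReal.ofReal_lt_top

theorem integral_pow_mul_exp (k : ℕ) :
    ∫ y in Ioi (0 : ℝ), y ^ k * Real.exp (-y ^ 2 / 2) =
      (1 / 2 : ℝ) ^ (-((k : ℝ) + 1) / 2) * (1 / 2) * Real.Gamma (((k : ℝ) + 1) / 2) := by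
  rw [← integral_rpow_mul_exp_neg_mul_rpow (p := 2) (q := k) (b := 1 / 2) (by norm_num)
    (by have : (0 : ℝ) ≤ k := by positivity
        linarith) (by norm_num)]
  refine setIntegral_congr_fun measurableSet_Ioi fun y _ => ?_
  simp only [Real.rpow_natCast, Real.rpow_two]
  congr 2
  ring

/-- The mean of the norm of a standard Gaussian vector. -/
theorem integral_norm_stdGaussian {m : ℕ} (hm : 0 < m) :
    ∫ x, ‖x‖ ∂(stdGaussian (E m)) = phi m := by
  obtain ⟨c, hc⟩ := integral_fun_norm_stdGaussian hm
  obtain ⟨k, rfl⟩ : ∃ k, m = k + 1 := ⟨m - 1, by omega⟩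
  have h1 := hc (fun _ => 1) measurable_const
  have h2 := hc (fun y => y) measurable_id
  simp only [integral_const, probReal_univ, one_smul, mul_one, Nat.add_sub_cancel] at h1
  rw [h2]
  have e : ∀ y : ℝ, y ^ k * (Real.exp (-y ^ 2 / 2) * y) = y ^ (k + 1) * Real.exp (-y ^ 2 / 2) :=
    fun y => by ring
  simp only [Nat.add_sub_cancel, e]
  rw [integral_pow_mul_exp] at h1 ⊢
  have hG : Real.Gamma (((k : ℝ) + 1) / 2) ≠ 0 := (Real.Gamma_pos_of_pos (by positivity)).ne'
  have hp : (1 / 2 : ℝ) ^ (-((k : ℝ) + 1) / 2) ≠ 0 := by positivity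
  have hs : (1 / 2 : ℝ) ^ (-((k + 1 : ℕ) + 1 : ℝ) / 2) =
      (1 / 2 : ℝ) ^ (-((k : ℝ) + 1) / 2) * √2 := by
    have : (√2 : ℝ) = (1 / 2 : ℝ) ^ (-1 / 2 : ℝ) := by
      rw [Real.sqrt_eq_rpow, one_div, ← Real.rpow_neg_one (2 : ℝ),
        ← Real.rpow_mul (by norm_num : (0 : ℝ) ≤ 2)]
      norm_num
    rw [this, ← Real.rpow_add (by norm_num)]
    congr 1
    push_cast
    ring
  rw [hs, phi]
  push_cast
  rw [eq_div_iff hG]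
  calc _ = (c * ((1 / 2 : ℝ) ^ (-((k : ℝ) + 1) / 2) * (1 / 2) *
        Real.Gamma (((k : ℝ) + 1) / 2))) * (√2 * Real.Gamma (((k : ℝ) + 1 + 1) / 2)) := by ring
    _ = _ := by rw [← h1, one_mul]

/-! ### Gordon's theorem for Gaussian matrices -/

/-- The matrix with the given entries. -/
def matOf {m n : ℕ} (a : Fin m × Fin n → ℝ) : Matrix (Fin m) (Fin n) ℝ :=
  Matrix.of fun i j => a (i, j)

theorem real_inner_eq_sum {n : ℕ} (x y : E n) : inner ℝ x y = ∑ i, x i * y i := by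
  rw [PiLp.inner_apply]
  exact Finset.sum_congr rfl fun i _ => by simp [mul_comm]

theorem inner_matOf {m n : ℕ} (a : Fin m × Fin n → ℝ) (u : E m) (v : E n) :
    inner ℝ u ((matOf a).toEuclideanLin v) = ∑ p : Fin m × Fin n, u p.1 * v p.2 * a p := by
  rw [real_inner_eq_sum, Fintype.sum_prod_type]
  refine Finset.sum_congr rfl fun i _ => ?_
  simp only [Matrix.toLpLin_apply, Matrix.mulVec, dotProduct, matOf, Matrix.of_apply,
    Finset.mul_sum]
  exact Finset.sum_congr rfl fun j _ => by ring

section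

variable {m n : ℕ} {I J : Type*}

/-- The Gaussian process `⟨u, A v⟩ + g`. -/
noncomputable def matProc (v : I → E n) (u : I × J → E m) :
    ((Fin m × Fin n) ⊕ Unit → ℝ) →L[ℝ] (I × J → ℝ) :=
  ContinuousLinearMap.pi fun k => ∑ p : Fin m × Fin n, (u k p.1 * v k.1 p.2) •
    ContinuousLinearMap.proj (R := ℝ) (φ := fun _ => ℝ) (Sum.inl p) +
    ContinuousLinearMap.proj (R := ℝ) (φ := fun _ => ℝ) (Sum.inr ())

/-- The Gaussian process `⟨g, u⟩ - ⟨h, v⟩`. -/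
noncomputable def vecProc (v : I → E n) (u : I × J → E m) :
    (Fin m ⊕ Fin n → ℝ) →L[ℝ] (I × J → ℝ) :=
  ContinuousLinearMap.pi fun k =>
    ∑ i, u k i • ContinuousLinearMap.proj (R := ℝ) (φ := fun _ => ℝ) (Sum.inl i) -
    ∑ j, v k.1 j • ContinuousLinearMap.proj (R := ℝ) (φ := fun _ => ℝ) (Sum.inr j)

theorem matProc_apply (v : I → E n) (u : I × J → E m) (x : (Fin m × Fin n) ⊕ Unit → ℝ)
    (k : I × J) : matProc v u x k = inner ℝ (u k) ((matOf (resInl _ _ x)).toEuclideanLin (v k.1)) +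
      x (Sum.inr ()) := by
  rw [inner_matOf]
  simp [matProc]

theorem vecProc_apply (v : I → E n) (u : I × J → E m) (x : Fin m ⊕ Fin n → ℝ) (k : I × J) :
    vecProc v u x k = inner ℝ (u k) (toE _ (resInl _ _ x)) -
      inner ℝ (v k.1) (toE _ (resInr _ _ x)) := by
  rw [real_inner_eq_sum, real_inner_eq_sum]
  simp [vecProc]

/-- The `+ 1` from the auxiliary Gaussian makes Gordon's hypotheses hold for unit vectors: minus the
covariance of `vecProc` it leaves `(1 - ⟨u, u'⟩)(1 - ⟨v, v'⟩)`, which is nonnegative, and zero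
within a row, where `v = v'`. -/
theorem covOf_matProc (v : I → E n) (u : I × J → E m) (k l : I × J) :
    covOf (matProc v u) k l = inner ℝ (u k) (u l) * inner ℝ (v k.1) (v l.1) + 1 := by
  have h1 : ∀ (p : Fin m × Fin n) (k : I × J),
      matProc v u (Pi.single (Sum.inl p) 1) k = u k p.1 * v k.1 p.2 := by
    intro p k
    simp [matProc, Pi.single_apply]
  have h2 : ∀ k : I × J, matProc v u (Pi.single (Sum.inr ()) 1) k = 1 := by
    intro k
    simp [matProc]
  simp only [covOf, Fintype.sum_sum_type, h1, h2, Fintype.sum_prod_type, real_inner_eq_sum,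
    Finset.sum_mul_sum]
  simp only [Finset.univ_unique, Finset.sum_singleton, mul_one, PUnit.default_eq_unit]
  congr 1
  exact Finset.sum_congr rfl fun i _ => Finset.sum_congr rfl fun j _ => by ring

theorem covOf_vecProc (v : I → E n) (u : I × J → E m) (k l : I × J) :
    covOf (vecProc v u) k l = inner ℝ (u k) (u l) + inner ℝ (v k.1) (v l.1) := by
  simp only [covOf, vecProc, Fintype.sum_sum_type]
  simp [Pi.single_apply, real_inner_eq_sum]

variable [Fintype I] [Fintype J] [Nonempty I] [Nonempty J]

theorem minmax_add_const (z : I × J → ℝ) (c : ℝ) :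
    minmax (fun k => z k + c) = minmax z + c := by
  refine eq_of_forall_le_iff fun d => ?_
  rw [le_minmax_iff, ← sub_le_iff_le_add, le_minmax_iff]
  simp only [sub_le_iff_le_add]

theorem lintegral_exp_gaussianReal (s : ℝ) :
    ∫⁻ t, ENNReal.ofReal (Real.exp (-(s * t))) ∂(gaussianReal 0 1) =
      ENNReal.ofReal (Real.exp (s ^ 2 / 2)) := by
  have h := congrFun (mgf_id_gaussianReal (μ := 0) (v := 1)) (-s)
  simp only [mgf, id_eq] at h
  rw [← ofReal_integral_eq_lintegral_ofReal _ (ae_of_all _ fun x => (Real.exp_pos _).le)]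
  · congr 1
    simp only [← neg_mul]
    rw [h]
    simp
  · simpa only [← neg_mul] using integrable_exp_mul_gaussianReal (μ := 0) (v := 1) (-s)

/-- Gordon's bound for the Laplace transform of the min-max of a Gaussian bilinear form. -/
theorem lintegral_exp_minmax_matOf_le (v : I → E n) (u : I × J → E m)
    (hv : ∀ i, ‖v i‖ = 1) (hu : ∀ k, ‖u k‖ = 1) {a : E m → ℝ} {b : E n → ℝ}
    (ha : LipschitzWith 1 a) (hb : LipschitzWith 1 b)
    (hab : ∀ g h, a g + b h ≤ minmax fun k => inner ℝ (u k) g - inner ℝ (v k.1) h)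
    {s : ℝ} (hs : 0 ≤ s) :
    ∫⁻ x, ENNReal.ofReal (Real.exp (-(s * minmax fun k : I × J =>
        inner ℝ (u k) ((matOf x).toEuclideanLin (v k.1))))) ∂(gaussPi (Fin m × Fin n)) ≤
      ENNReal.ofReal (Real.exp (-(s * (∫ g, a g ∂(stdGaussian (E m)) +
        ∫ h, b h ∂(stdGaussian (E n)))) + s ^ 2 / 2)) := by
  classical
  have hu' : ∀ k, inner ℝ (u k) (u k) = (1 : ℝ) := fun k => by
    rw [real_inner_self_eq_norm_sq, hu]; norm_num
  have hv' : ∀ i, inner ℝ (v i) (v i) = (1 : ℝ) := fun i => by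
    rw [real_inner_self_eq_norm_sq, hv]; norm_num
  have hG := gordon_lintegral_exp_le (matProc v u) (vecProc v u)
    (fun i j j' => by
      rw [covOf_matProc, covOf_vecProc, hv', mul_one])
    (fun k l _ => by
      rw [covOf_matProc, covOf_vecProc]
      have h1 : inner ℝ (u k) (u l) ≤ (1 : ℝ) := by
        simpa [hu] using real_inner_le_norm (u k) (u l)
      have h2 : inner ℝ (v k.1) (v l.1) ≤ (1 : ℝ) := by
        simpa [hv] using real_inner_le_norm (v k.1) (v l.1)
      nlinarith) hs
  set M : (Fin m × Fin n → ℝ) → ℝ := fun x => minmax fun k : I × J =>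
    inner ℝ (u k) ((matOf x).toEuclideanLin (v k.1)) with hM
  have hMc : Continuous M := by
    refine continuous_minmax.comp (continuous_pi fun k => ?_)
    simp_rw [inner_matOf]
    fun_prop
  -- The auxiliary Gaussian shifts the min-max by an independent constant, hence contributes the
  -- factor `e^{s²/2}`.
  have hL : ∫⁻ x, ENNReal.ofReal (Real.exp (-(s * minmax (matProc v u x))))
      ∂(gaussPi ((Fin m × Fin n) ⊕ Unit)) =
      (∫⁻ x, ENNReal.ofReal (Real.exp (-(s * M x))) ∂(gaussPi (Fin m × Fin n))) *
        ENNReal.ofReal (Real.exp (s ^ 2 / 2)) := by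
    have h1 : ∀ x, ENNReal.ofReal (Real.exp (-(s * minmax (matProc v u x)))) =
        (fun p : (Fin m × Fin n → ℝ) × (Unit → ℝ) => ENNReal.ofReal (Real.exp (-(s * M p.1))) *
          ENNReal.ofReal (Real.exp (-(s * p.2 ())))) (resInl _ _ x, resInr _ _ x) := by
      intro x
      have : matProc v u x = fun k => inner ℝ (u k) ((matOf (resInl _ _ x)).toEuclideanLin (v k.1)) +
          x (Sum.inr ()) := funext fun k => matProc_apply v u x k
      simp only
      rw [this, minmax_add_const, ← ENNReal.ofReal_mul (Real.exp_pos _).le, ← Real.exp_add]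
      congr 2
      simp [hM]
      ring
    simp_rw [h1]
    rw [← lintegral_exp_gaussianReal s]
    have h2 : ∫⁻ t, ENNReal.ofReal (Real.exp (-(s * t))) ∂(gaussianReal 0 1) =
        ∫⁻ t : Unit → ℝ, ENNReal.ofReal (Real.exp (-(s * t ()))) ∂(gaussPi Unit) :=
      ((measurePreserving_eval (fun _ : Unit => gaussianReal 0 1) ()).lintegral_comp
        (f := fun t => ENNReal.ofReal (Real.exp (-(s * t)))) (by fun_prop)).symm
    rw [h2, ← lintegral_prod_mul (Measurable.aemeasurable (by fun_prop))
      (Measurable.aemeasurable (by fun_prop))]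
    exact measurePreserving_res.lintegral_comp
      (f := fun p : (Fin m × Fin n → ℝ) × (Unit → ℝ) => ENNReal.ofReal (Real.exp (-(s * M p.1))) *
          ENNReal.ofReal (Real.exp (-(s * p.2 ())))) (by fun_prop)
  have hR : ∫⁻ y, ENNReal.ofReal (Real.exp (-(s * minmax (vecProc v u y))))
      ∂(gaussPi (Fin m ⊕ Fin n)) ≤
      (∫⁻ g, ENNReal.ofReal (Real.exp (s * -a g)) ∂(stdGaussian (E m))) *
        ∫⁻ h, ENNReal.ofReal (Real.exp (s * -b h)) ∂(stdGaussian (E n)) := by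
    have hac := ha.continuous
    have hbc := hb.continuous
    have h1 : ∀ y, ENNReal.ofReal (Real.exp (-(s * minmax (vecProc v u y)))) ≤
        (fun p : (Fin m → ℝ) × (Fin n → ℝ) => ENNReal.ofReal (Real.exp (s * -a (toE _ p.1))) *
          ENNReal.ofReal (Real.exp (s * -b (toE _ p.2)))) (resInl _ _ y, resInr _ _ y) := by
      intro y
      have : vecProc v u y = fun k => inner ℝ (u k) (toE _ (resInl _ _ y)) -
          inner ℝ (v k.1) (toE _ (resInr _ _ y)) := funext fun k => vecProc_apply v u y k
      simp only
      rw [this, ← ENNReal.ofReal_mul (Real.exp_pos _).le, ← Real.exp_add]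
      refine ENNReal.ofReal_le_ofReal (Real.exp_le_exp.2 ?_)
      have := mul_le_mul_of_nonneg_left (hab (toE _ (resInl _ _ y)) (toE _ (resInr _ _ y))) hs
      linarith
    refine (lintegral_mono h1).trans (le_of_eq ?_)
    rw [measurePreserving_res.lintegral_comp
      (f := fun p : (Fin m → ℝ) × (Fin n → ℝ) => ENNReal.ofReal (Real.exp (s * -a (toE _ p.1))) *
          ENNReal.ofReal (Real.exp (s * -b (toE _ p.2)))) (by fun_prop),
      lintegral_prod_mul (f := fun p => ENNReal.ofReal (Real.exp (s * -a (toE _ p))))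
        (g := fun p => ENNReal.ofReal (Real.exp (s * -b (toE _ p)))) (by fun_prop) (by fun_prop),
      measurePreserving_toE.lintegral_comp (f := fun g => ENNReal.ofReal (Real.exp (s * -a g)))
        (by fun_prop),
      measurePreserving_toE.lintegral_comp (f := fun g => ENNReal.ofReal (Real.exp (s * -b g)))
        (by fun_prop)]
  rw [hL] at hG
  -- The Lipschitz bounds for `a` and `b` cost `e^{s²/2}` each; dividing by the factor of the
  -- auxiliary Gaussian leaves a single one.
  have hfin := hG.trans (hR.trans (mul_le_mul' (lintegral_exp_le_of_lipschitz ha.neg hs)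
    (lintegral_exp_le_of_lipschitz hb.neg hs)))
  rw [← ENNReal.le_div_iff_mul_le (by simp [Real.exp_pos]) (by simp)] at hfin
  refine hfin.trans ?_
  rw [← ENNReal.ofReal_mul (Real.exp_pos _).le, ← ENNReal.ofReal_div_of_pos (Real.exp_pos _),
    ← Real.exp_add, ← Real.exp_sub]
  simp only [Pi.neg_apply, integral_neg]
  refine ENNReal.ofReal_le_ofReal (Real.exp_le_exp.2 ?_)
  linarith

/-- Chernoff's bound with the optimal parameter `s = t`. -/
theorem measure_minmax_matOf_le (v : I → E n) (u : I × J → E m)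
    (hv : ∀ i, ‖v i‖ = 1) (hu : ∀ k, ‖u k‖ = 1) {a : E m → ℝ} {b : E n → ℝ}
    (ha : LipschitzWith 1 a) (hb : LipschitzWith 1 b)
    (hab : ∀ g h, a g + b h ≤ minmax fun k => inner ℝ (u k) g - inner ℝ (v k.1) h)
    {t : ℝ} (ht : 0 ≤ t) :
    gaussPi (Fin m × Fin n) {x | (minmax fun k : I × J =>
        inner ℝ (u k) ((matOf x).toEuclideanLin (v k.1))) ≤
          ∫ g, a g ∂(stdGaussian (E m)) + ∫ h, b h ∂(stdGaussian (E n)) - t} ≤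
      ENNReal.ofReal (Real.exp (-t ^ 2 / 2)) := by
  set c := ∫ g, a g ∂(stdGaussian (E m)) + ∫ h, b h ∂(stdGaussian (E n))
  set M : (Fin m × Fin n → ℝ) → ℝ := fun x => minmax fun k : I × J =>
    inner ℝ (u k) ((matOf x).toEuclideanLin (v k.1)) with hM
  have hMc : Continuous M := by
    refine continuous_minmax.comp (continuous_pi fun k => ?_)
    simp_rw [inner_matOf]
    fun_prop
  have hsub : {x | M x ≤ c - t} ⊆
      {x | ENNReal.ofReal (Real.exp (-(t * (c - t)))) ≤ ENNReal.ofReal (Real.exp (-(t * M x)))} := by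
    intro x hx
    have hx : M x ≤ c - t := hx
    exact ENNReal.ofReal_le_ofReal (Real.exp_le_exp.2 (by gcongr))
  have hpos : ENNReal.ofReal (Real.exp (-(t * (c - t)))) ≠ 0 := by
    simpa using Real.exp_pos _
  refine (measure_mono hsub).trans ?_
  refine (meas_ge_le_lintegral_div (by fun_prop) hpos ENNReal.ofReal_ne_top).trans ?_
  refine (ENNReal.div_le_div_right (lintegral_exp_minmax_matOf_le v u hv hu ha hb hab ht) _).trans ?_
  rw [← ENNReal.ofReal_div_of_pos (Real.exp_pos _), ← Real.exp_sub]
  refine ENNReal.ofReal_le_ofReal (Real.exp_le_exp.2 ?_)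
  linarith

end

/-! ### Uniform bounds for Gaussian matrices -/

section

variable {m n : ℕ}

/-- The support function of `D`, whose Gaussian mean is the Gaussian width. -/
noncomputable def supFun (D : Set (E n)) (h : E n) : ℝ :=
  sSup ((fun z : E n => inner ℝ h z) '' D)

theorem gaussianWidth_eq (D : Set (E n)) :
    gaussianWidth D = ∫ h, supFun D h ∂(stdGaussian (E n)) := rfl

theorem bddAbove_inner_image {D : Set (E n)} (hD : D ⊆ Metric.closedBall 0 1) (h : E n) :
    BddAbove ((fun z : E n => inner ℝ h z) '' D) := by
  refine ⟨‖h‖, ?_⟩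
  rintro _ ⟨z, hz, rfl⟩
  have hz1 : ‖z‖ ≤ 1 := by simpa using hD hz
  exact (real_inner_le_norm h z).trans (mul_le_of_le_one_right (norm_nonneg _) hz1)

theorem inner_le_supFun {D : Set (E n)} (hD : D ⊆ Metric.closedBall 0 1) (h : E n) {z : E n}
    (hz : z ∈ D) : inner ℝ h z ≤ supFun D h :=
  le_csSup (bddAbove_inner_image hD h) ⟨z, hz, rfl⟩

theorem lipschitzWith_supFun {D : Set (E n)} (hD : D ⊆ Metric.closedBall 0 1)
    (hne : D.Nonempty) : LipschitzWith 1 (supFun D) := by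
  refine LipschitzWith.of_le_add fun h h' => ?_
  refine csSup_le (hne.image _) ?_
  rintro _ ⟨z, hz, rfl⟩
  have hz1 : ‖z‖ ≤ 1 := by simpa using hD hz
  have h1 : inner ℝ (h - h') z ≤ ‖h - h'‖ :=
    (real_inner_le_norm _ z).trans (mul_le_of_le_one_right (norm_nonneg _) hz1)
  rw [inner_sub_left] at h1
  have h2 := inner_le_supFun hD h' hz
  rw [dist_eq_norm]
  simp only
  linarith

theorem minmax_le_iff {I J : Type*} [Fintype I] [Fintype J] [Nonempty I] [Nonempty J]
    {z : I × J → ℝ} {c : ℝ} : minmax z ≤ c ↔ ∃ i, ∀ j, z (i, j) ≤ c := by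
  rw [← not_lt, lt_minmax_iff]
  push Not
  rfl

theorem continuous_toEuclideanLin (A : Matrix (Fin m) (Fin n) ℝ) :
    Continuous fun v : E n => A.toEuclideanLin v :=
  LinearMap.continuous_of_finiteDimensional _

/-- A finite `ε`-net of the sphere recovers the norm up to the factor `1 - ε`, since Gordon's
comparison is available for finite index sets only. -/
theorem exists_inner_ge_of_pos (hm : 0 < m) {ε : ℝ} (hε : 0 < ε) :
    ∃ U : Finset (E m), U.Nonempty ∧ (∀ u ∈ U, ‖u‖ = 1) ∧
      ∀ g : E m, ∃ u ∈ U, (1 - ε) * ‖g‖ ≤ inner ℝ u g := by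
  have : Nontrivial (E m) := by
    refine Module.nontrivial_of_finrank_pos (R := ℝ) ?_
    rw [finrank_euclideanSpace_fin]
    exact hm
  obtain ⟨t, htS, htf, hcov⟩ :=
    (isCompact_sphere (0 : E m) 1).finite_cover_balls (e := ε) hε
  have hmem : ∀ g : E m, ‖g‖ = 1 → ∃ u ∈ t, ‖g - u‖ < ε := by
    intro g hg
    have := hcov (show g ∈ Metric.sphere 0 1 by simpa using hg)
    simp only [mem_iUnion, Metric.mem_ball, dist_eq_norm, exists_prop] at this
    exact this
  have hunit : ∀ u ∈ t, ‖u‖ = 1 := fun u hu => by simpa using htS hu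
  obtain ⟨g0, hg0⟩ := exists_norm_eq (E m) zero_le_one
  obtain ⟨u0, hu0, -⟩ := hmem g0 hg0
  refine ⟨htf.toFinset, ⟨u0, by simpa using hu0⟩, fun u hu => hunit u (by simpa using hu),
    fun g => ?_⟩
  by_cases hg : g = 0
  · exact ⟨u0, by simpa using hu0, by simp [hg]⟩
  · have hgn : 0 < ‖g‖ := norm_pos_iff.2 hg
    obtain ⟨u, hu, hlt⟩ := hmem (‖g‖⁻¹ • g) (by
      rw [norm_smul, norm_inv, norm_norm, inv_mul_cancel₀ hgn.ne'])
    refine ⟨u, by simpa using hu, ?_⟩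
    have h1 : inner ℝ (‖g‖⁻¹ • g - u) g ≤ ε * ‖g‖ :=
      (real_inner_le_norm _ _).trans (by gcongr)
    rw [inner_sub_left, real_inner_smul_left, real_inner_self_eq_norm_sq] at h1
    have : ‖g‖⁻¹ * ‖g‖ ^ 2 = ‖g‖ := by field_simp
    linarith

/-- Gordon's escape through a mesh theorem. -/
theorem measure_exists_norm_lt_le {D T : Set (E n)} (hD : D ⊆ Metric.closedBall 0 1)
    (hTD : T ⊆ D) (hT : T.Nonempty) (hT1 : ∀ v ∈ T, ‖v‖ = 1) (hm : 0 < m) {t : ℝ} (ht : 0 ≤ t) :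
    gaussPi (Fin m × Fin n) {x | ∃ v ∈ T, ‖(matOf x).toEuclideanLin v‖ <
      phi m - gaussianWidth D - t} ≤ ENNReal.ofReal (Real.exp (-t ^ 2 / 2)) := by
  have : Nonempty T := hT.to_subtype
  obtain ⟨v, hv⟩ := TopologicalSpace.exists_dense_seq T
  have hphi := phi_nonneg (t := m) (by positivity)
  -- Row indices run through the first `N + 1` points of a dense sequence in `T`, and the net has
  -- mesh `1/(N+1)`. The sets increase with `N`, so a bound uniform in `N` passes to their union.
  let S : ℕ → Set (Fin m × Fin n → ℝ) := fun N => {x | ∃ i ≤ N,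
    ‖(matOf x).toEuclideanLin (v i : E n)‖ < (1 - 1 / ((N : ℝ) + 1)) * phi m - gaussianWidth D - t}
  have hsub : {x | ∃ v ∈ T, ‖(matOf x).toEuclideanLin v‖ < phi m - gaussianWidth D - t} ⊆
      ⋃ N, S N := by
    rintro x ⟨w, hwT, hw⟩
    have hopen : IsOpen {y : T | ‖(matOf x).toEuclideanLin (y : E n)‖ <
        phi m - gaussianWidth D - t} :=
      isOpen_lt ((continuous_toEuclideanLin (matOf x)).comp continuous_subtype_val).norm
        continuous_const
    obtain ⟨i, hi⟩ := hv.exists_mem_open hopen ⟨⟨w, hwT⟩, hw⟩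
    have hi : ‖(matOf x).toEuclideanLin (v i : E n)‖ < phi m - gaussianWidth D - t := hi
    have hlim : Tendsto (fun N : ℕ => (1 - 1 / ((N : ℝ) + 1)) * phi m - gaussianWidth D - t) atTop
        (𝓝 ((1 - 0) * phi m - gaussianWidth D - t)) :=
      (((tendsto_one_div_add_atTop_nhds_zero_nat.const_sub 1).mul_const _).sub_const _).sub_const _
    rw [sub_zero, one_mul] at hlim
    obtain ⟨N, hN, hiN⟩ := ((hlim.eventually (lt_mem_nhds hi)).and (eventually_ge_atTop i)).exists
    exact mem_iUnion.2 ⟨N, i, hiN, hN⟩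
  have hmono : Monotone S := by
    rintro M N hMN x ⟨i, hi, hx⟩
    refine ⟨i, hi.trans hMN, hx.trans_le ?_⟩
    have : 1 / ((N : ℝ) + 1) ≤ 1 / ((M : ℝ) + 1) := by gcongr
    gcongr
  refine (measure_mono hsub).trans ?_
  rw [hmono.measure_iUnion]
  refine iSup_le fun N => ?_
  obtain ⟨U, hUne, hU1, hU⟩ := exists_inner_ge_of_pos hm (ε := 1 / ((N : ℝ) + 1)) (by positivity)
  have : Nonempty U := hUne.to_subtype
  set ε : ℝ := 1 / ((N : ℝ) + 1) with hε
  have hε0 : 0 < ε := by positivity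
  have hε1 : ε ≤ 1 := by
    rw [hε, div_le_one (by positivity)]
    have : (0 : ℝ) ≤ N := by positivity
    linarith
  -- The maximum over the net of `⟨u, g⟩` is at least `(1 - ε)‖g‖`, of mean `(1 - ε) φ(m)`, and
  -- `-⟨v, h⟩` is at least minus the support function of `D`, of mean `-gaussianWidth D`.
  have ha : LipschitzWith 1 fun g : E m => (1 - ε) * ‖g‖ := by
    refine LipschitzWith.of_dist_le_mul fun g h => ?_
    rw [Real.dist_eq, ← mul_sub, abs_mul, abs_of_nonneg (by linarith), NNReal.coe_one, one_mul,
      dist_eq_norm]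
    have h1 := abs_norm_sub_norm_le g h
    have h2 := abs_nonneg (‖g‖ - ‖h‖)
    nlinarith
  have hb : LipschitzWith 1 fun h : E n => -supFun D h :=
    (lipschitzWith_supFun hD (hT.mono hTD)).neg
  have h := measure_minmax_matOf_le (I := Fin (N + 1)) (J := U) (fun i => (v i : E n))
    (fun k => (k.2 : E m)) (fun i => hT1 _ (v i).2) (fun k => hU1 _ k.2.2) ha hb ?_ ht
  · refine (measure_mono ?_).trans h
    rintro x ⟨i, hi, hx⟩
    simp only [mem_ofPred_eq]
    rw [integral_const_mul, integral_norm_stdGaussian hm, integral_neg, ← gaussianWidth_eq,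
      ← sub_eq_add_neg, minmax_le_iff]
    refine ⟨⟨i, by omega⟩, fun u => ?_⟩
    refine ((real_inner_le_norm _ _).trans ?_).trans hx.le
    rw [hU1 _ u.2, one_mul]
  · intro g h
    rw [le_minmax_iff]
    intro i
    obtain ⟨u, hu, hug⟩ := hU g
    refine ⟨⟨u, hu⟩, ?_⟩
    have := inner_le_supFun hD h (hTD (v i).2)
    rw [real_inner_comm] at this
    simp only
    linarith

/-- A Slepian type upper bound for the supremum of a Gaussian bilinear form. -/
theorem measure_exists_lt_inner_le {T₁ : Set (E m)} {T₂ : Set (E n)} (hne₁ : T₁.Nonempty)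
    (hne₂ : T₂.Nonempty) (h₁ : ∀ u ∈ T₁, ‖u‖ = 1) (h₂ : ∀ v ∈ T₂, ‖v‖ = 1)
    {a : E m → ℝ} {b : E n → ℝ} (ha : LipschitzWith 1 a) (hb : LipschitzWith 1 b)
    (hua : ∀ g, ∀ u ∈ T₁, inner ℝ u g ≤ a g) (hvb : ∀ h, ∀ v ∈ T₂, inner ℝ v h ≤ b h)
    {t : ℝ} (ht : 0 ≤ t) :
    gaussPi (Fin m × Fin n) {x | ∃ u ∈ T₁, ∃ v ∈ T₂,
      ∫ g, a g ∂(stdGaussian (E m)) + ∫ h, b h ∂(stdGaussian (E n)) + t <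
        inner ℝ u ((matOf x).toEuclideanLin v)} ≤ ENNReal.ofReal (Real.exp (-t ^ 2 / 2)) := by
  have : Nonempty T₁ := hne₁.to_subtype
  have : Nonempty T₂ := hne₂.to_subtype
  obtain ⟨w, hw⟩ := TopologicalSpace.exists_dense_seq (T₁ × T₂)
  set c := ∫ g, a g ∂(stdGaussian (E m)) + ∫ h, b h ∂(stdGaussian (E n)) + t with hc
  let S : ℕ → Set (Fin m × Fin n → ℝ) := fun N => {x | ∃ i ≤ N,
    c < inner ℝ ((w i).1 : E m) ((matOf x).toEuclideanLin ((w i).2 : E n))}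
  have hsub : {x | ∃ u ∈ T₁, ∃ v ∈ T₂, c < inner ℝ u ((matOf x).toEuclideanLin v)} ⊆
      ⋃ N, S N := by
    rintro x ⟨u, hu, v, hv, hx⟩
    have hopen : IsOpen {y : T₁ × T₂ | c < inner ℝ (y.1 : E m)
        ((matOf x).toEuclideanLin (y.2 : E n))} := by
      refine isOpen_lt continuous_const ?_
      exact (continuous_subtype_val.comp continuous_fst).inner
        ((continuous_toEuclideanLin (matOf x)).comp (continuous_subtype_val.comp continuous_snd))
    obtain ⟨i, hi⟩ := hw.exists_mem_open hopen ⟨(⟨u, hu⟩, ⟨v, hv⟩), hx⟩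
    exact mem_iUnion.2 ⟨i, i, le_rfl, hi⟩
  have hmono : Monotone S := by
    rintro M N hMN x ⟨i, hi, hx⟩
    exact ⟨i, hi.trans hMN, hx⟩
  refine (measure_mono hsub).trans ?_
  rw [hmono.measure_iUnion]
  refine iSup_le fun N => ?_
  -- Each pair `(u, v)` is a row with one column, so the min-max is a plain minimum; the sign change
  -- `u ↦ -u` turns it into a supremum.
  have h := measure_minmax_matOf_le (I := Fin (N + 1)) (J := Unit) (fun i => ((w i).2 : E n))
    (fun k => -((w k.1).1 : E m)) (fun i => h₂ _ (w i).2.2)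
    (fun k => by rw [norm_neg]; exact h₁ _ (w k.1).1.2) ha.neg hb.neg ?_ ht
  · refine (measure_mono ?_).trans h
    rintro x ⟨i, hi, hx⟩
    simp only [mem_ofPred_eq, Pi.neg_apply]
    rw [integral_neg, integral_neg, minmax_le_iff]
    refine ⟨⟨i, by omega⟩, fun _ => ?_⟩
    rw [inner_neg_left]
    linarith
  · intro g h
    rw [le_minmax_iff]
    intro i
    refine ⟨(), ?_⟩
    have e1 := hua g _ (w i).1.2
    have e2 := hvb h _ (w i).2.2
    simp only [Pi.neg_apply, inner_neg_left]
    linarith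

theorem integral_inner_stdGaussian (v : E n) :
    ∫ g, inner ℝ v g ∂(stdGaussian (E n)) = 0 :=
  integral_strongDual_stdGaussian (innerSL ℝ v)

theorem lipschitzWith_inner {v : E n} (hv : ‖v‖ ≤ 1) : LipschitzWith 1 fun g : E n => inner ℝ v g := by
  refine LipschitzWith.of_dist_le_mul fun g h => ?_
  rw [Real.dist_eq, ← inner_sub_right, NNReal.coe_one, one_mul, dist_eq_norm]
  exact (abs_real_inner_le_norm _ _).trans (mul_le_of_le_one_left (norm_nonneg _) hv)

/-- The escape bound for a single point, whose Gaussian width is `0`. -/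
theorem measure_norm_lt_le {v : E n} (hv : ‖v‖ = 1) (hm : 0 < m) {t : ℝ} (ht : 0 ≤ t) :
    gaussPi (Fin m × Fin n) {x | ‖(matOf x).toEuclideanLin v‖ < phi m - t} ≤
      ENNReal.ofReal (Real.exp (-t ^ 2 / 2)) := by
  have hw : gaussianWidth ({v} : Set (E n)) = 0 := by
    rw [← integral_inner_stdGaussian v]
    simp only [gaussianWidth, image_singleton, csSup_singleton]
    exact integral_congr_ae (ae_of_all _ fun g => real_inner_comm _ _)
  have h := measure_exists_norm_lt_le (D := {v}) (T := {v}) (m := m)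
    (by simp [hv]) subset_rfl (singleton_nonempty v)
    (by simpa using hv) hm ht
  simpa [hw] using h

theorem measure_exists_lt_inner_vec_le {D T : Set (E n)} (hD : D ⊆ Metric.closedBall 0 1)
    (hTD : T ⊆ D) (hT : T.Nonempty) (hT1 : ∀ v ∈ T, ‖v‖ = 1) {w : E m} (hw : ‖w‖ = 1)
    {t : ℝ} (ht : 0 ≤ t) :
    gaussPi (Fin m × Fin n) {x | ∃ v ∈ T,
      gaussianWidth D + t < inner ℝ w ((matOf x).toEuclideanLin v)} ≤
        ENNReal.ofReal (Real.exp (-t ^ 2 / 2)) := by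
  have h := measure_exists_lt_inner_le (T₁ := {w}) (singleton_nonempty w) hT (by simpa using hw) hT1
    (lipschitzWith_inner hw.le) (lipschitzWith_supFun hD (hT.mono hTD))
    (by simp)
    (fun h v hv => by rw [real_inner_comm]; exact inner_le_supFun hD h (hTD hv)) ht
  simpa [integral_inner_stdGaussian, ← gaussianWidth_eq] using h

/-- The operator norm is the supremum of `⟨u, Av⟩` over two unit spheres, whose support functions
are the norms, of mean `φ(m)` and `φ(n)`. -/
theorem measure_opNorm_le (hm : 0 < m) (hn : 0 < n) {t : ℝ} (ht : 0 ≤ t) :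
    gaussPi (Fin m × Fin n) {x | ∃ v : E n,
      (phi m + phi n + t) * ‖v‖ < ‖(matOf x).toEuclideanLin v‖} ≤
        ENNReal.ofReal (Real.exp (-t ^ 2 / 2)) := by
  have hnt : ∀ {k : ℕ}, 0 < k → (Metric.sphere (0 : E k) 1).Nonempty := by
    intro k hk
    have : Nontrivial (E k) := by
      refine Module.nontrivial_of_finrank_pos (R := ℝ) ?_
      rw [finrank_euclideanSpace_fin]
      exact hk
    exact NormedSpace.sphere_nonempty.2 zero_le_one
  have hle : ∀ {k : ℕ} (g : E k), ∀ u ∈ Metric.sphere (0 : E k) 1, inner ℝ u g ≤ ‖g‖ := by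
    intro k g u hu
    have hu : ‖u‖ = 1 := by simpa using hu
    simpa [hu] using real_inner_le_norm u g
  have h := measure_exists_lt_inner_le (hnt hm) (hnt hn) (by simp) (by simp)
    lipschitzWith_one_norm lipschitzWith_one_norm hle hle ht
  rw [integral_norm_stdGaussian hm, integral_norm_stdGaussian hn] at h
  refine (measure_mono ?_).trans h
  rintro x ⟨v, hv⟩
  have hv0 : v ≠ 0 := by
    rintro rfl
    simp at hv
  have hA0 : 0 < ‖(matOf x).toEuclideanLin v‖ := by
    refine lt_of_le_of_lt ?_ hv
    have := phi_nonneg (t := m) (by positivity)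
    have := phi_nonneg (t := n) (by positivity)
    positivity
  have hvn : 0 < ‖v‖ := norm_pos_iff.2 hv0
  refine ⟨‖(matOf x).toEuclideanLin v‖⁻¹ • (matOf x).toEuclideanLin v, ?_, ‖v‖⁻¹ • v, ?_, ?_⟩
  · simp [norm_smul, hA0.ne']
  · simp [norm_smul, hvn.ne']
  · rw [map_smul, real_inner_smul_left, real_inner_smul_right, real_inner_self_eq_norm_sq]
    have : ‖(matOf x).toEuclideanLin v‖⁻¹ * (‖v‖⁻¹ * ‖(matOf x).toEuclideanLin v‖ ^ 2) =
        ‖(matOf x).toEuclideanLin v‖ / ‖v‖ := by field_simp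
    rw [this, lt_div_iff₀ hvn]
    exact hv

theorem gaussianWidth_nonneg {D : Set (E n)} (hD : D ⊆ Metric.closedBall 0 1) (h0 : 0 ∈ D) :
    0 ≤ gaussianWidth D := by
  refine integral_nonneg fun g => ?_
  have := inner_le_supFun hD g h0
  rw [inner_zero_right] at this
  exact this

theorem integral_abs_gaussianReal : ∫ t, |t| ∂(gaussianReal 0 1) = phi 1 := by
  have h := integral_norm_stdGaussian (m := 1) one_pos
  rw [← integral_comp_toE continuous_norm] at h
  have e : ∀ x : Fin 1 → ℝ, ‖toE (Fin 1) x‖ = |x 0| := fun x => by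
    rw [EuclideanSpace.norm_eq]
    simp [Real.sqrt_sq_eq_abs]
  simp_rw [e] at h
  have hmp := measurePreserving_eval (fun _ : Fin 1 => gaussianReal 0 1) 0
  rw [← hmp.map_eq, integral_map hmp.measurable.aemeasurable continuous_abs.aestronglyMeasurable]
  rw [Nat.cast_one] at h
  exact h

/-- The supremum dominates the positive part of `⟨v, g⟩`, a standard normal variable with `𝔼|⟨v, g⟩|
= φ(1)`. -/
theorem phi_one_div_two_le_gaussianWidth {D : Set (E n)} (hD : D ⊆ Metric.closedBall 0 1) (h0 : 0 ∈ D)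
    {v : E n} (hv : v ∈ D) (hv1 : ‖v‖ = 1) : phi 1 / 2 ≤ gaussianWidth D := by
  have hlaw : (stdGaussian (E n)).map (innerSL ℝ v) = gaussianReal 0 1 := by
    rw [IsGaussian.map_eq_gaussianReal, integral_strongDual_stdGaussian, variance_dual_stdGaussian,
      innerSL_apply_norm, hv1]
    simp
  have h1 : ∫ g, |inner ℝ v g| ∂(stdGaussian (E n)) = phi 1 := by
    rw [← integral_abs_gaussianReal, ← hlaw,
      integral_map (innerSL ℝ v).continuous.aemeasurable (by fun_prop)]
    rfl
  have hi : Integrable (fun g => inner ℝ v g) (stdGaussian (E n)) :=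
    integrable_of_lipschitz (lipschitzWith_inner hv1.le)
  have h2 : ∫ g, (inner ℝ v g + |inner ℝ v g|) / 2 ∂(stdGaussian (E n)) = phi 1 / 2 := by
    rw [integral_div, integral_add hi hi.abs, integral_inner_stdGaussian, h1, zero_add]
  rw [← h2, gaussianWidth_eq]
  refine integral_mono ((hi.add hi.abs).div_const 2)
    (integrable_of_lipschitz (lipschitzWith_supFun hD ⟨0, h0⟩)) fun g => ?_
  have e1 := inner_le_supFun hD g hv
  have e2 := inner_le_supFun hD g h0
  rw [inner_zero_right] at e2
  rw [real_inner_comm] at e1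
  simp only
  rcases abs_cases (inner ℝ v g) with h | h <;> linarith

end

/-! ### Projected gradient descent for a fixed matrix -/

section Deterministic

variable {m n : ℕ}

/-- The projection onto a nonempty closed convex set lies in the set and satisfies the
obtuse-angle criterion. -/
theorem proj_spec {K : Set (E n)} (hK : IsClosed K) (hc : Convex ℝ K) (hne : K.Nonempty)
    (v : E n) : proj K v ∈ K ∧ ∀ q ∈ K, inner ℝ (v - proj K v) (q - proj K v) ≤ 0 := by
  have hex : ∃ p : E n, p ∈ K ∧ ∀ q ∈ K, ‖v - p‖ ≤ ‖v - q‖ := by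
    obtain ⟨p, hp, h⟩ := hK.exists_infDist_eq_dist hne v
    refine ⟨p, hp, fun q hq => ?_⟩
    rw [← dist_eq_norm, ← dist_eq_norm, ← h]
    exact Metric.infDist_le_dist_of_mem hq
  obtain ⟨hp, hmin⟩ := Classical.epsilon_spec hex
  change proj K v ∈ K at hp
  change ∀ q ∈ K, ‖v - proj K v‖ ≤ ‖v - q‖ at hmin
  refine ⟨hp, (norm_eq_iInf_iff_real_inner_le_zero hc hp).1 ?_⟩
  have : Nonempty K := hne.to_subtype
  refine le_antisymm (le_ciInf fun q => hmin q q.2) ?_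
  exact ciInf_le ⟨0, by rintro _ ⟨q, rfl⟩; exact norm_nonneg _⟩ (⟨proj K v, hp⟩ : K)

theorem inner_transpose_toEuclideanLin (A : Matrix (Fin m) (Fin n) ℝ) (u : E n) (y : E m) :
    inner ℝ u (A.transpose.toEuclideanLin y) = inner ℝ (A.toEuclideanLin u) y := by
  have h := Matrix.toEuclideanLin_conjTranspose_eq_adjoint A
  rw [Matrix.conjTranspose_eq_transpose_of_trivial] at h
  rw [h, LinearMap.adjoint_inner_right]

/-- Cauchy–Schwarz for the positive semidefinite form `⟨u, v⟩ - μ ⟨Au, Av⟩`. -/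
theorem inner_sub_mul_inner_le {L : E n →ₗ[ℝ] E m} {μ ρ : ℝ}
    (hpos : ∀ v, μ * ‖L v‖ ^ 2 ≤ ‖v‖ ^ 2) {u v : E n}
    (hu : ‖u‖ ^ 2 - μ * ‖L u‖ ^ 2 ≤ ρ * ‖u‖ ^ 2) (hv : ‖v‖ ^ 2 - μ * ‖L v‖ ^ 2 ≤ ρ * ‖v‖ ^ 2) :
    inner ℝ u v - μ * inner ℝ (L u) (L v) ≤ ρ * (‖u‖ * ‖v‖) := by
  have key : ∀ a b : ℝ, 2 * (a * b) * (inner ℝ u v - μ * inner ℝ (L u) (L v)) ≤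
      a ^ 2 * (‖u‖ ^ 2 - μ * ‖L u‖ ^ 2) + b ^ 2 * (‖v‖ ^ 2 - μ * ‖L v‖ ^ 2) := by
    intro a b
    have h := hpos (a • u - b • v)
    rw [map_sub, map_smul, map_smul, norm_sub_sq_real, norm_sub_sq_real] at h
    simp only [norm_smul, inner_smul_left, inner_smul_right, mul_pow, Real.norm_eq_abs, sq_abs,
      conj_trivial] at h
    linarith
  rcases eq_or_ne u 0 with rfl | hu0
  · simp
  rcases eq_or_ne v 0 with rfl | hv0
  · simp
  have hun := norm_pos_iff.2 hu0
  have hvn := norm_pos_iff.2 hv0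
  -- This choice of weights equalises the two terms, so no minimisation over `a` and `b` is needed.
  have h1 := key ‖v‖ ‖u‖
  have h2 := mul_le_mul_of_nonneg_left hu (sq_nonneg ‖v‖)
  have h3 := mul_le_mul_of_nonneg_left hv (sq_nonneg ‖u‖)
  have h4 : 0 < 2 * (‖v‖ * ‖u‖) := by positivity
  refine le_of_mul_le_mul_left ?_ h4
  linarith

theorem pgd_succ_sub_mem {f : E n → ℝ} {x : E n} {C : Set (E n)} (hf : IsProper f)
    (hc : ConvexOn ℝ univ f) (hC : IsDescentCone f x C) (A : Matrix (Fin m) (Fin n) ℝ) (y : E m)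
    (μ : ℝ) (τ : ℕ) : pgd {z | f z ≤ f x} μ A y (τ + 1) - x ∈ C := by
  have hcv : Convex ℝ {z | f z ≤ f x} := by simpa using hc.convex_le (f x)
  refine hC.descentSet_subset ?_
  change f (x + (pgd {z | f z ≤ f x} μ A y (τ + 1) - x)) ≤ f x
  rw [add_sub_cancel]
  exact (proj_spec (hf _) hcv ⟨x, le_refl (f x)⟩ _).1

/-- Every error after the first step lies in `C`, so the form `I - μ A*A` is at most `1 - μ s²`
there. The noise floor `t‖w‖/s²` is the fixed point of the recursion `r ↦ (1 - μ s²) r + μ t‖w‖`. -/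
theorem norm_pgd_sub_le {f : E n → ℝ} {x : E n} {C : Set (E n)} (hf : IsProper f)
    (hc : ConvexOn ℝ univ f) (hC : IsDescentCone f x C) {A : Matrix (Fin m) (Fin n) ℝ} {w : E m}
    {μ s t : ℝ} (hμ : 0 ≤ μ) (ht : 0 ≤ t) (hs : 0 < s) (hs1 : μ * s ^ 2 ≤ 1)
    (hlow : ∀ u ∈ C, s ^ 2 * ‖u‖ ^ 2 ≤ ‖A.toEuclideanLin u‖ ^ 2)
    (hx : s ^ 2 * ‖x‖ ^ 2 ≤ ‖A.toEuclideanLin x‖ ^ 2)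
    (hw : ∀ u ∈ C, inner ℝ w (A.toEuclideanLin u) ≤ t * ‖w‖ * ‖u‖)
    (hpos : ∀ v, μ * ‖A.toEuclideanLin v‖ ^ 2 ≤ ‖v‖ ^ 2) (τ : ℕ) :
    ‖pgd {z | f z ≤ f x} μ A (A.toEuclideanLin x + w) τ - x‖ ≤
      (1 - μ * s ^ 2) ^ τ * ‖x‖ + t * ‖w‖ / s ^ 2 := by
  set K := {z | f z ≤ f x} with hK
  set z := pgd K μ A (A.toEuclideanLin x + w) with hz
  have hcl : IsClosed K := hf _
  have hcv : Convex ℝ K := by simpa using hc.convex_le (f x)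
  have hxK : x ∈ K := le_refl (f x)
  have hsucc : ∀ τ, z (τ + 1) = proj K (z τ + μ • A.transpose.toEuclideanLin
      (A.toEuclideanLin x + w - A.toEuclideanLin (z τ))) := fun τ => rfl
  have hmemC : ∀ τ, z (τ + 1) - x ∈ C := pgd_succ_sub_mem hf hc hC A _ μ
  have hlow' : ∀ τ, s ^ 2 * ‖z τ - x‖ ^ 2 ≤ ‖A.toEuclideanLin (z τ - x)‖ ^ 2 := by
    intro τ
    cases τ with
    -- The initial error is `-x`, which need not lie in `C`; this is why `x` has its own lower
    -- bound.
    | zero =>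
      have : z 0 = 0 := rfl
      rw [this, zero_sub, map_neg, norm_neg, norm_neg]; exact hx
    | succ τ => exact hlow _ (hmemC τ)
  have hρ : 0 ≤ 1 - μ * s ^ 2 := by linarith
  have hform : ∀ τ, ‖z τ - x‖ ^ 2 - μ * ‖A.toEuclideanLin (z τ - x)‖ ^ 2 ≤
      (1 - μ * s ^ 2) * ‖z τ - x‖ ^ 2 := fun τ => by
    have := mul_le_mul_of_nonneg_left (hlow' τ) hμ
    linarith
  have step : ∀ τ, ‖z (τ + 1) - x‖ ≤ (1 - μ * s ^ 2) * ‖z τ - x‖ + μ * (t * ‖w‖) := by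
    intro τ
    set v := z τ + μ • A.transpose.toEuclideanLin
      (A.toEuclideanLin x + w - A.toEuclideanLin (z τ)) with hv
    have hang := (proj_spec hcl hcv ⟨x, hxK⟩ v).2 x hxK
    rw [← hsucc τ] at hang
    have h1 : ‖z (τ + 1) - x‖ ^ 2 ≤ inner ℝ (z (τ + 1) - x) (v - x) := by
      have e : v - z (τ + 1) = (v - x) - (z (τ + 1) - x) := by abel
      have e2 : x - z (τ + 1) = -(z (τ + 1) - x) := by abel
      rw [e, e2, inner_neg_right, inner_sub_left, real_inner_self_eq_norm_sq,
        real_inner_comm] at hang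
      linarith
    have h2 : inner ℝ (z (τ + 1) - x) (v - x) =
        (inner ℝ (z (τ + 1) - x) (z τ - x) -
          μ * inner ℝ (A.toEuclideanLin (z (τ + 1) - x)) (A.toEuclideanLin (z τ - x))) +
        μ * inner ℝ w (A.toEuclideanLin (z (τ + 1) - x)) := by
      have e : v - x = (z τ - x) + μ • A.transpose.toEuclideanLin
          (w - A.toEuclideanLin (z τ - x)) := by
        rw [hv, map_sub A.toEuclideanLin (z τ) x,
          show A.toEuclideanLin x + w - A.toEuclideanLin (z τ) =
            w - (A.toEuclideanLin (z τ) - A.toEuclideanLin x) by abel]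
        abel
      rw [e, inner_add_right, inner_smul_right, inner_transpose_toEuclideanLin,
        inner_sub_right (A.toEuclideanLin (z (τ + 1) - x)), real_inner_comm _ w]
      ring
    have h3 := inner_sub_mul_inner_le hpos (hform (τ + 1)) (hform τ)
    have h4 := mul_le_mul_of_nonneg_left (hw _ (hmemC τ)) hμ
    have h5 : ‖z (τ + 1) - x‖ * ‖z (τ + 1) - x‖ ≤ ‖z (τ + 1) - x‖ *
        ((1 - μ * s ^ 2) * ‖z τ - x‖ + μ * (t * ‖w‖)) := by
      rw [h2] at h1
      nlinarith
    rcases (norm_nonneg (z (τ + 1) - x)).eq_or_lt with h0 | h0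
    · rw [← h0]; positivity
    · exact le_of_mul_le_mul_left h5 h0
  induction τ with
  | zero =>
    have : z 0 = 0 := rfl
    simp only [this, zero_sub, norm_neg, pow_zero, one_mul, le_add_iff_nonneg_right]
    positivity
  | succ τ ih =>
    have h1 := mul_le_mul_of_nonneg_left ih hρ
    have h2 : μ * s ^ 2 * (t * ‖w‖ / s ^ 2) = μ * (t * ‖w‖) := by field_simp
    rw [pow_succ]
    linarith [step τ]

end Deterministic

/-! ### Recovery guarantees -/

section Recovery

variable {m n : ℕ}

theorem measure_norm_lt_mul_norm_le (x : E n) (hm : 0 < m) {t : ℝ} (ht : 0 ≤ t) :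
    gaussPi (Fin m × Fin n) {a | ‖(matOf a).toEuclideanLin x‖ < (phi m - t) * ‖x‖} ≤
      ENNReal.ofReal (Real.exp (-t ^ 2 / 2)) := by
  rcases eq_or_ne x 0 with rfl | hx
  · simp
  have hxn := norm_pos_iff.2 hx
  refine (measure_mono fun a ha => ?_).trans
    (measure_norm_lt_le (v := ‖x‖⁻¹ • x) (by simp [norm_smul, hxn.ne']) hm ht)
  change ‖(matOf a).toEuclideanLin x‖ < _ at ha
  change ‖(matOf a).toEuclideanLin (‖x‖⁻¹ • x)‖ < _
  rw [map_smul, norm_smul, norm_inv, norm_norm, inv_mul_lt_iff₀ hxn, mul_comm]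
  exact ha

theorem measure_exists_mul_norm_lt_inner_le {D T : Set (E n)} (hD : D ⊆ Metric.closedBall 0 1)
    (hTD : T ⊆ D) (hT : T.Nonempty) (hT1 : ∀ v ∈ T, ‖v‖ = 1) (w : E m) {t : ℝ} (ht : 0 ≤ t) :
    gaussPi (Fin m × Fin n) {a | ∃ v ∈ T,
      (gaussianWidth D + t) * ‖w‖ < inner ℝ w ((matOf a).toEuclideanLin v)} ≤
        ENNReal.ofReal (Real.exp (-t ^ 2 / 2)) := by
  rcases eq_or_ne w 0 with rfl | hw
  · simp
  have hwn := norm_pos_iff.2 hw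
  refine (measure_mono ?_).trans
    (measure_exists_lt_inner_vec_le hD hTD hT hT1 (w := ‖w‖⁻¹ • w)
      (by simp [norm_smul, hwn.ne']) ht)
  rintro a ⟨v, hv, ha⟩
  refine ⟨v, hv, ?_⟩
  rw [real_inner_smul_left, lt_inv_mul_iff₀ hwn, mul_comm]
  exact ha

/-- A Gaussian map has the law of the standard Gaussian matrix. -/
theorem IsGaussianMap.map_eq {Ω : Type*} [MeasurableSpace Ω] {P : Measure Ω}
    [IsProbabilityMeasure P] {A : Ω → Matrix (Fin m) (Fin n) ℝ} (hA : IsGaussianMap P A) :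
    P.map (fun s (p : Fin m × Fin n) => A s p.1 p.2) = gaussPi (Fin m × Fin n) := by
  rw [(iIndepFun_iff_map_fun_eq_pi_map fun p : Fin m × Fin n =>
    (hA.hasLaw p.1 p.2).aemeasurable).1 hA.indep]
  unfold gaussPi
  congr 1
  funext p
  exact (hA.hasLaw p.1 p.2).map_eq

theorem IsGaussianMap.aemeasurable {Ω : Type*} [MeasurableSpace Ω] {P : Measure Ω}
    {A : Ω → Matrix (Fin m) (Fin n) ℝ} (hA : IsGaussianMap P A) :
    AEMeasurable (fun s (p : Fin m × Fin n) => A s p.1 p.2) P :=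
  aemeasurable_pi_lambda _ fun p => (hA.hasLaw p.1 p.2).aemeasurable

/-- An inequality suffices for failure events, and it holds without measurability of the event. -/
theorem IsGaussianMap.measure_le {Ω : Type*} [MeasurableSpace Ω] {P : Measure Ω}
    [IsProbabilityMeasure P] {A : Ω → Matrix (Fin m) (Fin n) ℝ} (hA : IsGaussianMap P A)
    (p : Matrix (Fin m) (Fin n) ℝ → Prop) :
    P {s | p (A s)} ≤ gaussPi (Fin m × Fin n) {a | p (matOf a)} := by
  rw [← hA.map_eq]
  exact Measure.le_map_apply hA.aemeasurable {a | p (matOf a)}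

theorem step_size_bounds {a b c s : ℝ} (ha : 0 ≤ a) (hab : a < b) (hc : 0 ≤ c)
    (hs : √(2 / Real.pi) * (b - a) ≤ s) (hsb : s ≤ b) :
    0.3 / (b ^ 2 + c ^ 2) * (b - a) ^ 2 ≤ 0.99 / (b + c) ^ 2 * s ^ 2 ∧
      0.99 / (b + c) ^ 2 * s ^ 2 ≤ 1 := by
  have hb : 0 < b := ha.trans_lt hab
  have hba : 0 < b - a := sub_pos.2 hab
  have hs0 : 0 ≤ s := le_trans (by positivity) hs
  have hsq : 2 / Real.pi * (b - a) ^ 2 ≤ s ^ 2 := by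
    calc 2 / Real.pi * (b - a) ^ 2 = (√(2 / Real.pi) * (b - a)) ^ 2 := by
          rw [mul_pow, Real.sq_sqrt (by positivity)]
      _ ≤ s ^ 2 := by gcongr
  have hpi : (0.63 : ℝ) ≤ 2 / Real.pi := by
    rw [le_div_iff₀ Real.pi_pos]; linarith [Real.pi_lt_d2]
  constructor
  -- `(b + c)² ≤ 2 (b² + c²)` gives `0.99 / 2 = 0.495`, and `2/π ≥ 0.63`; the product `0.495 · 0.63`
  -- exceeds `0.3`.
  · calc 0.3 / (b ^ 2 + c ^ 2) * (b - a) ^ 2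
        ≤ 0.495 / (b ^ 2 + c ^ 2) * (0.63 * (b - a) ^ 2) := by
          rw [div_mul_eq_mul_div, div_mul_eq_mul_div]
          gcongr ?_ / _
          nlinarith [sq_nonneg (b - a)]
      _ ≤ 0.99 / (b + c) ^ 2 * s ^ 2 := by
          gcongr ?_ * ?_
          · rw [div_le_div_iff₀ (by positivity) (by positivity)]
            nlinarith [sq_nonneg (b - c)]
          · exact le_trans (by gcongr) hsq
  · rw [div_mul_eq_mul_div, div_le_one (by positivity)]
    have : s ^ 2 ≤ (b + c) ^ 2 := by gcongr; linarith
    nlinarith [sq_nonneg s]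

theorem noise_constant_le {a b s t : ℝ} (ha : 0 ≤ a) (hab : a < b)
    (hs : √(2 / Real.pi) * (b - a) ≤ s) (hta : t ≤ a) :
    2 * t / s ^ 2 ≤ 3.5 / (1 - a / b) ^ 2 * (a / b ^ 2) := by
  have hb : 0 < b := ha.trans_lt hab
  have hba : 0 < b - a := sub_pos.2 hab
  have hsq : 2 / Real.pi * (b - a) ^ 2 ≤ s ^ 2 := by
    calc 2 / Real.pi * (b - a) ^ 2 = (√(2 / Real.pi) * (b - a)) ^ 2 := by
          rw [mul_pow, Real.sq_sqrt (by positivity)]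
      _ ≤ s ^ 2 := by gcongr
  have e : 3.5 / (1 - a / b) ^ 2 * (a / b ^ 2) = 3.5 * a / (b - a) ^ 2 := by
    rw [one_sub_div hb.ne']
    field_simp
  rw [e]
  -- The factor `2` divided by `2/π` is `π`, which is below `3.5`.
  calc 2 * t / s ^ 2 ≤ 2 * a / s ^ 2 := by gcongr
    _ ≤ 2 * a / (2 / Real.pi * (b - a) ^ 2) := by gcongr
    _ = Real.pi * a / (b - a) ^ 2 := by field_simp
    _ ≤ 3.5 * a / (b - a) ^ 2 := by
        gcongr
        linarith [Real.pi_lt_d2]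

/-- The recovery bound for every matrix that is well conditioned on the cone. -/
theorem norm_pgd_sub_le_of_conditioned {f : E n → ℝ} {x : E n} {C : Set (E n)} (hf : IsProper f)
    (hc : ConvexOn ℝ univ f) (hC : IsDescentCone f x C) {A : Matrix (Fin m) (Fin n) ℝ} {w : E m}
    {m₀ : ℝ} (h₀ : 0 ≤ m₀) (hm : m₀ < m)
    (h1 : ∀ v ∈ C, ‖v‖ = 1 → phi m - phi m₀ ≤ ‖A.toEuclideanLin v‖)
    (h2 : (phi m - phi m₀) * ‖x‖ ≤ ‖A.toEuclideanLin x‖)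
    (h3 : ∀ v ∈ C, ‖v‖ = 1 → inner ℝ w (A.toEuclideanLin v) ≤ 2 * phi m₀ * ‖w‖)
    (h4 : ∀ v, ‖A.toEuclideanLin v‖ ≤ (phi m + phi n + 0.005 * √n) * ‖v‖) (τ : ℕ) :
    ‖pgd {z | f z ≤ f x} (0.99 / (√m + √n) ^ 2) A (A.toEuclideanLin x + w) τ - x‖ ≤
      (1 - 0.3 / (m + n) * (√m - √m₀) ^ 2) ^ τ * ‖x‖ +
        3.5 / (1 - √(m₀ / m)) ^ 2 * (√m₀ / m) * ‖w‖ := by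
  have hm0 : (0 : ℝ) < m := h₀.trans_lt hm
  have hm1 : (1 : ℝ) ≤ m := by exact_mod_cast Nat.one_le_iff_ne_zero.2 (by rintro rfl; simp at hm0)
  set s := phi m - phi m₀ with hsdef
  have ht := phi_nonneg h₀
  have hab : √m₀ < √m := Real.sqrt_lt_sqrt h₀ hm
  have hs : √(2 / Real.pi) * (√m - √m₀) ≤ s := sqrt_two_div_pi_mul_le_phi_sub h₀ hm.le hm1
  have hsb : s ≤ √m := by linarith [phi_le_sqrt hm0.le]
  have hs0 : 0 < s := lt_of_lt_of_le (mul_pos (by positivity) (sub_pos.2 hab)) hs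
  obtain ⟨hlo, hhi⟩ := step_size_bounds (Real.sqrt_nonneg m₀) hab (Real.sqrt_nonneg n) hs hsb
  have hnoise := noise_constant_le (Real.sqrt_nonneg m₀) hab hs (phi_le_sqrt h₀)
  rw [Real.sq_sqrt hm0.le, Real.sq_sqrt (Nat.cast_nonneg n)] at hlo
  rw [Real.sq_sqrt hm0.le, ← Real.sqrt_div h₀] at hnoise
  have hunit : ∀ u ∈ C, u ≠ 0 → ‖u‖⁻¹ • u ∈ C ∧ ‖‖u‖⁻¹ • u‖ = 1 := fun u hu hu0 =>
    ⟨hC.smul_mem _ (by positivity) u hu, by simp [norm_smul, hu0]⟩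
  have hsq : √m + √n > 0 := by positivity
  have hmain := norm_pgd_sub_le hf hc hC (A := A) (w := w) (μ := 0.99 / (√m + √n) ^ 2) (s := s)
    (t := 2 * phi m₀) (by positivity) (by positivity) hs0 hhi
    (fun u hu => by
      rcases eq_or_ne u 0 with rfl | hu0
      · simp
      have hun := norm_pos_iff.2 hu0
      have := h1 _ (hunit u hu hu0).1 (hunit u hu hu0).2
      rw [map_smul, norm_smul, norm_inv, norm_norm, le_inv_mul_iff₀ hun, mul_comm] at this
      rw [← mul_pow]
      gcongr)
    (by rw [← mul_pow]; gcongr)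
    (fun u hu => by
      rcases eq_or_ne u 0 with rfl | hu0
      · simp
      have hun := norm_pos_iff.2 hu0
      have := h3 _ (hunit u hu hu0).1 (hunit u hu hu0).2
      rw [map_smul, real_inner_smul_right, inv_mul_le_iff₀ hun, mul_comm] at this
      exact this)
    (fun v => by
      -- The slack `0.005 √n` is absorbed in `1.005 (√m + √n)`, and `0.99 · 1.005² < 1`.
      have h5 : ‖A.toEuclideanLin v‖ ≤ 1.005 * (√m + √n) * ‖v‖ := by
        refine (h4 v).trans ?_
        gcongr
        have := phi_le_sqrt hm0.le
        have := phi_le_sqrt (Nat.cast_nonneg (α := ℝ) n)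
        have := Real.sqrt_nonneg m
        linarith
      have h6 := pow_le_pow_left₀ (norm_nonneg _) h5 2
      rw [div_mul_eq_mul_div, div_le_iff₀ (by positivity)]
      have : 0 ≤ ‖v‖ ^ 2 * (√m + √n) ^ 2 := by positivity
      nlinarith) τ
  refine hmain.trans ?_
  gcongr ?_ ^ _ * _ + ?_
  · linarith
  · rw [mul_div_right_comm]
    gcongr

end Recovery

/-! ### Degenerate cases and the count of failure probabilities. -/

section Main

variable {m n : ℕ}

/-- Surjectivity of `phi` alone makes the chosen preimage a genuine one. -/
theorem phaseTransition_nonneg_and_phi_eq {C : Set (E n)} (h0 : 0 ∈ C) {η : ℝ} (hη : 0 ≤ η) :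
    0 ≤ phaseTransition C η ∧
      phi (phaseTransition C η) = gaussianWidth (C ∩ Metric.closedBall 0 1) + η := by
  have hw : 0 ≤ gaussianWidth (C ∩ Metric.closedBall 0 1) :=
    gaussianWidth_nonneg inter_subset_right ⟨h0, by simp⟩
  have h : ∃ a ∈ Ici (0 : ℝ), phi a = gaussianWidth (C ∩ Metric.closedBall 0 1) + η :=
    surjOn_phi (show (0 : ℝ) ≤ _ by positivity)
  exact ⟨Function.invFunOn_mem h, Function.invFunOn_eq h⟩

/-- The feasible set is then the single point `x`, so the first step already lands on it. -/
theorem norm_pgd_sub_le_of_subset_zero {f : E n → ℝ} {x : E n} {C : Set (E n)} (hf : IsProper f)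
    (hc : ConvexOn ℝ univ f) (hC : IsDescentCone f x C) (hC0 : ∀ v ∈ C, v = 0)
    (A : Matrix (Fin m) (Fin n) ℝ) (y : E m) (μ : ℝ) {ρ b : ℝ} (hρ : 0 ≤ ρ) (hb : 0 ≤ b) (τ : ℕ) :
    ‖pgd {z | f z ≤ f x} μ A y τ - x‖ ≤ ρ ^ τ * ‖x‖ + b := by
  cases τ with
  | zero => simpa [pgd] using hb
  | succ τ =>
    rw [hC0 _ (pgd_succ_sub_mem hf hc hC A y μ τ), norm_zero]
    positivity

theorem contraction_factor_nonneg {m₀ : ℝ} (hm : m₀ < m) :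
    0 ≤ 1 - 0.3 / ((m : ℝ) + n) * (√m - √m₀) ^ 2 := by
  have h1 : √m₀ ≤ √m := Real.sqrt_le_sqrt hm.le
  have h2 : (√(m : ℝ) - √m₀) ^ 2 ≤ (m : ℝ) := by
    calc (√(m : ℝ) - √m₀) ^ 2 ≤ √(m : ℝ) ^ 2 := by
          have := Real.sqrt_nonneg m₀
          gcongr
          linarith
      _ = (m : ℝ) := Real.sq_sqrt (Nat.cast_nonneg m)
  have h3 : (0 : ℝ) ≤ m := Nat.cast_nonneg m
  have h4 : (0 : ℝ) ≤ n := Nat.cast_nonneg n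
  rw [div_mul_eq_mul_div, sub_nonneg]
  exact div_le_one_of_le₀ (by nlinarith) (by positivity)

/-- The smallness assumption forces `η ≥ 1.1`. With `e = e^{-η²/2} < 1/2`, the first term is at most
`e · e^{-ωη} ≤ (5/7) e` and the second at most `e⁴ ≤ e/8`. -/
theorem exp_add_exp_le {ω η : ℝ} (hω : 0.39 ≤ ω) (hη0 : 0 ≤ η)
    (hη : 2 * Real.exp (-η ^ 2 / 2) < 1) :
    Real.exp (-(ω + η) ^ 2 / 2) + Real.exp (-(ω + 2 * η) ^ 2 / 2) ≤ Real.exp (-η ^ 2 / 2) := by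
  have hη1 : 1.1 ≤ η := by
    by_contra h
    push Not at h
    have h1 : Real.exp (-Real.log 2) ≤ Real.exp (-η ^ 2 / 2) := by
      gcongr
      nlinarith [Real.log_two_gt_d9]
    rw [Real.exp_neg, Real.exp_log two_pos] at h1
    linarith
  set e := Real.exp (-η ^ 2 / 2) with he
  have he0 : 0 < e := Real.exp_pos _
  set q := Real.exp (-(ω * η)) with hq
  have hq0 : 0 < q := Real.exp_pos _
  have hq1 : q ≤ 5 / 7 := by
    have h1 : 1.4 ≤ Real.exp (ω * η) := by
      have := Real.add_one_le_exp (ω * η)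
      nlinarith
    rw [hq, Real.exp_neg]
    calc (Real.exp (ω * η))⁻¹ ≤ 1.4⁻¹ := by gcongr
      _ = 5 / 7 := by norm_num
  have h1 : Real.exp (-(ω + η) ^ 2 / 2) ≤ e * q := by
    rw [he, hq, ← Real.exp_add]
    gcongr
    nlinarith [sq_nonneg ω]
  have h2 : Real.exp (-(ω + 2 * η) ^ 2 / 2) ≤ e * e ^ 3 := by
    rw [he, ← Real.exp_nat_mul, ← Real.exp_add]
    gcongr
    push_cast
    nlinarith [mul_nonneg (by linarith : 0 ≤ ω) hη0, sq_nonneg ω]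
  have h3 : e ^ 3 ≤ (1 / 2) ^ 3 := by
    gcongr
    linarith
  nlinarith

/-- Subadditivity replaces the complement formula, so the success event need not be measurable. -/
theorem one_sub_le_measureReal {Ω : Type*} [MeasurableSpace Ω] (P : Measure Ω)
    [IsProbabilityMeasure P] {S : Set Ω} {δ : ℝ} (hδ : 0 ≤ δ)
    (h : P Sᶜ ≤ ENNReal.ofReal δ) : 1 - δ ≤ P.real S := by
  have h1 : P.real univ ≤ P.real S + P.real Sᶜ := by
    rw [← union_compl_self S]
    exact measureReal_union_le _ _
  have h2 : P.real Sᶜ ≤ δ := ENNReal.toReal_le_of_le_ofReal hδ h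
  rw [probReal_univ] at h1
  linarith

theorem phi_one_div_two_ge : 0.39 ≤ phi 1 / 2 := by
  have h := sqrt_two_div_pi_mul_le_phi_sub le_rfl zero_le_one le_rfl
  rw [phi_zero, Real.sqrt_one, Real.sqrt_zero, sub_zero, sub_zero, mul_one] at h
  have h2 : 0.78 ≤ √(2 / Real.pi) := by
    refine Real.le_sqrt_of_sq_le ?_
    rw [le_div_iff₀ Real.pi_pos]
    linarith [Real.pi_lt_d2]
  linarith

end Main

end PGD

theorem theorem3 :
    ∃ γ : ℝ, 0 < γ ∧
      ∀ (m n : ℕ) (x : PGD.E n) (w : PGD.E m) (f : PGD.E n → ℝ) (C : Set (PGD.E n)) (η : ℝ),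
        PGD.IsProper f →
        ConvexOn ℝ Set.univ f →
        PGD.IsDescentCone f x C →
        0 ≤ η →
        PGD.phaseTransition C η < m →
        ∀ {Ω : Type*} [MeasurableSpace Ω] (P : Measure Ω) [IsProbabilityMeasure P]
          (A : Ω → Matrix (Fin m) (Fin n) ℝ),
          PGD.IsGaussianMap P A →
          1 - 2 * Real.exp (-η ^ 2 / 2) - Real.exp (-γ * n) ≤
            P.real {s | ∀ τ : ℕ,
              ‖PGD.pgd {z | f z ≤ f x} (0.99 / (√m + √n) ^ 2) (A s)
                  ((A s).toEuclideanLin x + w) τ - x‖ ≤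
                (1 - 0.3 / (m + n) * (√m - √(PGD.phaseTransition C η)) ^ 2) ^ τ * ‖x‖ +
                  3.5 / (1 - √(PGD.phaseTransition C η / m)) ^ 2 *
                    (√(PGD.phaseTransition C η) / m) * ‖w‖} := by
  -- `γ = 0.005² / 2`, from the deviation `0.005 √n` allowed in the operator norm.
  refine ⟨0.0000125, by norm_num, ?_⟩
  intro m n x w f C η hf hc hC hη hm Ω _ P _ A hA
  have h0 : (0 : PGD.E n) ∈ C := hC.descentSet_subset (by simp [PGD.descentSet])
  obtain ⟨hm0, hphi⟩ := PGD.phaseTransition_nonneg_and_phi_eq h0 hη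
  set m₀ := PGD.phaseTransition C η with hm₀
  set ω := PGD.gaussianWidth (C ∩ Metric.closedBall 0 1) with hωdef
  set S := {s | ∀ τ : ℕ,
      ‖PGD.pgd {z | f z ≤ f x} (0.99 / (√m + √n) ^ 2) (A s)
        ((A s).toEuclideanLin x + w) τ - x‖ ≤
          (1 - 0.3 / (m + n) * (√m - √m₀) ^ 2) ^ τ * ‖x‖ +
            3.5 / (1 - √(m₀ / m)) ^ 2 * (√m₀ / m) * ‖w‖} with hS
  have hexp2 := Real.exp_pos (-0.0000125 * (n : ℝ))
  have hexp1 := Real.exp_pos (-η ^ 2 / 2)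
  -- In this case, and for `n = 0`, the claimed lower bound on the probability is not positive.
  rcases le_or_gt 1 (2 * Real.exp (-η ^ 2 / 2)) with hbig | hsmall
  · exact le_trans (by linarith) measureReal_nonneg
  rcases Nat.eq_zero_or_pos n with hn | hn
  · refine le_trans ?_ measureReal_nonneg
    rw [hn, Nat.cast_zero, mul_zero, Real.exp_zero]
    linarith
  have hmpos : 0 < m := by
    have : (0 : ℝ) < m := hm0.trans_lt hm
    exact_mod_cast this
  set D := C ∩ Metric.closedBall (0 : PGD.E n) 1 with hD
  set T := {v : PGD.E n | v ∈ C ∧ ‖v‖ = 1} with hT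
  have hDB : D ⊆ Metric.closedBall 0 1 := Set.inter_subset_right
  have hTD : T ⊆ D := fun v hv => ⟨hv.1, by simp [hv.2]⟩
  have hT1 : ∀ v ∈ T, ‖v‖ = 1 := fun v hv => hv.2
  have h0D : (0 : PGD.E n) ∈ D := ⟨h0, by simp⟩
  -- Without unit vectors `C = {0}` and the lower bound on `ω` is lost, but the conclusion is
  -- deterministic.
  rcases T.eq_empty_or_nonempty with hTe | hTne
  · have hC0 : ∀ v ∈ C, v = 0 := by
      intro v hv
      by_contra hv0
      have : ‖v‖⁻¹ • v ∈ T :=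
        ⟨hC.smul_mem _ (by positivity) v hv, by simp [norm_smul, hv0]⟩
      rw [hTe] at this
      exact this
    have hall : S = Set.univ := Set.eq_univ_of_forall fun s τ =>
      PGD.norm_pgd_sub_le_of_subset_zero hf hc hC hC0 (A s) _ _
        (PGD.contraction_factor_nonneg hm) (by positivity) τ
    rw [hall, probReal_univ]
    linarith
  have hω : 0.39 ≤ ω := by
    obtain ⟨v, hv⟩ := hTne
    exact PGD.phi_one_div_two_ge.trans
      (PGD.phi_one_div_two_le_gaussianWidth hDB h0D (hTD hv) hv.2)
  have hω0 : 0 ≤ ω := by linarith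
  have hn0 : (0 : ℝ) ≤ n := Nat.cast_nonneg n
  rw [sub_sub]
  refine PGD.one_sub_le_measureReal P (by positivity) ?_
  -- The deviations are `η`, `ω + η`, `ω + 2η` and `0.005 √n`. The second and third are the largest
  -- compatible with the levels `φ(m) - φ(m₀)` and `2 φ(m₀) = ω + (ω + 2η)`.
  have hsub : Sᶜ ⊆ (({s | ∃ v ∈ T, ‖(A s).toEuclideanLin v‖ < PGD.phi m - ω - η} ∪
      {s | ‖(A s).toEuclideanLin x‖ < (PGD.phi m - (ω + η)) * ‖x‖}) ∪
      {s | ∃ v ∈ T, (ω + (ω + 2 * η)) * ‖w‖ < inner ℝ w ((A s).toEuclideanLin v)}) ∪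
      {s | ∃ v : PGD.E n, (PGD.phi m + PGD.phi n + 0.005 * √n) * ‖v‖ <
        ‖(A s).toEuclideanLin v‖} := by
    intro s hs
    by_contra hcon
    simp only [Set.mem_union, Set.mem_ofPred_eq, not_or, not_exists, not_and, not_lt] at hcon
    obtain ⟨⟨⟨g1, g2⟩, g3⟩, g4⟩ := hcon
    refine hs fun τ => PGD.norm_pgd_sub_le_of_conditioned hf hc hC hm0 hm ?_ ?_ ?_ g4 τ
    · intro v hv hv1
      rw [hphi, ← sub_sub]
      exact g1 v ⟨hv, hv1⟩
    · rw [hphi]; exact g2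
    · intro v hv hv1
      rw [hphi]
      refine (g3 v ⟨hv, hv1⟩).trans_eq ?_
      ring
  have b1 := (hA.measure_le fun M => ∃ v ∈ T, ‖M.toEuclideanLin v‖ < PGD.phi m - ω - η).trans
    (PGD.measure_exists_norm_lt_le hDB hTD hTne hT1 hmpos hη)
  have b2 := (hA.measure_le fun M => ‖M.toEuclideanLin x‖ < (PGD.phi m - (ω + η)) * ‖x‖).trans
    (PGD.measure_norm_lt_mul_norm_le x hmpos (by positivity))
  have b3 := (hA.measure_le fun M => ∃ v ∈ T, (ω + (ω + 2 * η)) * ‖w‖ <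
      inner ℝ w (M.toEuclideanLin v)).trans
    (PGD.measure_exists_mul_norm_lt_inner_le hDB hTD hTne hT1 w
      (t := ω + 2 * η) (by positivity))
  have b4 := (hA.measure_le fun M => ∃ v : PGD.E n,
      (PGD.phi m + PGD.phi n + 0.005 * √n) * ‖v‖ < ‖M.toEuclideanLin v‖).trans
    (PGD.measure_opNorm_le hmpos hn (t := 0.005 * √n) (by positivity))
  have e4 : -(0.005 * √(n : ℝ)) ^ 2 / 2 = -0.0000125 * (n : ℝ) := by
    rw [mul_pow, Real.sq_sqrt hn0]
    ring
  rw [e4] at b4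
  have hsum := PGD.exp_add_exp_le hω hη hsmall
  calc P Sᶜ ≤ _ := measure_mono hsub
    _ ≤ _ := (measure_union_le _ _).trans (add_le_add ((measure_union_le _ _).trans
        (add_le_add ((measure_union_le _ _).trans (add_le_add b1 b2)) b3)) b4)
    _ = ENNReal.ofReal (Real.exp (-η ^ 2 / 2) + Real.exp (-(ω + η) ^ 2 / 2) +
        Real.exp (-(ω + 2 * η) ^ 2 / 2) + Real.exp (-0.0000125 * (n : ℝ))) := by
      rw [← ENNReal.ofReal_add (by positivity) (by positivity),
        ← ENNReal.ofReal_add (by positivity) (by positivity),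
        ← ENNReal.ofReal_add (by positivity) (by positivity)]
    _ ≤ _ := by
      gcongr
      linarith
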